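/- A \emph{cluster graph} is a graph in which every connected component is a complete graph. A \emph{cluster deletion set} of a finite simple graph $G$ is a set $S \subseteq V(G)$ such that $G - S$ is a cluster graph. A \emph{connected vertex cover} of $G$ is a set $X \subseteq V(G)$ that contains at least one endpoint of every edge of $G$ and induces a connected (in particular non-empty) subgraph $G[X]$. \textbf{Theorem.} There is an algorithm that, given a finite simple graph $G$, a cluster deletion set $S$ of $G$ and a positive integer $\ell$, determines whether $G$ has a connected vertex cover of size at most $\ell$ in $\mathcal{O}^*(4^{|S|})$ time. That is, there are a single random access machine (with logarithmic cost measure) and constants $C, d$ such that on every such instance $(G,S,\ell)$ the machine halts with the correct answer within time $C \cdot 4^{|S|} \cdot N^{d}$, where $N$ is the size of the instance, written as the number of vertices, the number $\ell$ in binary, the adjacency matrix of $G$ and the characteristic vector of $S$. -/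

import Mathlib

/-! ## Graph notions -/

section Graphs

variable {V : Type*}

/-- A cluster graph: every connected component is a complete graph. -/
def IsClusterGraph (G : SimpleGraph V) : Prop :=
  ∀ c : G.ConnectedComponent, G.IsClique c.supp

/-- `S` is a cluster deletion set of `G`: the graph `G - S` is a cluster graph. -/
def IsClusterDeletionSet (G : SimpleGraph V) (S : Finset V) : Prop :=
  IsClusterGraph (G.induce ((S : Set V)ᶜ))

/-- `G` has a connected vertex cover of size at most `ℓ`: a vertex cover with at most `ℓ`
vertices that induces a connected (in particular non-empty) subgraph. -/
def HasConnectedVertexCover (G : SimpleGraph V) (ℓ : ℕ) : Prop :=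
  ∃ X : Finset V,
    G.IsVertexCover (X : Set V) ∧ (G.induce (X : Set V)).Connected ∧ X.card ≤ ℓ

end Graphs

/-! ## Random access machines with logarithmic cost

Programs are written in structured form over finitely many registers and a memory that can be
addressed indirectly; both hold natural numbers. Every value that is read or computed is charged
its length in binary. -/

namespace RAM

/-- The contents of the registers and of the memory. -/
structure State where
  /-- the registers, addressed directly by the program -/
  reg : ℕ → ℕ
  /-- the memory, addressed by computed values -/
  mem : ℕ → ℕ

/-- Arithmetic terms. -/
inductive Term where
  /-- a constant -/
  | const (c : ℕ)
  /-- the content of a fixed register -/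
  | reg (r : ℕ)
  /-- the content of the memory cell whose address is the value of the term -/
  | mem (a : Term)
  /-- sum -/
  | add (a b : Term)
  /-- difference, cut off at zero -/
  | sub (a b : Term)
  /-- product -/
  | mul (a b : Term)
  /-- half, rounded down -/
  | half (a : Term)
  /-- comparison: `1` if the first value is smaller than the second one, otherwise `0` -/
  | lt (a b : Term)

/-- The value of a term in a state. -/
def Term.value (s : State) : Term → ℕ
  | .const c => c
  | .reg r => s.reg r
  | .mem a => s.mem (a.value s)
  | .add a b => a.value s + b.value s
  | .sub a b => a.value s - b.value s
  | .mul a b => a.value s * b.value s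
  | .half a => a.value s / 2
  | .lt a b => if a.value s < b.value s then 1 else 0

/-- The time needed to compute the value of a term: every node of the term is charged one plus the
binary length of its value (a comparison just one); a product is charged, in addition, the product
of the binary lengths of its factors. -/
def Term.cost (s : State) : Term → ℕ
  | .const c => c.size + 1
  | .reg r => (s.reg r).size + 1
  | .mem a => a.cost s + (s.mem (a.value s)).size + 1
  | .add a b => a.cost s + b.cost s + (a.value s + b.value s).size + 1
  | .sub a b => a.cost s + b.cost s + (a.value s - b.value s).size + 1
  | .mul a b => a.cost s + b.cost s + (a.value s).size * (b.value s).size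
      + (a.value s * b.value s).size + 1
  | .half a => a.cost s + (a.value s / 2).size + 1
  | .lt a b => a.cost s + b.cost s + 1

/-- Programs. -/
inductive Program where
  /-- do nothing -/
  | skip
  /-- write the value of `e` into the register `r` -/
  | assign (r : ℕ) (e : Term)
  /-- write the value of `e` into the memory cell whose address is the value of `a` -/
  | store (a e : Term)
  /-- run `p`, then `q` -/
  | seq (p q : Program)
  /-- run `p` if the value of `b` is not zero, otherwise `q` -/
  | ite (b : Term) (p q : Program)
  /-- run `p` as long as the value of `b` is not zero -/
  | while (b : Term) (p : Program)

/-- `Exec p s s' t`: the program `p`, started in the state `s`, halts in the state `s'` after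
time exactly `t`. -/
inductive Exec : Program → State → State → ℕ → Prop
  | skip (s : State) : Exec .skip s s 1
  | assign (r : ℕ) (e : Term) (s : State) :
      Exec (.assign r e) s ⟨Function.update s.reg r (e.value s), s.mem⟩ (e.cost s + 1)
  | store (a e : Term) (s : State) :
      Exec (.store a e) s ⟨s.reg, Function.update s.mem (a.value s) (e.value s)⟩
        (a.cost s + e.cost s + 1)
  | seq {p q : Program} {s s' s'' : State} {t t' : ℕ} :
      Exec p s s' t → Exec q s' s'' t' → Exec (.seq p q) s s'' (t + t')
  | ite_true {b : Term} {p q : Program} {s s' : State} {t : ℕ} :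
      b.value s ≠ 0 → Exec p s s' t → Exec (.ite b p q) s s' (b.cost s + t + 1)
  | ite_false {b : Term} {p q : Program} {s s' : State} {t : ℕ} :
      b.value s = 0 → Exec q s s' t → Exec (.ite b p q) s s' (b.cost s + t + 1)
  | while_true {b : Term} {p : Program} {s s' s'' : State} {t t' : ℕ} :
      b.value s ≠ 0 → Exec p s s' t → Exec (.while b p) s' s'' t' →
        Exec (.while b p) s s'' (b.cost s + t + t' + 1)
  | while_false {b : Term} {p : Program} {s : State} :
      b.value s = 0 → Exec (.while b p) s s (b.cost s + 1)

/-- The machine is deterministic: the final state and the running time are determined by the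
program and the initial state. -/
theorem Exec.unique {p : Program} {s s₁ s₂ : State} {t₁ t₂ : ℕ}
    (h₁ : Exec p s s₁ t₁) (h₂ : Exec p s s₂ t₂) : s₁ = s₂ ∧ t₁ = t₂ := by
  induction h₁ generalizing s₂ t₂ with
  | skip => cases h₂; exact ⟨rfl, rfl⟩
  | assign => cases h₂; exact ⟨rfl, rfl⟩
  | store => cases h₂; exact ⟨rfl, rfl⟩
  | seq _ _ ih ih' =>
    cases h₂ with
    | seq k k' =>
      obtain ⟨rfl, rfl⟩ := ih k
      obtain ⟨rfl, rfl⟩ := ih' k'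
      exact ⟨rfl, rfl⟩
  | ite_true hb _ ih =>
    cases h₂ with
    | ite_true _ k => obtain ⟨rfl, rfl⟩ := ih k; exact ⟨rfl, rfl⟩
    | ite_false hb' _ => exact absurd hb' hb
  | ite_false hb _ ih =>
    cases h₂ with
    | ite_true hb' _ => exact absurd hb hb'
    | ite_false _ k => obtain ⟨rfl, rfl⟩ := ih k; exact ⟨rfl, rfl⟩
  | while_true hb _ _ ih ih' =>
    cases h₂ with
    | while_true _ k k' =>
      obtain ⟨rfl, rfl⟩ := ih k
      obtain ⟨rfl, rfl⟩ := ih' k'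
      exact ⟨rfl, rfl⟩
    | while_false hb' => exact absurd hb' hb
  | while_false hb =>
    cases h₂ with
    | while_true hb' _ _ => exact absurd hb hb'
    | while_false => exact ⟨rfl, rfl⟩

/-- The initial state on an input word: the word is written into the memory cells `0, 1, 2, …`,
register `0` holds its length, everything else is zero. -/
def init (w : List ℕ) : State where
  reg r := if r = 0 then w.length else 0
  mem i := w.getD i 0

/-- The size of an input word: its entries are written in binary, each with one separator. -/
def inputSize (w : List ℕ) : ℕ :=
  (w.map fun a => a.size + 1).sum

/-- On the input word `w`, the program `p` halts within time `T` and leaves in register `0` the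
answer to the question whether `A` holds: `1` for yes, `0` for no. -/
def DecidesWithin (p : Program) (w : List ℕ) (A : Prop) (T : ℕ) : Prop :=
  ∃ (s : State) (t : ℕ), Exec p (init w) s t ∧ t ≤ T ∧
    (A → s.reg 0 = 1) ∧ (¬ A → s.reg 0 = 0)

end RAM

/-! ## Instances as input words -/

open Classical in
/-- The input word of an instance `(G, S, ℓ)`, where `G` is a graph with vertices `0, …, n - 1`:
the number `n`, the number `ℓ`, the `n * n` entries of the adjacency matrix of `G` row by row, and
the `n` entries of the characteristic vector of `S`. -/
noncomputable def encodeInstance {n : ℕ} (G : SimpleGraph (Fin n)) (S : Finset (Fin n)) (ℓ : ℕ) :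
    List ℕ :=
  [n, ℓ]
    ++ (List.finRange n).flatMap
        (fun u => (List.finRange n).map fun v => if G.Adj u v then 1 else 0)
    ++ (List.finRange n).map fun v => if v ∈ S then 1 else 0

/-!
Let `T` consist of the cluster deletion set `S` and of a vertex `r`, the root, that is guessed to be
in the cover, and let `A` be the part of the cover in `T`. A code is a number with `|S|` digits in
base `4`. The digit `3` excludes a vertex of `S` from the cover; the digits `0`, `1`, `2` include
it, and the sequence of the digits of the included vertices directs a search with three-way
branchings. So each of the `4 ^ |S|` codes stands for a guess of `A` together with a branch of the
search.

The search enlarges a set `Y` of vertices known to be in the cover, which initially contains `A` and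
some forced vertices. Of three undecided vertices in a clique outside `T`, at least two belong to
the cover. If one of the pairs can be added to `Y` without lowering the number of components of `Y`
that meet `A`, then an exchange argument (`exists_extends_of_triple`) shows that the third vertex
may be taken into the cover. Otherwise the next digit selects a pair, and it is paid for by a
component. Pairs of adjacent undecided vertices are treated in the same way
(`exists_extends_of_pair`). In the end `Y` is a vertex cover all of whose components meet `A`, and
the number of its components plus the number of digits read is at most `|A|` (`exists_search`).

The digits that are not read may be assumed to be zero, so `Y` has at most `z + 1` components, where
`z` is the number of trailing zeros among the digits of the included vertices
(`exists_succeeds`). The remaining problem, to link the components by the least number of further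
vertices, is solved by a dynamic program over the `2 ^ (z + 1)` sets of components (`Table.final`);
the vertices that are added to a vertex cover are pairwise nonadjacent, so each of them links all
components that it meets, and nothing else has to be recorded. The sum of `2 ^ z` over all codes
is at most `2 * 4 ^ |S|` (`sum_two_pow_zeros`), whence the running time.

The algorithm is written in a language of bounded loops with arrays, whose programs are functions on
states with a number of steps. The language is translated into programs of the machine once and for
all (`simulation`): as values grow by at most `4` in each step, apart from sums that are clamped to
stay below the value of a variable, all values remain small, and every step takes time at most
quadratic in their binary length.
-/

/-! ### A language of bounded loops -/

namespace LoopLang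

/-- A state of the loop language: numerical variables and unbounded arrays. -/
structure Store where
  /-- the variables -/
  v : ℕ → ℕ
  /-- the arrays; array `0` holds the input and is never written -/
  a : ℕ → ℕ → ℕ

namespace Store

/-- Overwrite a variable. -/
def setV (s : Store) (x m : ℕ) : Store := ⟨Function.update s.v x m, s.a⟩

/-- Overwrite an array cell. -/
def setA (s : Store) (k i m : ℕ) : Store :=
  ⟨s.v, Function.update s.a k (Function.update (s.a k) i m)⟩

@[simp] theorem setV_v (s : Store) (x m y : ℕ) : (s.setV x m).v y = if y = x then m else s.v y := by
  simp [setV, Function.update_apply]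

@[simp] theorem setV_a (s : Store) (x m : ℕ) : (s.setV x m).a = s.a := rfl

@[simp] theorem setA_v (s : Store) (k i m : ℕ) : (s.setA k i m).v = s.v := rfl

@[simp] theorem setA_a (s : Store) (k i m l : ℕ) :
    (s.setA k i m).a l = if l = k then Function.update (s.a k) i m else s.a l := by
  by_cases h : l = k <;> simp [setA, h]

end Store

/-- Expressions of the loop language. -/
inductive Ex where
  /-- a constant -/
  | const (c : ℕ)
  /-- a variable -/
  | var (x : ℕ)
  /-- an entry of an array -/
  | arr (k : ℕ) (e : Ex)
  /-- sum -/
  | add (a b : Ex)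
  /-- truncated difference -/
  | sub (a b : Ex)
  /-- product -/
  | mul (a b : Ex)
  /-- half, rounded down -/
  | half (a : Ex)
  /-- comparison, with value `0` or `1` -/
  | lt (a b : Ex)

namespace Ex

/-- The value of an expression. -/
@[simp] def val (s : Store) : Ex → ℕ
  | const c => c
  | var x => s.v x
  | arr k e => s.a k (e.val s)
  | add a b => a.val s + b.val s
  | sub a b => a.val s - b.val s
  | mul a b => a.val s * b.val s
  | half a => a.val s / 2
  | lt a b => if a.val s < b.val s then 1 else 0

/-- Translation into terms of the machine. Register `1` holds the length of the input word. The
input is read in place, with a guard that makes it zero beyond its end; array `k` for `0 < k < 8`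
occupies the cells behind the input whose offset is congruent to `k` modulo `8`. -/
def term : Ex → RAM.Term
  | const c => .const c
  | var x => .reg x
  | arr k e =>
    if k = 0 then .mul (.lt e.term (.reg 1)) (.mem e.term)
    else .mem (.add (.reg 1) (.add (.mul e.term (.const 8)) (.const k)))
  | add a b => .add a.term b.term
  | sub a b => .sub a.term b.term
  | mul a b => .mul a.term b.term
  | half a => .half a.term
  | lt a b => .lt a.term b.term

/-- All arrays that are read have a number below `8`. -/
def wf : Ex → Bool
  | const _ => true
  | var _ => true
  | arr k e => decide (k < 8) && e.wf
  | add a b => a.wf && b.wf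
  | sub a b => a.wf && b.wf
  | mul a b => a.wf && b.wf
  | half a => a.wf
  | lt a b => a.wf && b.wf

/-- A syntactic guarantee that the value does not exceed all values present in the store
(and `1`). -/
def safe : Ex → Bool
  | const c => decide (c ≤ 1)
  | var _ => true
  | arr _ _ => true
  | add _ _ => false
  | sub a _ => a.safe
  | mul _ _ => false
  | half a => a.safe
  | lt _ _ => true

/-- A syntactic guarantee that the value exceeds those present in the store by at most `4`. -/
def slow : Ex → Bool
  | add a (const c) => a.safe && decide (c ≤ 4)
  | e => e.safe

end Ex

/-- Programs of the loop language. -/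
inductive Cmd where
  /-- do nothing -/
  | skip
  /-- assignment to a variable -/
  | set (x : ℕ) (e : Ex)
  /-- assignment to a variable, with value zero unless the value of `e` is below that of `y` -/
  | setC (x : ℕ) (e : Ex) (y : ℕ)
  /-- assignment to an array cell -/
  | aset (k : ℕ) (i e : Ex)
  /-- sequential composition -/
  | seq (p q : Cmd)
  /-- case distinction -/
  | ite (b : Ex) (p q : Cmd)
  /-- run `p` for the values `0, 1, …, b - 1` of the variable `i`, where `b` is a variable -/
  | loop (i b : ℕ) (p : Cmd)

namespace Cmd

/-- The state in which a loop with body `f` and counter `i` begins round `j`. -/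
def iter (f : Store → Store) (i : ℕ) (s : Store) : ℕ → Store
  | 0 => s.setV i 0
  | j + 1 => (f (iter f i s j)).setV i (j + 1)

/-- The final state of a program. -/
def run : Cmd → Store → Store
  | skip, s => s
  | set x e, s => s.setV x (e.val s)
  | setC x e y, s => s.setV x (if e.val s < s.v y then e.val s else 0)
  | aset k i e, s => s.setA k (i.val s) (e.val s)
  | seq p q, s => q.run (p.run s)
  | ite b p q, s => if b.val s ≠ 0 then p.run s else q.run s
  | loop i b p, s => iter p.run i s (s.v b)

/-- The number of elementary steps of a program. -/
def steps : Cmd → Store → ℕ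
  | skip, _ => 1
  | set _ _, _ => 1
  | setC _ _ _, _ => 1
  | aset _ _ _, _ => 1
  | seq p q, s => p.steps s + q.steps (p.run s)
  | ite b p q, s => 1 + if b.val s ≠ 0 then p.steps s else q.steps s
  | loop i b p, s => 2 + ∑ j ∈ Finset.range (s.v b), (p.steps (iter p.run i s j) + 2)

/-- The variables written by a program. -/
def wv : Cmd → ℕ → Bool
  | skip, _ => false
  | set x _, y => decide (y = x)
  | setC x _ _, y => decide (y = x)
  | aset _ _ _, _ => false
  | seq p q, y => p.wv y || q.wv y
  | ite _ p q, y => p.wv y || q.wv y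
  | loop i _ p, y => decide (y = i) || p.wv y

/-- The arrays written by a program. -/
def wa : Cmd → ℕ → Bool
  | skip, _ => false
  | set _ _, _ => false
  | setC _ _ _, _ => false
  | aset k _ _, l => decide (l = k)
  | seq p q, l => p.wa l || q.wa l
  | ite _ p q, l => p.wa l || q.wa l
  | loop _ _ p, l => p.wa l

/-- Well-formed programs: the input and its length are never written, loop bounds and counters are
not written by the body of the loop, and values grow slowly. -/
def wf : Cmd → Bool
  | skip => true
  | set x e => decide (x ≠ 1) && e.wf && e.slow
  | setC x e _ => decide (x ≠ 1) && e.wf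
  | aset k i e => decide (k ≠ 0) && decide (k < 8) && i.wf && e.wf && e.slow
  | seq p q => p.wf && q.wf
  | ite b p q => b.wf && p.wf && q.wf
  | loop i b p => decide (i ≠ 1) && decide (i ≠ b) && !p.wv i && !p.wv b && p.wf

/-- Translation into programs of the machine. -/
def prog : Cmd → RAM.Program
  | skip => .skip
  | set x e => .assign x e.term
  | setC x e y => .assign x (.mul (.lt e.term (.reg y)) e.term)
  | aset k i e => .store (.add (.reg 1) (.add (.mul i.term (.const 8)) (.const k))) e.term
  | seq p q => .seq p.prog q.prog
  | ite b p q => .ite b.term p.prog q.prog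
  | loop i b p => .seq (.assign i (.const 0))
      (.while (.lt (.reg i) (.reg b)) (.seq p.prog (.assign i (.add (.reg i) (.const 1)))))

/-- Two states agree on everything that a program does not write. -/
def Agree (p : Cmd) (s t : Store) : Prop :=
  (∀ x, p.wv x = false → t.v x = s.v x) ∧ ∀ k, p.wa k = false → t.a k = s.a k

/-- A program changes only what it writes. -/
theorem run_agree (p : Cmd) (s : Store) : p.Agree s (p.run s) := by
  induction p generalizing s with
  | skip => exact ⟨fun _ _ => rfl, fun _ _ => rfl⟩
  | set x e => exact ⟨fun y h => by simp_all [wv, run], fun _ _ => rfl⟩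
  | setC x e y => exact ⟨fun y h => by simp_all [wv, run], fun _ _ => rfl⟩
  | aset k i e => exact ⟨fun _ _ => rfl, fun l h => by simp_all [wa, run]⟩
  | seq p q ihp ihq =>
    refine ⟨fun x h => ?_, fun k h => ?_⟩
    · simp only [wv, Bool.or_eq_false_iff] at h
      exact ((ihq _).1 x h.2).trans ((ihp s).1 x h.1)
    · simp only [wa, Bool.or_eq_false_iff] at h
      exact ((ihq _).2 k h.2).trans ((ihp s).2 k h.1)
  | ite b p q ihp ihq =>
    refine ⟨fun x h => ?_, fun k h => ?_⟩
    · simp only [wv, Bool.or_eq_false_iff] at h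
      simp only [run]
      split_ifs
      exacts [(ihp s).1 x h.1, (ihq s).1 x h.2]
    · simp only [wa, Bool.or_eq_false_iff] at h
      simp only [run]
      split_ifs
      exacts [(ihp s).2 k h.1, (ihq s).2 k h.2]
  | loop i b p ih =>
    simp only [run]
    generalize s.v b = m
    induction m with
    | zero =>
      refine ⟨fun x h => ?_, fun k h => rfl⟩
      simp only [wv, Bool.or_eq_false_iff, decide_eq_false_iff_not] at h
      simp [iter, h.1]
    | succ m im =>
      refine ⟨fun x h => ?_, fun k h => ?_⟩
      · have h' := h
        simp only [wv, Bool.or_eq_false_iff, decide_eq_false_iff_not] at h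
        simp only [iter, Store.setV_v, h.1, if_false]
        exact ((ih _).1 x h.2).trans (im.1 x h')
      · exact ((ih _).2 k h).trans (im.2 k h)

theorem iter_agree (p : Cmd) (i b : ℕ) (s : Store) (j : ℕ) :
    (loop i b p).Agree s (iter p.run i s j) := by
  induction j with
  | zero =>
    refine ⟨fun x h => ?_, fun k h => rfl⟩
    simp only [wv, Bool.or_eq_false_iff, decide_eq_false_iff_not] at h
    simp [iter, h.1]
  | succ m im =>
    refine ⟨fun x h => ?_, fun k h => ?_⟩
    · have h' := h
      simp only [wv, Bool.or_eq_false_iff, decide_eq_false_iff_not] at h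
      simp only [iter, Store.setV_v, h.1, if_false]
      exact ((p.run_agree _).1 x h.2).trans (im.1 x h')
    · exact ((p.run_agree _).2 k h).trans (im.2 k h)

theorem iter_counter (f : Store → Store) (i : ℕ) (s : Store) (j : ℕ) : (iter f i s j).v i = j := by
  cases j <;> simp [iter]

/-- The invariant rule for loops. -/
theorem loop_rule {p : Cmd} {i b : ℕ} {s : Store} (I : ℕ → Store → Prop)
    (h0 : I 0 (s.setV i 0))
    (hs : ∀ j t, j < s.v b → (loop i b p).Agree s t → t.v i = j → I j t →
      I (j + 1) ((p.run t).setV i (j + 1))) :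
    I (s.v b) ((loop i b p).run s) := by
  have : ∀ j ≤ s.v b, I j (iter p.run i s j) := by
    intro j hj
    induction j with
    | zero => exact h0
    | succ j ih =>
      exact hs j _ hj (iter_agree p i b s j) (iter_counter _ _ _ _) (ih (by omega))
  exact this _ le_rfl

end Cmd

/-! ### Simulation on the machine -/

/-- All registers and memory cells hold values at most `B`. -/
def Below (B : ℕ) (σ : RAM.State) : Prop := (∀ r, σ.reg r ≤ B) ∧ ∀ i, σ.mem i ≤ B

/-- An exponent `d` such that the value of the term is at most `(B + 2) ^ d` in every state with
values at most `B`. -/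
def deg : RAM.Term → ℕ
  | .const c => c + 1
  | .reg _ => 1
  | .mem _ => 1
  | .add a b => deg a + deg b
  | .sub a _ => deg a
  | .mul a b => deg a + deg b
  | .half a => deg a
  | .lt _ _ => 1

theorem deg_pos (e : RAM.Term) : 0 < deg e := by
  induction e <;> simp_all [deg]

theorem value_le_pow {B : ℕ} {σ : RAM.State} (h : Below B σ) (e : RAM.Term) :
    e.value σ ≤ (B + 2) ^ deg e := by
  have two : ∀ d, 0 < d → 2 ≤ (B + 2) ^ d := fun d hd =>
    le_trans (by omega) (Nat.le_self_pow hd.ne' (B + 2))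
  induction e with
  | const c =>
    simp only [RAM.Term.value, deg]
    calc c ≤ 2 ^ (c + 1) := le_trans (Nat.le_succ c) (Nat.lt_two_pow_self).le
      _ ≤ _ := Nat.pow_le_pow_left (by omega) _
  | reg r => simpa [RAM.Term.value, deg] using (h.1 r).trans (by omega)
  | mem a => simpa [RAM.Term.value, deg] using (h.2 _).trans (by omega)
  | add a b iha ihb =>
    have ha := two _ (deg_pos a)
    have hb := two _ (deg_pos b)
    simp only [RAM.Term.value, deg, pow_add]
    nlinarith
  | sub a b iha => exact (Nat.sub_le _ _).trans iha
  | mul a b iha ihb => simpa [RAM.Term.value, deg, pow_add] using Nat.mul_le_mul iha ihb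
  | half a iha => exact (Nat.div_le_self _ _).trans iha
  | lt a b =>
    simp only [RAM.Term.value, deg, pow_one]
    split_ifs <;> omega

theorem size_pow_le (x d : ℕ) : (x ^ d).size ≤ d * x.size + 1 := by
  rw [Nat.size_le]
  calc x ^ d ≤ (2 ^ x.size) ^ d := Nat.pow_le_pow_left (Nat.lt_size_self x).le d
    _ = 2 ^ (d * x.size) := by rw [← pow_mul, mul_comm]
    _ < _ := Nat.pow_lt_pow_right (by omega) (by omega)

/-- A factor `c` such that evaluating the term takes time at most `c * L ^ 2`, where `L` is the
binary length of the bound on all values. -/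
def weight : RAM.Term → ℕ
  | .const c => c.size + 1
  | .reg _ => 3
  | .mem a => weight a + 3
  | .add a b => weight a + weight b + (deg a + deg b + 2)
  | .sub a b => weight a + weight b + (deg a + 2)
  | .mul a b => weight a + weight b + (deg a + 1) * (deg b + 1) + (deg a + deg b + 2)
  | .half a => weight a + (deg a + 2)
  | .lt a b => weight a + weight b + 1

theorem cost_le {B : ℕ} {σ : RAM.State} (h : Below B σ) (e : RAM.Term) :
    e.cost σ ≤ weight e * (B + 2).size ^ 2 := by
  set L := (B + 2).size with hL
  have hL1 : 1 ≤ L := Nat.one_le_iff_ne_zero.2 (by simp [hL, Nat.size_eq_zero])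
  have hsz : ∀ e : RAM.Term, (e.value σ).size ≤ (deg e + 1) * L := fun e => by
    have := (Nat.size_le_size (value_le_pow h e)).trans (size_pow_le _ _)
    nlinarith
  have hLL : L ≤ L ^ 2 := Nat.le_self_pow (by omega) L
  have lin : ∀ x d : ℕ, x ≤ d * L → x + 1 ≤ (d + 1) * L ^ 2 := fun x d hx => by nlinarith
  induction e with
  | const c =>
    simp only [RAM.Term.cost, weight]
    nlinarith
  | reg r =>
    have := lin _ _ (hsz (.reg r))
    simpa [RAM.Term.cost, weight, deg, RAM.Term.value] using this
  | mem a iha =>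
    have := lin _ _ (hsz (.mem a))
    simp only [RAM.Term.cost, weight, deg, RAM.Term.value] at *
    linarith
  | add a b iha ihb =>
    have := lin _ _ (hsz (.add a b))
    simp only [RAM.Term.cost, weight, deg, RAM.Term.value] at *
    linarith
  | sub a b iha ihb =>
    have := lin _ _ (hsz (.sub a b))
    simp only [RAM.Term.cost, weight, deg, RAM.Term.value] at *
    linarith
  | mul a b iha ihb =>
    have := lin _ _ (hsz (.mul a b))
    have hm := Nat.mul_le_mul (hsz a) (hsz b)
    simp only [RAM.Term.cost, weight, deg, RAM.Term.value] at *
    have : (deg a + 1) * L * ((deg b + 1) * L) = (deg a + 1) * (deg b + 1) * L ^ 2 := by ring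
    linarith
  | half a iha =>
    have := lin _ _ (hsz (.half a))
    simp only [RAM.Term.cost, weight, deg, RAM.Term.value] at *
    linarith
  | lt a b iha ihb =>
    simp only [RAM.Term.cost, weight] at *
    nlinarith

/-- The machine state `σ` represents the state `s` of the loop language. -/
structure Sim (s : Store) (σ : RAM.State) : Prop where
  reg : ∀ x, σ.reg x = s.v x
  inp : ∀ i, s.a 0 i = if i < s.v 1 then σ.mem i else 0
  arr : ∀ k i, 0 < k → k < 8 → σ.mem (s.v 1 + (i * 8 + k)) = s.a k i

/-- The translation of expressions is correct. Beyond the end of the input the guard makes both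
sides zero. -/
theorem Sim.value {s : Store} {σ : RAM.State} (h : Sim s σ) {e : Ex} (he : e.wf) :
    e.term.value σ = e.val s := by
  induction e with
  | const c => rfl
  | var x => exact h.reg x
  | arr k e ih =>
    simp only [Ex.wf, Bool.and_eq_true, decide_eq_true_eq] at he
    have ih := ih he.2
    by_cases hk : k = 0
    · subst hk
      simp only [Ex.term, if_true, RAM.Term.value, ih, Ex.val, h.inp, h.reg]
      split_ifs <;> simp
    · simp only [Ex.term, hk, if_false, RAM.Term.value, ih, Ex.val, h.reg]
      exact h.arr k _ (Nat.pos_of_ne_zero hk) he.1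
  | add a b iha ihb =>
    simp only [Ex.wf, Bool.and_eq_true] at he
    simp [Ex.term, RAM.Term.value, iha he.1, ihb he.2]
  | sub a b iha ihb =>
    simp only [Ex.wf, Bool.and_eq_true] at he
    simp [Ex.term, RAM.Term.value, iha he.1, ihb he.2]
  | mul a b iha ihb =>
    simp only [Ex.wf, Bool.and_eq_true] at he
    simp [Ex.term, RAM.Term.value, iha he.1, ihb he.2]
  | half a iha =>
    simp only [Ex.wf] at he
    simp [Ex.term, RAM.Term.value, iha he]
  | lt a b iha ihb =>
    simp only [Ex.wf, Bool.and_eq_true] at he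
    simp [Ex.term, RAM.Term.value, iha he.1, ihb he.2]

/-- A safe expression takes no value above all those present on the machine. -/
theorem safe_le {B : ℕ} {s : Store} {σ : RAM.State} (h : Sim s σ) (hB : Below B σ) (h1 : 1 ≤ B)
    {e : Ex} (hw : e.wf) (he : e.safe) : e.val s ≤ B := by
  induction e with
  | const c =>
    simp only [Ex.safe, decide_eq_true_eq] at he
    exact le_trans he h1
  | var x => exact (h.reg x).symm.trans_le (hB.1 x)
  | arr k e ih =>
    simp only [Ex.wf, Bool.and_eq_true, decide_eq_true_eq] at hw
    rcases Nat.eq_zero_or_pos k with rfl | hk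
    · simp only [Ex.val, h.inp]
      split_ifs
      exacts [hB.2 _, Nat.zero_le _]
    · exact (h.arr k (e.val s) hk hw.1).symm.trans_le (hB.2 _)
  | add a b => simp [Ex.safe] at he
  | sub a b iha =>
    simp only [Ex.wf, Bool.and_eq_true] at hw
    exact (Nat.sub_le _ _).trans (iha hw.1 he)
  | mul a b => simp [Ex.safe] at he
  | half a iha => exact (Nat.div_le_self _ _).trans (iha hw he)
  | lt a b =>
    simp only [Ex.val]
    split_ifs <;> omega

theorem slow_le {B : ℕ} {s : Store} {σ : RAM.State} (h : Sim s σ) (hB : Below B σ) (h1 : 1 ≤ B)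
    {e : Ex} (hw : e.wf) (he : e.slow) : e.val s ≤ B + 4 := by
  unfold Ex.slow at he
  split at he
  · simp only [Bool.and_eq_true, decide_eq_true_eq] at he
    simp only [Ex.wf, Bool.and_eq_true] at hw
    exact Nat.add_le_add (safe_le h hB h1 hw.1 he.1) he.2
  · exact (safe_le h hB h1 hw he).trans (by omega)

theorem Below.mono {B C : ℕ} {σ : RAM.State} (h : Below B σ) (hBC : B ≤ C) : Below C σ :=
  ⟨fun r => (h.1 r).trans hBC, fun i => (h.2 i).trans hBC⟩

theorem Sim.setV {s : Store} {σ : RAM.State} (h : Sim s σ) {x : ℕ} (hx : x ≠ 1) (m : ℕ) :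
    Sim (s.setV x m) ⟨Function.update σ.reg x m, σ.mem⟩ where
  reg y := by by_cases hy : y = x <;> simp [hy, h.reg]
  inp i := by simpa [hx.symm] using h.inp i
  arr k i hk hk' := by simpa [hx.symm] using h.arr k i hk hk'

theorem Below.setV {B : ℕ} {σ : RAM.State} (h : Below B σ) {x m C : ℕ} (hBC : B ≤ C) (hm : m ≤ C) :
    Below C ⟨Function.update σ.reg x m, σ.mem⟩ :=
  ⟨fun r => by by_cases hr : r = x <;> simp [hr, hm, (h.1 r).trans hBC],
    fun i => (h.2 i).trans hBC⟩

/-- The simulation theorem: a program of the loop language runs on the machine in time proportional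
to the number of its steps, up to the square of the binary length of the values involved. -/
theorem simulation (p : Cmd) (hp : p.wf) : ∃ C : ℕ, ∀ (s : Store) (σ : RAM.State) (B : ℕ),
    Sim s σ → Below B σ → 1 ≤ B → ∃ σ' t, RAM.Exec p.prog σ σ' t ∧ Sim (p.run s) σ' ∧
      Below (B + 4 * p.steps s) σ' ∧
        t ≤ C * p.steps s * (B + 4 * p.steps s + 2).size ^ 2 := by
  have pos : ∀ m : ℕ, 1 ≤ (m + 2).size ^ 2 := fun m =>
    Nat.one_le_iff_ne_zero.2 (pow_ne_zero _ (by simp [Nat.size_eq_zero]))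
  have mon : ∀ {m m' : ℕ}, m ≤ m' → (m + 2).size ^ 2 ≤ (m' + 2).size ^ 2 := fun h =>
    Nat.pow_le_pow_left (Nat.size_le_size (by omega)) 2
  induction p with
  | skip =>
    refine ⟨1, fun s σ B h hB h1 => ⟨σ, 1, .skip σ, h, hB.mono (by omega), ?_⟩⟩
    simpa [Cmd.steps] using pos _
  | set x e =>
    simp only [Cmd.wf, Bool.and_eq_true, decide_eq_true_eq] at hp
    obtain ⟨⟨hx, hw⟩, hs⟩ := hp
    refine ⟨weight e.term + 1, fun s σ B h hB h1 => ⟨_, _, .assign x e.term σ, ?_, ?_, ?_⟩⟩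
    · rw [h.value hw]
      exact h.setV hx _
    · rw [h.value hw]
      exact hB.setV (by omega) (slow_le h hB h1 hw hs)
    · have h2 := cost_le hB e.term
      have h3 := mon (show B ≤ B + 4 * 1 by omega)
      have h4 := pos (B + 4 * 1)
      simp only [Cmd.steps]
      nlinarith
  | setC x e y =>
    simp only [Cmd.wf, Bool.and_eq_true, decide_eq_true_eq] at hp
    obtain ⟨hx, hw⟩ := hp
    refine ⟨weight (.mul (.lt e.term (.reg y)) e.term) + 1,
      fun s σ B h hB h1 => ⟨_, _, .assign x _ σ, ?_, ?_, ?_⟩⟩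
    · have : RAM.Term.value σ (.mul (.lt e.term (.reg y)) e.term)
          = if e.val s < s.v y then e.val s else 0 := by
        simp only [RAM.Term.value, h.value hw, h.reg]
        split_ifs <;> simp
      rw [this]
      exact h.setV hx _
    · refine hB.setV (by omega) ?_
      simp only [RAM.Term.value, h.value hw]
      have := hB.1 y
      split_ifs <;> omega
    · have h2 := cost_le hB (.mul (.lt e.term (.reg y)) e.term)
      have h3 := mon (show B ≤ B + 4 * 1 by omega)
      have h4 := pos (B + 4 * 1)
      simp only [Cmd.steps]
      nlinarith
  | aset k i e =>
    simp only [Cmd.wf, Bool.and_eq_true, decide_eq_true_eq] at hp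
    obtain ⟨⟨⟨⟨hk, hk'⟩, hi⟩, hw⟩, hs⟩ := hp
    set τ : RAM.Term := .add (.reg 1) (.add (.mul i.term (.const 8)) (.const k)) with hτ
    refine ⟨weight τ + weight e.term + 1, fun s σ B h hB h1 =>
      ⟨_, _, .store τ e.term σ, ?_, ?_, ?_⟩⟩
    · have hv : τ.value σ = s.v 1 + (i.val s * 8 + k) := by
        simp [hτ, RAM.Term.value, h.value hi, h.reg]
      rw [hv, h.value hw]
      refine ⟨h.reg, fun j => ?_, fun l j hl hl' => ?_⟩
      · have : (s.setA k (i.val s) (e.val s)).a 0 = s.a 0 := by simp [hk.symm]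
        rw [Cmd.run, this, h.inp, Store.setA_v]
        by_cases hj : j < s.v 1
        · simp only [if_pos hj]
          exact (Function.update_of_ne (by omega) _ _).symm
        · simp only [if_neg hj]
      · simp only [Cmd.run, Store.setA_v, Store.setA_a]
        by_cases hlk : l = k
        · subst hlk
          by_cases hj : j = i.val s
          · simp [hj]
          · rw [Function.update_of_ne (by omega), h.arr _ _ hl hl']
            simp [hj]
        · rw [Function.update_of_ne (by omega), h.arr _ _ hl hl', if_neg hlk]
    · refine ⟨fun r => (hB.1 r).trans (by omega), fun j => ?_⟩
      have h3 := slow_le h hB h1 hw hs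
      simp only [Cmd.steps]
      by_cases hj : j = τ.value σ
      · simp only [hj, Function.update_self, h.value hw]
        exact h3
      · simp only [Function.update_of_ne hj]
        exact (hB.2 j).trans (by omega)
    · have h2 := cost_le hB τ
      have h2' := cost_le hB e.term
      have h3 := mon (show B ≤ B + 4 * 1 by omega)
      have h4 := pos (B + 4 * 1)
      simp only [Cmd.steps]
      nlinarith
  | seq p q ihp ihq =>
    simp only [Cmd.wf, Bool.and_eq_true] at hp
    obtain ⟨C, hC⟩ := ihp hp.1
    obtain ⟨D, hD⟩ := ihq hp.2
    refine ⟨C + D, fun s σ B h hB h1 => ?_⟩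
    obtain ⟨σ₁, t₁, e₁, s₁, b₁, l₁⟩ := hC s σ B h hB h1
    obtain ⟨σ₂, t₂, e₂, s₂, b₂, l₂⟩ := hD _ σ₁ _ s₁ b₁ (by omega)
    refine ⟨σ₂, _, .seq e₁ e₂, s₂, b₂.mono (by simp only [Cmd.steps]; omega), ?_⟩
    simp only [Cmd.steps]
    set a := p.steps s
    set b := q.steps (p.run s)
    have h3 := mon (show B + 4 * a ≤ B + 4 * (a + b) by omega)
    have h4 : B + 4 * a + 4 * b = B + 4 * (a + b) := by ring
    rw [h4] at l₂
    set L := (B + 4 * (a + b) + 2).size ^ 2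
    have h5 : C * a * (B + 4 * a + 2).size ^ 2 ≤ C * a * L := Nat.mul_le_mul_left _ h3
    have : (C + D) * (a + b) * L = C * a * L + C * b * L + D * a * L + D * b * L := by ring
    have := Nat.zero_le (C * b * L)
    have := Nat.zero_le (D * a * L)
    omega
  | ite b p q ihp ihq =>
    simp only [Cmd.wf, Bool.and_eq_true] at hp
    obtain ⟨C, hC⟩ := ihp hp.1.2
    obtain ⟨D, hD⟩ := ihq hp.2
    refine ⟨C + D + weight b.term + 1, fun s σ B h hB h1 => ?_⟩
    have hv := h.value hp.1.1
    have h2 := cost_le hB b.term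
    by_cases hb : b.val s ≠ 0
    · obtain ⟨σ₁, t₁, e₁, s₁, b₁, l₁⟩ := hC s σ B h hB h1
      refine ⟨σ₁, _, .ite_true (hv ▸ hb) e₁, by simpa [Cmd.run, hb] using s₁,
        b₁.mono (by simp only [Cmd.steps, if_pos hb]; omega), ?_⟩
      simp only [Cmd.steps, if_pos hb]
      set a := p.steps s
      have h3 := mon (show B + 4 * a ≤ B + 4 * (1 + a) by omega)
      have h3' := mon (show B ≤ B + 4 * (1 + a) by omega)
      have h4 := pos (B + 4 * (1 + a))
      set L := (B + 4 * (1 + a) + 2).size ^ 2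
      have h5 : C * a * (B + 4 * a + 2).size ^ 2 ≤ C * a * L := Nat.mul_le_mul_left _ h3
      have h6 : weight b.term * (B + 2).size ^ 2 ≤ weight b.term * L := Nat.mul_le_mul_left _ h3'
      have : (C + D + weight b.term + 1) * (1 + a) * L = C * a * L + weight b.term * L + L
        + (C * L + D * L + D * a * L + weight b.term * a * L + a * L) := by ring
      omega
    · obtain ⟨σ₁, t₁, e₁, s₁, b₁, l₁⟩ := hD s σ B h hB h1
      rw [not_ne_iff] at hb
      refine ⟨σ₁, _, .ite_false (hv ▸ hb) e₁, by simpa [Cmd.run, hb] using s₁,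
        b₁.mono (by simp [Cmd.steps, hb]), ?_⟩
      simp only [Cmd.steps, hb, ne_eq, not_true, if_false]
      set a := q.steps s
      have h3 := mon (show B + 4 * a ≤ B + 4 * (1 + a) by omega)
      have h3' := mon (show B ≤ B + 4 * (1 + a) by omega)
      have h4 := pos (B + 4 * (1 + a))
      set L := (B + 4 * (1 + a) + 2).size ^ 2
      have h5 : D * a * (B + 4 * a + 2).size ^ 2 ≤ D * a * L := Nat.mul_le_mul_left _ h3
      have h6 : weight b.term * (B + 2).size ^ 2 ≤ weight b.term * L := Nat.mul_le_mul_left _ h3'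
      have : (C + D + weight b.term + 1) * (1 + a) * L = D * a * L + weight b.term * L + L
        + (C * L + D * L + C * a * L + weight b.term * a * L + a * L) := by ring
      omega
  | loop i b p ih =>
    simp only [Cmd.wf, Bool.and_eq_true, decide_eq_true_eq, Bool.not_eq_true'] at hp
    obtain ⟨⟨⟨⟨hi, hib⟩, hpi⟩, hpb⟩, hw⟩ := hp
    obtain ⟨C, hC⟩ := ih hw
    set w₁ := weight (.lt (.reg i) (.reg b))
    set w₂ := weight (.add (.reg i) (.const 1))
    set w₃ := weight (.const 0)
    refine ⟨C + w₁ + w₂ + w₃ + 3, fun s σ B h hB h1 => ?_⟩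
    set m := s.v b with hm
    set f : ℕ → ℕ := fun j => p.steps (Cmd.iter p.run i s j) + 2 with hf
    have hvb : ∀ j, (Cmd.iter p.run i s j).v b = m := fun j =>
      (Cmd.iter_agree p i b s j).1 b (by simp [Cmd.wv, hib.symm, hpb])
    -- the loop, entered with `j` rounds to go, where `F` bounds the steps made before
    have key : ∀ j, j ≤ m → ∀ (σ₁ : RAM.State) (F : ℕ), Sim (Cmd.iter p.run i s (m - j)) σ₁ →
        Below (B + 4 * F) σ₁ → ∃ σ' t,
          RAM.Exec (.while (.lt (.reg i) (.reg b))
            (.seq p.prog (.assign i (.add (.reg i) (.const 1))))) σ₁ σ' t ∧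
          Sim (Cmd.iter p.run i s m) σ' ∧
          Below (B + 4 * (F + ∑ l ∈ Finset.Ico (m - j) m, f l)) σ' ∧
          t ≤ (C + w₁ + w₂ + 2) * (1 + ∑ l ∈ Finset.Ico (m - j) m, f l) *
            (B + 4 * (F + ∑ l ∈ Finset.Ico (m - j) m, f l) + 2).size ^ 2 := by
      intro j
      induction j with
      | zero =>
        intro _ σ₁ F h₁ b₁
        refine ⟨σ₁, _, .while_false ?_, by simpa using h₁, by simpa using b₁, ?_⟩
        · simp [RAM.Term.value, h₁.reg, Cmd.iter_counter, hvb]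
        · have h2 := cost_le b₁ (.lt (.reg i) (.reg b))
          have h4 := pos (B + 4 * F)
          simp only [Nat.sub_zero, Finset.Ico_self, Finset.sum_empty, add_zero, mul_one]
          nlinarith
      | succ j ihj =>
        intro hj σ₁ F h₁ b₁
        have hlt : m - (j + 1) < m := by omega
        set q := m - (j + 1) with hq
        have hq' : m - j = q + 1 := by omega
        rw [hq'] at ihj
        have hsum : ∑ l ∈ Finset.Ico q m, f l = f q + ∑ l ∈ Finset.Ico (q + 1) m, f l :=
          Finset.sum_eq_sum_Ico_succ_bot hlt f
        obtain ⟨σ₂, t₂, e₂, s₂, b₂, l₂⟩ := hC _ σ₁ _ h₁ b₁ (by omega)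
        have hreg : σ₂.reg i = q := by
          rw [s₂.reg, (p.run_agree _).1 i hpi, Cmd.iter_counter]
        have hval : RAM.Term.value σ₂ (.add (.reg i) (.const 1)) = q + 1 := by
          simp [RAM.Term.value, hreg]
        have hmB : m ≤ B := by
          have := hB.1 b
          rwa [h.reg] at this
        have e₃ := RAM.Exec.assign i (.add (.reg i) (.const 1)) σ₂
        rw [hval] at e₃
        have s₃ : Sim (Cmd.iter p.run i s (q + 1)) ⟨Function.update σ₂.reg i (q + 1), σ₂.mem⟩ :=
          s₂.setV hi (q + 1)
        have b₃ : Below (B + 4 * (F + f q)) ⟨Function.update σ₂.reg i (q + 1), σ₂.mem⟩ :=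
          b₂.setV (by simp only [hf]; omega) (by omega)
        obtain ⟨σ₄, t₄, e₄, s₄, b₄, l₄⟩ := ihj (by omega) _ (F + f q) s₃ b₃
        refine ⟨σ₄, _, .while_true ?_ (.seq e₂ e₃) e₄, s₄, b₄.mono (by rw [hsum]; omega), ?_⟩
        · simp [RAM.Term.value, h₁.reg, Cmd.iter_counter, hvb, hlt]
        · have c₁ := cost_le b₁ (.lt (.reg i) (.reg b))
          have c₂ := cost_le b₂ (.add (.reg i) (.const 1))
          rw [hsum]
          set W := ∑ l ∈ Finset.Ico (q + 1) m, f l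
          have hfq : f q = p.steps (Cmd.iter p.run i s q) + 2 := rfl
          set a := p.steps (Cmd.iter p.run i s q)
          have m₁ := mon (show B + 4 * F ≤ B + 4 * (F + (f q + W)) by omega)
          have m₂ := mon (show B + 4 * F + 4 * a ≤ B + 4 * (F + (f q + W)) by omega)
          have m₄ : B + 4 * (F + f q + W) = B + 4 * (F + (f q + W)) := by ring
          have h4 := pos (B + 4 * (F + (f q + W)))
          rw [m₄] at l₄
          set L := (B + 4 * (F + (f q + W)) + 2).size ^ 2
          have k₁ := c₁.trans (Nat.mul_le_mul_left w₁ m₁)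
          have k₂ := c₂.trans (Nat.mul_le_mul_left w₂ m₂)
          have k₃ := l₂.trans (Nat.mul_le_mul_left (C * a) m₂)
          rw [hfq]
          have e1 : (C + w₁ + w₂ + 2) * (1 + (a + 2 + W)) * L
              = (C + w₁ + w₂ + 2) * (1 + W) * L + C * a * L + w₁ * L + w₂ * L + 2 * L
                + ((w₁ + w₂ + 2) * a * L + 2 * C * L + (w₁ + w₂) * L + 2 * L) := by ring
          omega
    have s₁ : Sim (s.setV i 0) ⟨Function.update σ.reg i 0, σ.mem⟩ := h.setV hi 0
    have b₁ : Below (B + 4 * 1) ⟨Function.update σ.reg i 0, σ.mem⟩ :=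
      hB.setV (by omega) (by omega)
    have e₁ := RAM.Exec.assign i (.const 0) σ
    obtain ⟨σ₂, t₂, e₂, s₂, b₂, l₂⟩ := key m le_rfl ⟨Function.update σ.reg i 0, σ.mem⟩ 1
      (by simpa [Cmd.iter] using s₁) b₁
    have hst : (Cmd.loop i b p).steps s = 2 + ∑ l ∈ Finset.range m, f l := rfl
    rw [Nat.sub_self, ← Finset.range_eq_Ico] at b₂ l₂
    refine ⟨σ₂, _, .seq e₁ e₂, s₂, b₂.mono (by rw [hst]; omega), ?_⟩
    rw [hst]
    set W := ∑ l ∈ Finset.range m, f l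
    have c₁ := cost_le hB (.const 0)
    have m₁ := mon (show B ≤ B + 4 * (2 + W) by omega)
    have m₂ := mon (show B + 4 * (1 + W) ≤ B + 4 * (2 + W) by omega)
    have h4 := pos (B + 4 * (2 + W))
    set L := (B + 4 * (2 + W) + 2).size ^ 2
    have k₁ := c₁.trans (Nat.mul_le_mul_left w₃ m₁)
    have k₂ := l₂.trans (Nat.mul_le_mul_left _ m₂)
    have e1 : (C + w₁ + w₂ + w₃ + 3) * (2 + W) * L
        = (C + w₁ + w₂ + 2) * (1 + W) * L + w₃ * L + L
          + ((C + w₁ + w₂ + 2) * L + (w₃ + 1) * (1 + W) * L) := by ring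
    omega

end LoopLang

/-! ### Connected vertex covers and exchange arguments -/

namespace ConnVC

/-- Two vertices are joined in `Y` if they are equal or linked by a walk inside `Y`. -/
def Joined (E : SimpleGraph ℕ) (Y : Finset ℕ) : ℕ → ℕ → Prop :=
  Relation.ReflTransGen fun p q => E.Adj p q ∧ p ∈ Y ∧ q ∈ Y

variable {E : SimpleGraph ℕ} {Y Z X A T : Finset ℕ} {n ℓ : ℕ}

namespace Joined

theorem refl (x : ℕ) : Joined E Y x x := Relation.ReflTransGen.refl

theorem single {x y : ℕ} (h : E.Adj x y) (hx : x ∈ Y) (hy : y ∈ Y) : Joined E Y x y :=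
  Relation.ReflTransGen.single ⟨h, hx, hy⟩

theorem trans {x y z : ℕ} (h : Joined E Y x y) (h' : Joined E Y y z) : Joined E Y x z :=
  Relation.ReflTransGen.trans h h'

theorem symm {x y : ℕ} (h : Joined E Y x y) : Joined E Y y x := by
  induction h with
  | refl => exact refl _
  | tail _ h ih => exact (single h.1.symm h.2.2 h.2.1).trans ih

theorem mono {x y : ℕ} (h : Joined E Y x y) (hYZ : Y ⊆ Z) : Joined E Z x y := by
  induction h with
  | refl => exact refl _
  | tail _ h ih => exact ih.trans (single h.1 (hYZ h.2.1) (hYZ h.2.2))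

/-- A property that is inherited along the edges inside `Y` holds on whole components. -/
theorem closed {x y : ℕ} (h : Joined E Y x y) (P : ℕ → Prop) (hx : P x)
    (hP : ∀ p q, P p → E.Adj p q → p ∈ Y → q ∈ Y → P q) : P y := by
  induction h with
  | refl => exact hx
  | tail _ h ih => exact hP _ _ ih h.1 h.2.1 h.2.2

/-- A walk ending in `u` reaches a neighbour of `u` without using `u`. -/
theorem exists_last {x u : ℕ} (h : Joined E Y x u) (hxu : x ≠ u) :
    ∃ y ∈ Y, E.Adj y u ∧ Joined E (Y.erase u) x y := by
  induction h using Relation.ReflTransGen.head_induction_on with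
  | refl => exact absurd rfl hxu
  | @head x y hxy _ ih =>
    by_cases hy : y = u
    · subst hy
      exact ⟨x, hxy.2.1, hxy.1, refl x⟩
    · obtain ⟨z, hz, hzu, hj⟩ := ih hy
      exact ⟨z, hz, hzu, (single hxy.1 (Finset.mem_erase.2 ⟨hxu, hxy.2.1⟩)
        (Finset.mem_erase.2 ⟨hy, hxy.2.2⟩)).trans hj⟩

/-- Connections through `u` can be rerouted to `p` if all neighbours of `u` are joined to `p`. -/
theorem reroute {x u p : ℕ} (h : Joined E X x u) (hZ : X.erase u ⊆ Z)
    (hu : ∀ y ∈ X, E.Adj u y → Joined E Z y p) (hxu : x ≠ u) : Joined E Z x p := by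
  obtain ⟨y, hy, hyu, hj⟩ := h.exists_last hxu
  exact (hj.mono hZ).trans (hu y hy hyu.symm)

end Joined

open Classical in
/-- The least vertices of `A` in the components of the graph induced on `Y`. -/
noncomputable def reps (E : SimpleGraph ℕ) (A Y : Finset ℕ) : Finset ℕ :=
  A.filter fun x => ∀ x' ∈ A, x' < x → ¬ Joined E Y x' x

/-- The number of components of the graph induced on `Y` that meet `A`. -/
noncomputable def comps (E : SimpleGraph ℕ) (A Y : Finset ℕ) : ℕ := (reps E A Y).card

theorem mem_reps {x : ℕ} : x ∈ reps E A Y ↔ x ∈ A ∧ ∀ x' ∈ A, x' < x → ¬ Joined E Y x' x := by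
  simp [reps]

theorem exists_rep {a : ℕ} (ha : a ∈ A) : ∃ x ∈ reps E A Y, Joined E Y x a := by
  induction a using Nat.strong_induction_on with
  | _ a ih =>
    by_cases h : a ∈ reps E A Y
    · exact ⟨a, h, .refl a⟩
    · simp only [mem_reps, ha, true_and, not_forall, not_not] at h
      obtain ⟨x', hx', hlt, hj⟩ := h
      obtain ⟨x, hx, hxj⟩ := ih x' hlt hx'
      exact ⟨x, hx, hxj.trans hj⟩

theorem reps_injective {x y : ℕ} (hx : x ∈ reps E A Y) (hy : y ∈ reps E A Y)
    (h : Joined E Y x y) : x = y := by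
  rw [mem_reps] at hx hy
  rcases lt_trichotomy x y with hl | hl | hl
  · exact absurd h (hy.2 x hx.1 hl)
  · exact hl
  · exact absurd h.symm (hx.2 y hy.1 hl)

theorem reps_anti (h : Y ⊆ Z) : reps E A Z ⊆ reps E A Y := fun x hx => by
  rw [mem_reps] at hx ⊢
  exact ⟨hx.1, fun x' hx' hl hj => hx.2 x' hx' hl (hj.mono h)⟩

/-- If enlarging `Y` does not lower the number of components, it joins nothing in `A`. -/
theorem joined_of_comps (h : Y ⊆ Z) (hc : ¬ comps E A Z < comps E A Y) {a b : ℕ} (ha : a ∈ A)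
    (hb : b ∈ A) (hj : Joined E Z a b) : Joined E Y a b := by
  have he : reps E A Z = reps E A Y := Finset.eq_of_subset_of_card_le (reps_anti h) (not_lt.1 hc)
  obtain ⟨x, hx, hxa⟩ := exists_rep (E := E) (Y := Y) ha
  obtain ⟨y, hy, hyb⟩ := exists_rep (E := E) (Y := Y) hb
  have : x = y := reps_injective (he ▸ hx) (he ▸ hy)
    ((hxa.mono h).trans (hj.trans (hyb.mono h).symm))
  subst this
  exact hxa.symm.trans hyb

theorem comps_le_card : comps E A Y ≤ A.card := by
  classical exact Finset.card_filter_le _ _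

/-- If every vertex of `Y` is joined to `A`, all components of `Y` are counted. -/
theorem comps_self_le (h : ∀ y ∈ Y, ∃ a ∈ A, Joined E Y a y) : comps E Y Y ≤ comps E A Y := by
  have : ∀ y ∈ reps E Y Y, ∃ x ∈ reps E A Y, Joined E Y x y := fun y hy => by
    obtain ⟨a, ha, haj⟩ := h y (mem_reps.1 hy).1
    obtain ⟨x, hx, hxj⟩ := exists_rep (E := E) (Y := Y) ha
    exact ⟨x, hx, hxj.trans haj⟩
  choose! f hf hfj using this
  refine Finset.card_le_card_of_injOn f hf fun y hy z hz hyz => ?_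
  exact reps_injective hy hz ((hfj y hy).symm.trans (hyz ▸ hfj z hz))

/-- Connected vertex covers of a graph with vertices among `0, …, n - 1`. -/
structure IsCVC (E : SimpleGraph ℕ) (n : ℕ) (X : Finset ℕ) : Prop where
  subset : X ⊆ Finset.range n
  nonempty : X.Nonempty
  cover : ∀ x y, E.Adj x y → x ∈ X ∨ y ∈ X
  joined : ∀ x ∈ X, ∀ y ∈ X, Joined E X x y

/-- Outside `T` the graph is a disjoint union of cliques. -/
def Cluster (E : SimpleGraph ℕ) (T : Finset ℕ) : Prop :=
  ∀ x y z, x ∉ T → y ∉ T → z ∉ T → E.Adj x y → E.Adj y z → x ≠ z → E.Adj x z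

/-- Replacing `u` by an adjacent vertex `w` outside the cover keeps a connected vertex cover if the
neighbours of `u` remain joined to `w`. -/
theorem IsCVC.swap (hX : IsCVC E n X) (hT : Cluster E T) {u w : ℕ} (hu : u ∈ X) (hw : w ∉ X)
    (hwn : w < n) (huT : u ∉ T) (hwT : w ∉ T) (huw : E.Adj u w)
    (hN : ∀ y ∈ T, E.Adj u y → y ∈ X)
    (hj : ∀ y ∈ X, E.Adj u y → Joined E (insert w (X.erase u)) y w) :
    IsCVC E n (insert w (X.erase u)) where
  subset := Finset.insert_subset (Finset.mem_range.2 hwn)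
    ((Finset.erase_subset _ _).trans hX.subset)
  nonempty := ⟨w, Finset.mem_insert_self _ _⟩
  cover := by
    have key : ∀ y, E.Adj u y → y ∈ insert w (X.erase u) := fun y hy => by
      by_cases hyw : y = w
      · simp [hyw]
      · refine Finset.mem_insert_of_mem (Finset.mem_erase.2 ⟨hy.ne', ?_⟩)
        by_cases hyT : y ∈ T
        · exact hN y hyT hy
        · exact (hX.cover y w (hT y u w hyT huT hwT hy.symm huw hyw)).resolve_right hw
    intro x y hxy
    by_cases hxu : x = u
    · exact .inr (key y (hxu ▸ hxy))
    by_cases hyu : y = u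
    · exact .inl (key x (hyu ▸ hxy.symm))
    rcases hX.cover x y hxy with h | h
    · exact .inl (by simp [h, hxu])
    · exact .inr (by simp [h, hyu])
  joined := by
    have key : ∀ x ∈ insert w (X.erase u), Joined E (insert w (X.erase u)) x w := fun x hx => by
      rcases Finset.mem_insert.1 hx with rfl | hx
      · exact .refl _
      · obtain ⟨hxu, hx⟩ := Finset.mem_erase.1 hx
        exact (hX.joined x hx u hu).reroute (Finset.subset_insert _ _) hj hxu
    exact fun x hx y hy => (key x hx).trans (key y hy).symm

/-- The situation during the search: `A` is the part of the cover in `T`, and `Y` a set of vertices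
that are known to be in the cover, such that undecided vertices have no neighbours in `T` outside
`A`, and, unless isolated outside `T`, a neighbour outside `T` with a neighbour in `A`. -/
structure Partial (E : SimpleGraph ℕ) (n : ℕ) (T A Y : Finset ℕ) : Prop where
  sub : A ⊆ Y
  out : ∀ u, u ∉ T → u ∉ Y → ∀ y ∈ T, E.Adj u y → y ∈ A
  touch : ∀ u x, u < n → u ∉ T → u ∉ Y → x ∉ T → E.Adj u x →
    ∃ x, x ∉ T ∧ E.Adj u x ∧ ∃ a ∈ A, E.Adj x a

theorem Partial.mono (h : Partial E n T A Y) (hYZ : Y ⊆ Z) : Partial E n T A Z where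
  sub := h.sub.trans hYZ
  out u hu hY := h.out u hu fun hY' => hY (hYZ hY')
  touch u x hun hu hY := h.touch u x hun hu fun hY' => hY (hYZ hY')

/-- `X` is a connected vertex cover of size at most `ℓ` that contains `Y` and meets `T` in `A`. -/
structure Extends (E : SimpleGraph ℕ) (n ℓ : ℕ) (T A Y X : Finset ℕ) : Prop where
  cvc : IsCVC E n X
  card : X.card ≤ ℓ
  inter : ∀ x ∈ T, x ∈ X ↔ x ∈ A
  sub : Y ⊆ X

/-- After the exchange of `u` for `w` the solution is no larger and still meets `T` in `A`. -/
theorem Extends.swap (h : Extends E n ℓ T A Y X) (hP : Partial E n T A Y) (hT : Cluster E T)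
    {u w : ℕ} (hu : u ∈ X) (hw : w ∉ X)
    (hwn : w < n) (huT : u ∉ T) (hwT : w ∉ T) (huw : E.Adj u w) (huY : u ∉ Y)
    (hj : ∀ y ∈ X, E.Adj u y → Joined E (insert w (X.erase u)) y w) :
    Extends E n ℓ T A (insert w Y) (insert w (X.erase u)) where
  cvc := h.cvc.swap hT hu hw hwn huT hwT huw
    (fun y hy hyu => (h.inter y hy).2 (hP.out u huT huY y hy hyu)) hj
  card := by
    rw [Finset.card_insert_of_notMem (by simp [hw]), Finset.card_erase_add_one hu]
    exact h.card
  inter x hx := by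
    have h1 : x ≠ u := fun e => huT (e ▸ hx)
    have h2 : x ≠ w := fun e => hwT (e ▸ hx)
    simp [h1, h2, h.inter x hx]
  sub := Finset.insert_subset_insert _ fun y hy =>
    Finset.mem_erase.2 ⟨fun e => huY (e ▸ hy), h.sub hy⟩

/-- One half of `exists_extends_of_triple`. -/
theorem Extends.swap_of_triple (h : Extends E n ℓ T A Y X) (hP : Partial E n T A Y)
    (hT : Cluster E T) {u v w : ℕ} (hu : u ∈ X) (hv : v ∈ X) (hw : w ∉ X) (hwn : w < n)
    (huT : u ∉ T) (hvT : v ∉ T) (hwT : w ∉ T) (huv : E.Adj u v) (huw : E.Adj u w)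
    (hvw : E.Adj v w) (huY : u ∉ Y)
    (hA : ∀ a ∈ A, E.Adj u a → ∃ b ∈ A, E.Adj v b ∧ Joined E Y a b) :
    Extends E n ℓ T A (insert w Y) (insert w (X.erase u)) := by
  refine h.swap hP hT hu hw hwn huT hwT huw huY fun y hy hyu => ?_
  set Z := insert w (X.erase u)
  have hYZ : Y ⊆ Z := fun y hy => Finset.mem_insert_of_mem
    (Finset.mem_erase.2 ⟨fun e => huY (e ▸ hy), h.sub hy⟩)
  have hvZ : v ∈ Z := Finset.mem_insert_of_mem (Finset.mem_erase.2 ⟨huv.ne', hv⟩)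
  have hyZ : y ∈ Z := Finset.mem_insert_of_mem (Finset.mem_erase.2 ⟨hyu.ne', hy⟩)
  have hvwj : Joined E Z v w := .single hvw hvZ (Finset.mem_insert_self _ _)
  by_cases hyT : y ∈ T
  · obtain ⟨b, hb, hvb, hj⟩ := hA y ((h.inter y hyT).1 hy) hyu
    exact (hj.mono hYZ).trans ((Joined.single hvb.symm (hYZ (hP.sub hb)) hvZ).trans hvwj)
  · by_cases hyv : y = v
    · exact hyv ▸ hvwj
    · exact (Joined.single (hT y u v hyT huT hvT hyu.symm huv hyv) hyZ hvZ).trans hvwj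

/-- Of three undecided vertices in a clique, the third one may be taken into the cover if adding the
other two joins nothing in `A`. -/
theorem exists_extends_of_triple (h : Extends E n ℓ T A Y X) (hP : Partial E n T A Y)
    (hT : Cluster E T) {u v w : ℕ} (hwn : w < n)
    (huT : u ∉ T) (hvT : v ∉ T) (hwT : w ∉ T) (huv : E.Adj u v) (huw : E.Adj u w)
    (hvw : E.Adj v w) (huY : u ∉ Y) (hvY : v ∉ Y)
    (hc : ¬ comps E A (insert u (insert v Y)) < comps E A Y) :
    ∃ X, Extends E n ℓ T A (insert w Y) X := by
  by_cases hw : w ∈ X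
  · exact ⟨X, h.cvc, h.card, h.inter, Finset.insert_subset hw h.sub⟩
  have hu : u ∈ X := (h.cvc.cover u w huw).resolve_right hw
  have hv : v ∈ X := (h.cvc.cover v w hvw).resolve_right hw
  set Z := insert u (insert v Y) with hZ
  have hYZ : Y ⊆ Z := (Finset.subset_insert _ _).trans (Finset.subset_insert _ _)
  have huZ : u ∈ Z := by simp [hZ]
  have hvZ : v ∈ Z := by simp [hZ]
  have hAZ := hP.sub.trans hYZ
  by_cases hAv : ∃ b ∈ A, E.Adj v b
  · obtain ⟨b, hb, hvb⟩ := hAv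
    refine ⟨_, h.swap_of_triple hP hT hu hv hw hwn huT hvT hwT huv huw hvw huY
      fun a ha hua => ⟨b, hb, hvb, joined_of_comps hYZ hc ha hb ?_⟩⟩
    exact (Joined.single hua.symm (hAZ ha) huZ).trans
      ((Joined.single huv huZ hvZ).trans (.single hvb hvZ (hAZ hb)))
  · push Not at hAv
    exact ⟨_, h.swap_of_triple hP hT hv hu hw hwn hvT huT hwT huv.symm hvw huw hvY
      fun a ha hva => absurd hva (hAv a ha)⟩

/-- Of the last two undecided vertices in a clique, the second one may be taken into the cover if
adding the first one joins nothing in `A`. -/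
theorem exists_extends_of_pair (h : Extends E n ℓ T A Y X) (hP : Partial E n T A Y)
    (hT : Cluster E T) (hAT : A ⊆ T) {u w : ℕ} (hun : u < n) (hwn : w < n) (huT : u ∉ T)
    (hwT : w ∉ T) (huw : E.Adj u w) (huY : u ∉ Y)
    (hY : ∀ x, x ∉ T → E.Adj u x → x ≠ w → x ∈ Y)
    (hc : ¬ comps E A (insert u Y) < comps E A Y) :
    ∃ X, Extends E n ℓ T A (insert w Y) X := by
  by_cases hw : w ∈ X
  · exact ⟨X, h.cvc, h.card, h.inter, Finset.insert_subset hw h.sub⟩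
  have hu : u ∈ X := (h.cvc.cover u w huw).resolve_right hw
  have hYuX : Y ⊆ X.erase u := fun y hy =>
    Finset.mem_erase.2 ⟨fun e => huY (e ▸ hy), h.sub hy⟩
  have hu' : u ∈ insert u Y := Finset.mem_insert_self _ _
  have hYu : Y ⊆ insert u Y := Finset.subset_insert _ _
  have hAu : A ⊆ insert u Y := hP.sub.trans hYu
  refine ⟨_, h.swap hP hT hu hw hwn huT hwT huw huY fun y hy hyu => ?_⟩
  set Z := insert w (X.erase u)
  have hXZ : X.erase u ⊆ Z := Finset.subset_insert _ _
  have hwZ : w ∈ Z := Finset.mem_insert_self _ _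
  have hclique : ∀ x, x ∉ T → E.Adj u x → x ≠ w → E.Adj x w := fun x hx hux hxw =>
    hT x u w hx huT hwT hux.symm huw hxw
  by_cases hyT : y ∉ T
  · have hyw : y ≠ w := fun e => hw (e ▸ hy)
    exact .single (hclique y hyT hyu hyw) (hXZ (hYuX (hY y hyT hyu hyw))) hwZ
  have hyA : y ∈ A := (h.inter y (not_not.1 hyT)).1 hy
  -- vertices of `A` next to `u`, or next to a neighbour of `u` in `Y`, are joined to `y`
  -- without `u`
  have hyZ : ∀ a ∈ A, Joined E (insert u Y) a u → Joined E Z a y := fun a ha haj =>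
    (joined_of_comps hYu hc ha hyA (haj.trans (.single hyu hu' (hAu hyA)))).mono (hYuX.trans hXZ)
  by_cases hx : ∃ x, x ∉ T ∧ E.Adj u x ∧ x ≠ w ∧ ∃ a ∈ A, E.Adj x a
  · obtain ⟨x, hxT, hux, hxw, a, ha, hxa⟩ := hx
    have hxY := hY x hxT hux hxw
    have h1 := hyZ a ha ((Joined.single hxa.symm (hAu ha) (hYu hxY)).trans
      (.single hux.symm (hYu hxY) hu'))
    exact h1.symm.trans ((Joined.single hxa.symm (hXZ (hYuX (hP.sub ha))) (hXZ (hYuX hxY))).trans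
      (.single (hclique x hxT hux hxw) (hXZ (hYuX hxY)) hwZ))
  · push Not at hx
    obtain ⟨x, hxT, hux, a, ha, hxa⟩ := hP.touch u w hun huT huY hwT huw
    have hxw : x = w := by
      by_contra hne
      exact hx x hxT hux hne a ha hxa
    subst hxw
    have haX : a ∈ X := h.sub (hP.sub ha)
    have hau : a ≠ u := fun e => huT (e ▸ hAT ha)
    obtain ⟨y', hy', hyu', hj⟩ := (h.cvc.joined a haX u hu).exists_last hau
    have haw : Joined E Z a x := .single hxa.symm (hXZ (hYuX (hP.sub ha))) hwZ
    by_cases hyT' : y' ∈ T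
    · have hyA' := (h.inter y' hyT').1 hy'
      exact (hyZ y' hyA' (.single hyu' (hAu hyA') hu')).symm.trans
        ((hj.mono hXZ).symm.trans haw)
    · -- the neighbours of `u` outside `T` other than `w` are not linked to `A` except through `u`
      refine absurd (hAT ha) (hj.symm.closed (fun z => z ∉ T ∧ E.Adj u z) ⟨hyT', hyu'.symm⟩
        fun p q hp hpq hpX hqX => ?_).1
      have hpw : p ≠ x := fun e => hw (e ▸ (Finset.mem_erase.1 hpX).2)
      have hqT : q ∉ T := fun hqT => hx p hp.1 hp.2 hpw q
        ((h.inter q hqT).1 (Finset.mem_erase.1 hqX).2) hpq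
      exact ⟨hqT, hT u p q huT hp.1 hqT hp.2 hpq (Finset.mem_erase.1 hqX).1.symm⟩

end ConnVC

/-! ### The branching search -/

namespace ConnVC

/-- `rounds m f x` applies `f 0`, …, `f (m - 1)` in turn to `x`. -/
def rounds {α : Type*} : ℕ → (ℕ → α → α) → α → α
  | 0, _, x => x
  | m + 1, f, x => f m (rounds m f x)

/-- One step of the search. The state consists of the set `Y` of vertices known to be in the cover
and the number of digits read so far. There are three options `{a, a'}`, `{b, b'}`, `{c, c'}` for
sets to be added to `Y`. If one of them joins nothing in `A`, the vertex `s`, `s'` or `s''` that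
goes with it is added. Otherwise the next digit selects the option to be added. -/
noncomputable def branch (E : SimpleGraph ℕ) (A : Finset ℕ) (dig : ℕ → ℕ)
    (a a' s b b' s' c c' s'' : ℕ) (p : Finset ℕ × ℕ) : Finset ℕ × ℕ :=
  if ¬ comps E A (insert a (insert a' p.1)) < comps E A p.1 then (insert s p.1, p.2)
  else if ¬ comps E A (insert b (insert b' p.1)) < comps E A p.1 then (insert s' p.1, p.2)
  else if ¬ comps E A (insert c (insert c' p.1)) < comps E A p.1 then (insert s'' p.1, p.2)
  else if dig p.2 = 0 then (insert a (insert a' p.1), p.2 + 1)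
  else if dig p.2 = 1 then (insert b (insert b' p.1), p.2 + 1)
  else (insert c (insert c' p.1), p.2 + 1)

/-- Three undecided vertices in a clique outside `T`. -/
def Triple (E : SimpleGraph ℕ) (T Y : Finset ℕ) (u v w : ℕ) : Prop :=
  (u ∉ T ∧ v ∉ T ∧ w ∉ T) ∧ (u ∉ Y ∧ v ∉ Y ∧ w ∉ Y) ∧ E.Adj u v ∧ E.Adj u w ∧ E.Adj v w

/-- Two adjacent undecided vertices outside `T`. -/
def Pair (E : SimpleGraph ℕ) (T Y : Finset ℕ) (u w : ℕ) : Prop :=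
  (u ∉ T ∧ w ∉ T) ∧ (u ∉ Y ∧ w ∉ Y) ∧ E.Adj u w

open Classical in
/-- Of three undecided vertices in a clique, at least two belong to the cover. -/
noncomputable def tripleStep (E : SimpleGraph ℕ) (T A : Finset ℕ) (dig : ℕ → ℕ) (u v w : ℕ)
    (p : Finset ℕ × ℕ) : Finset ℕ × ℕ :=
  if Triple E T p.1 u v w then branch E A dig u v w u w v v w u p else p

open Classical in
/-- Of two adjacent undecided vertices, at least one belongs to the cover. -/
noncomputable def pairStep (E : SimpleGraph ℕ) (T A : Finset ℕ) (dig : ℕ → ℕ) (u w : ℕ)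
    (p : Finset ℕ × ℕ) : Finset ℕ × ℕ :=
  if Pair E T p.1 u w then branch E A dig u u w w w u w w u p else p

/-- All steps for triples. -/
noncomputable def triplePass (E : SimpleGraph ℕ) (n : ℕ) (T A : Finset ℕ) (dig : ℕ → ℕ) :
    Finset ℕ × ℕ → Finset ℕ × ℕ :=
  rounds n fun u => rounds n fun v => rounds n fun w => tripleStep E T A dig u v w

/-- All steps for pairs. -/
noncomputable def pairPass (E : SimpleGraph ℕ) (n : ℕ) (T A : Finset ℕ) (dig : ℕ → ℕ) :
    Finset ℕ × ℕ → Finset ℕ × ℕ :=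
  rounds n fun u => rounds n fun w => pairStep E T A dig u w

open Classical in
/-- The vertices outside `T` that are known to be in the cover from the start: neighbours of
vertices of `T` outside `A`, and vertices without which a clique could not be linked to `A`. -/
noncomputable def forced (E : SimpleGraph ℕ) (n : ℕ) (T A : Finset ℕ) : Finset ℕ :=
  (Finset.range n).filter fun u => u ∉ T ∧ ((∃ o ∈ T, o ∉ A ∧ E.Adj u o) ∨
    (∃ x, x ∉ T ∧ E.Adj u x) ∧ ¬ ∃ x, x ∉ T ∧ E.Adj u x ∧ ∃ a ∈ A, E.Adj x a)

/-- The set of vertices and the number of digits read at the end of the search. -/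
noncomputable def search (E : SimpleGraph ℕ) (n : ℕ) (T A : Finset ℕ) (dig : ℕ → ℕ) :
    Finset ℕ × ℕ :=
  pairPass E n T A dig (triplePass E n T A dig (A ∪ forced E n T A, 0))

/-- From every set with property `I`, suitable digits lead `F` to a larger set with properties `I`
and `Q`, where every digit read is paid for by a component. -/
def Advances (E : SimpleGraph ℕ) (A : Finset ℕ) (I : Finset ℕ → Prop)
    (F : (ℕ → ℕ) → Finset ℕ × ℕ → Finset ℕ × ℕ) (Q : Finset ℕ → Prop) : Prop :=
  ∀ Y, I Y → ∃ (Y' : Finset ℕ) (δ : List ℕ), I Y' ∧ Y ⊆ Y' ∧ Q Y' ∧ (∀ g ∈ δ, g < 3) ∧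
    comps E A Y' + δ.length ≤ comps E A Y ∧
    ∀ (dig : ℕ → ℕ) (p : ℕ), (∀ i < δ.length, dig (p + i) = δ.getD i 0) →
      F dig (Y, p) = (Y', p + δ.length)

variable {E : SimpleGraph ℕ} {Y Z X A T : Finset ℕ} {n ℓ : ℕ}

/-- The digits for two procedures in succession are concatenated. -/
theorem Advances.comp {I : Finset ℕ → Prop} {F G : (ℕ → ℕ) → Finset ℕ × ℕ → Finset ℕ × ℕ}
    {Q R : Finset ℕ → Prop} (hF : Advances E A I F Q) (hG : Advances E A I G R)
    (hQ : ∀ Y Z, Y ⊆ Z → Q Y → Q Z) :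
    Advances E A I (fun dig x => G dig (F dig x)) fun Y => Q Y ∧ R Y := by
  intro Y hY
  obtain ⟨Y₁, δ₁, hI₁, hs₁, hq₁, hd₁, hc₁, hf₁⟩ := hF Y hY
  obtain ⟨Y₂, δ₂, hI₂, hs₂, hq₂, hd₂, hc₂, hf₂⟩ := hG Y₁ hI₁
  refine ⟨Y₂, δ₁ ++ δ₂, hI₂, hs₁.trans hs₂, ⟨hQ _ _ hs₂ hq₁, hq₂⟩, ?_, ?_, fun dig p h => ?_⟩
  · intro g hg
    rcases List.mem_append.1 hg with hg | hg
    exacts [hd₁ g hg, hd₂ g hg]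
  · rw [List.length_append]
    omega
  · rw [List.length_append] at h ⊢
    change G dig (F dig (Y, p)) = _
    rw [hf₁ dig p fun i hi => by rw [h i (by omega), List.getD_append _ _ _ _ hi],
      hf₂ dig (p + δ₁.length) fun i hi => by
        rw [add_assoc, h _ (by omega), List.getD_append_right _ _ _ _ (by omega)]
        congr 1
        omega, add_assoc]

theorem Advances.rounds {I : Finset ℕ → Prop} {F : ℕ → (ℕ → ℕ) → Finset ℕ × ℕ → Finset ℕ × ℕ}
    {Q : ℕ → Finset ℕ → Prop} {m : ℕ} (hF : ∀ j < m, Advances E A I (F j) (Q j))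
    (hQ : ∀ j Y Z, Y ⊆ Z → Q j Y → Q j Z) :
    Advances E A I (fun dig => ConnVC.rounds m fun j => F j dig) fun Y => ∀ j < m, Q j Y := by
  induction m with
  | zero =>
    exact fun Y hY => ⟨Y, [], hY, subset_rfl, by simp, by simp, by simp, fun _ _ _ => rfl⟩
  | succ m ih =>
    have := Advances.comp (ih fun j hj => hF j (by omega)) (hF m (by omega))
      fun Y Z hYZ h j hj => hQ j Y Z hYZ (h j hj)
    intro Y hY
    obtain ⟨Y', δ, hI, hs, hq, hd, hc, hf⟩ := this Y hY
    refine ⟨Y', δ, hI, hs, fun j hj => ?_, hd, hc, hf⟩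
    rcases Nat.lt_succ_iff_lt_or_eq.1 hj with h | rfl
    exacts [hq.1 j h, hq.2]

/-- A branching step succeeds if the vertex that goes with an option may be added whenever the
option joins nothing, and some option may be added anyway. -/
theorem advances_branch {I : Finset ℕ → Prop} {a a' s b b' s' c c' s'' : ℕ}
    (ha : ¬ comps E A (insert a (insert a' Y)) < comps E A Y → I (insert s Y))
    (hb : ¬ comps E A (insert b (insert b' Y)) < comps E A Y → I (insert s' Y))
    (hc : ¬ comps E A (insert c (insert c' Y)) < comps E A Y → I (insert s'' Y))
    (ho : I (insert a (insert a' Y)) ∨ I (insert b (insert b' Y)) ∨ I (insert c (insert c' Y))) :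
    ∃ (Y' : Finset ℕ) (δ : List ℕ), I Y' ∧ Y ⊆ Y' ∧
      (s ∈ Y' ∨ s' ∈ Y' ∨ s'' ∈ Y' ∨ a ∈ Y' ∨ b ∈ Y' ∨ c ∈ Y') ∧ (∀ g ∈ δ, g < 3) ∧
      comps E A Y' + δ.length ≤ comps E A Y ∧
      ∀ (dig : ℕ → ℕ) (p : ℕ), (∀ i < δ.length, dig (p + i) = δ.getD i 0) →
        branch E A dig a a' s b b' s' c c' s'' (Y, p) = (Y', p + δ.length) := by
  have anti : ∀ {Z : Finset ℕ}, Y ⊆ Z → comps E A Z ≤ comps E A Y := fun h =>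
    Finset.card_le_card (reps_anti h)
  have sub2 : ∀ x y, Y ⊆ insert x (insert y Y) := fun x y =>
    (Finset.subset_insert _ _).trans (Finset.subset_insert _ _)
  by_cases h1 : comps E A (insert a (insert a' Y)) < comps E A Y
  swap
  · exact ⟨_, [], ha h1, Finset.subset_insert _ _, by simp, by simp,
      by simpa using anti (Finset.subset_insert _ _), fun dig p _ => by simp [branch, h1]⟩
  by_cases h2 : comps E A (insert b (insert b' Y)) < comps E A Y
  swap
  · exact ⟨_, [], hb h2, Finset.subset_insert _ _, by simp, by simp,
      by simpa using anti (Finset.subset_insert _ _), fun dig p _ => by simp [branch, h1, h2]⟩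
  by_cases h3 : comps E A (insert c (insert c' Y)) < comps E A Y
  swap
  · exact ⟨_, [], hc h3, Finset.subset_insert _ _, by simp, by simp,
      by simpa using anti (Finset.subset_insert _ _),
      fun dig p _ => by simp [branch, h1, h2, h3]⟩
  rcases ho with h | h | h
  · refine ⟨_, [0], h, sub2 _ _, by simp, by simp, h1, fun dig p hd => ?_⟩
    have := hd 0 (by simp)
    simp at this
    simp [branch, h1, h2, h3, this]
  · refine ⟨_, [1], h, sub2 _ _, by simp, by simp, h2, fun dig p hd => ?_⟩
    have := hd 0 (by simp)
    simp at this
    simp [branch, h1, h2, h3, this]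
  · refine ⟨_, [2], h, sub2 _ _, by simp, by simp, h3, fun dig p hd => ?_⟩
    have := hd 0 (by simp)
    simp at this
    simp [branch, h1, h2, h3, this]

/-- The invariant of the search. -/
def Good (E : SimpleGraph ℕ) (n ℓ : ℕ) (T A Y : Finset ℕ) : Prop :=
  Partial E n T A Y ∧ ∃ X, Extends E n ℓ T A Y X

theorem Good.insert_mem (h : Partial E n T A Y) (hX : Extends E n ℓ T A Y X) {x : ℕ}
    (hx : x ∈ X) : Extends E n ℓ T A (insert x Y) X ∧ Partial E n T A (insert x Y) :=
  ⟨⟨hX.cvc, hX.card, hX.inter, Finset.insert_subset hx hX.sub⟩, h.mono (Finset.subset_insert _ _)⟩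

/-- The three options for a triple are its pairs. Two vertices of every triangle belong to the
cover, and the vertex that goes with a pair is the third one. -/
theorem advances_tripleStep (hT : Cluster E T) {u v w : ℕ} (hu : u < n) (hv : v < n) (hw : w < n) :
    Advances E A (Good E n ℓ T A) (fun dig => tripleStep E T A dig u v w)
      fun Y => ¬ Triple E T Y u v w := by
  intro Y hY
  by_cases h : Triple E T Y u v w
  swap
  · exact ⟨Y, [], hY, subset_rfl, h, by simp, by simp, fun _ _ _ => by simp [tripleStep, h]⟩
  obtain ⟨⟨huT, hvT, hwT⟩, ⟨huY, hvY, hwY⟩, huv, huw, hvw⟩ := id h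
  obtain ⟨hP, X, hX⟩ := id hY
  have single : ∀ {s}, (∃ X, Extends E n ℓ T A (insert s Y) X) → Good E n ℓ T A (insert s Y) :=
    fun h => ⟨hP.mono (Finset.subset_insert _ _), h⟩
  have two : ∀ {s t}, s ∈ X → t ∈ X → Good E n ℓ T A (insert s (insert t Y)) := fun hs ht =>
    have := Good.insert_mem hP hX ht
    have := Good.insert_mem this.2 this.1 hs
    ⟨this.2, X, this.1⟩
  obtain ⟨Y', δ, h1, h2, h3, h4, h5, h6⟩ := advances_branch (E := E) (A := A) (a := u) (a' := v)
    (s := w) (b := u) (b' := w) (s' := v) (c := v) (c' := w) (s'' := u)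
    (fun hc => single (exists_extends_of_triple hX hP hT hw huT hvT hwT huv huw hvw huY hvY hc))
    (fun hc => single
      (exists_extends_of_triple hX hP hT hv huT hwT hvT huw huv hvw.symm huY hwY hc))
    (fun hc => single
      (exists_extends_of_triple hX hP hT hu hvT hwT huT hvw huv.symm huw.symm hvY hwY hc))
    (by
      by_cases hu : u ∈ X
      · by_cases hv : v ∈ X
        · exact .inl (two hu hv)
        · exact .inr (.inl (two hu ((hX.cvc.cover v w hvw).resolve_left hv)))
      · exact .inr (.inr (two ((hX.cvc.cover u v huv).resolve_left hu)
          ((hX.cvc.cover u w huw).resolve_left hu))))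
  refine ⟨Y', δ, h1, h2, fun h' => ?_, h4, h5, fun dig p hd => ?_⟩
  · obtain ⟨-, ⟨k1, k2, k3⟩, -⟩ := h'
    tauto
  · simp only [tripleStep, h, if_true]
    exact h6 dig p hd

theorem Triple.anti {u v w : ℕ} (hYZ : Y ⊆ Z) (h : ¬ Triple E T Y u v w) :
    ¬ Triple E T Z u v w := fun h' =>
  h ⟨h'.1, ⟨fun h => h'.2.1.1 (hYZ h), fun h => h'.2.1.2.1 (hYZ h), fun h => h'.2.1.2.2 (hYZ h)⟩,
    h'.2.2⟩

theorem Pair.anti {u w : ℕ} (hYZ : Y ⊆ Z) (h : ¬ Pair E T Y u w) : ¬ Pair E T Z u w := fun h' =>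
  h ⟨h'.1, ⟨fun h => h'.2.1.1 (hYZ h), fun h => h'.2.1.2 (hYZ h)⟩, h'.2.2⟩

theorem advances_triplePass (hT : Cluster E T) :
    Advances E A (Good E n ℓ T A) (triplePass E n T A)
      fun Y => ∀ u < n, ∀ v < n, ∀ w < n, ¬ Triple E T Y u v w :=
  Advances.rounds (fun _ hu => Advances.rounds (fun _ hv => Advances.rounds
    (fun _ hw => advances_tripleStep hT hu hv hw)
    fun _ _ _ hYZ h => Triple.anti hYZ h)
    fun _ _ _ hYZ h w hw => Triple.anti hYZ (h w hw))
    fun _ _ _ hYZ h v hv w hw => Triple.anti hYZ (h v hv w hw)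

/-- The invariant of the search once no undecided triples are left. -/
def Good₂ (E : SimpleGraph ℕ) (n ℓ : ℕ) (T A Y : Finset ℕ) : Prop :=
  Good E n ℓ T A Y ∧ ∀ u < n, ∀ v < n, ∀ w < n, ¬ Triple E T Y u v w

theorem Good₂.insert (h : Good₂ E n ℓ T A Y) {s : ℕ}
    (hs : ∃ X, Extends E n ℓ T A (insert s Y) X) : Good₂ E n ℓ T A (insert s Y) :=
  ⟨⟨h.1.1.mono (Finset.subset_insert _ _), hs⟩, fun u hu v hv w hw =>
    Triple.anti (Finset.subset_insert _ _) (h.2 u hu v hv w hw)⟩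

/-- For a pair the options are its two vertices, the second one being listed twice. As no
undecided triples are left, the rest of the clique is known to be in the cover. -/
theorem advances_pairStep (hT : Cluster E T) (hAT : A ⊆ T) (hE : ∀ x y, E.Adj x y → x < n)
    {u w : ℕ} (hu : u < n) (hw : w < n) :
    Advances E A (Good₂ E n ℓ T A) (fun dig => pairStep E T A dig u w)
      fun Y => ¬ Pair E T Y u w := by
  intro Y hY
  by_cases h : Pair E T Y u w
  swap
  · exact ⟨Y, [], hY, subset_rfl, h, by simp, by simp, fun _ _ _ => by simp [pairStep, h]⟩
  obtain ⟨⟨huT, hwT⟩, ⟨huY, hwY⟩, huw⟩ := id h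
  obtain ⟨⟨hP, X, hX⟩, hno⟩ := id hY
  have others : ∀ {u w}, u < n → w < n → u ∉ T → w ∉ T → u ∉ Y → w ∉ Y → E.Adj u w →
      ∀ x, x ∉ T → E.Adj u x → x ≠ w → x ∈ Y :=
      fun {u w} hu hw huT hwT huY hwY huw x hx hux hxw => by
    by_contra hxY
    exact hno u hu w hw x (hE x u hux.symm) ⟨⟨huT, hwT, hx⟩, ⟨huY, hwY, hxY⟩, huw, hux,
      (hT x u w hx huT hwT hux.symm huw hxw).symm⟩
  have first : ¬ comps E A (insert u (insert u Y)) < comps E A Y → Good₂ E n ℓ T A (insert w Y) :=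
    fun hc => hY.insert (exists_extends_of_pair hX hP hT hAT hu hw huT hwT huw huY
      (others hu hw huT hwT huY hwY huw) (by simpa using hc))
  have second : ¬ comps E A (insert w (insert w Y)) < comps E A Y → Good₂ E n ℓ T A (insert u Y) :=
    fun hc => hY.insert (exists_extends_of_pair hX hP hT hAT hw hu hwT huT huw.symm hwY
      (others hw hu hwT huT hwY huY huw.symm) (by simpa using hc))
  obtain ⟨Y', δ, h1, h2, h3, h4, h5, h6⟩ := advances_branch (E := E) (A := A) (a := u) (a' := u)
    (s := w) (b := w) (b' := w) (s' := u) (c := w) (c' := w) (s'' := u) first second second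
    (by
      simp only [Finset.insert_idem]
      rcases hX.cvc.cover u w huw with h | h
      · exact .inl (hY.insert ⟨X, (Good.insert_mem hP hX h).1⟩)
      · exact .inr (.inl (hY.insert ⟨X, (Good.insert_mem hP hX h).1⟩)))
  refine ⟨Y', δ, h1, h2, fun h' => ?_, h4, h5, fun dig p hd => ?_⟩
  · obtain ⟨-, ⟨k1, k2⟩, -⟩ := h'
    tauto
  · simp only [pairStep, h, if_true]
    exact h6 dig p hd

theorem advances_pairPass (hT : Cluster E T) (hAT : A ⊆ T) (hE : ∀ x y, E.Adj x y → x < n) :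
    Advances E A (Good₂ E n ℓ T A) (pairPass E n T A)
      fun Y => ∀ u < n, ∀ w < n, ¬ Pair E T Y u w :=
  Advances.rounds (fun _ hu => Advances.rounds
    (fun _ hw => advances_pairStep hT hAT hE hu hw)
    fun _ _ _ hYZ h => Pair.anti hYZ h)
    fun _ _ _ hYZ h w hw => Pair.anti hYZ (h w hw)

/-- The forced vertices belong to every connected vertex cover that meets `T` in `A`. -/
theorem good_start (hT : Cluster E T) (hE : ∀ x y, E.Adj x y → x < n) (hX : IsCVC E n X)
    (hl : X.card ≤ ℓ) (hA : ∀ x ∈ T, x ∈ X ↔ x ∈ A) (hAX : A ⊆ X) (hAT : A ⊆ T) {r : ℕ}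
    (hr : r ∈ A) : Good E n ℓ T A (A ∪ forced E n T A) := by
  classical
  refine ⟨⟨Finset.subset_union_left, fun u hu hY y hy huy => ?_, fun u x hun hu hY hx hux => ?_⟩,
    X, hX, hl, hA, Finset.union_subset hAX fun u hu => ?_⟩
  · by_contra hyA
    exact hY (Finset.mem_union_right _ (Finset.mem_filter.2
      ⟨Finset.mem_range.2 (hE u y huy), hu, .inl ⟨y, hy, hyA, huy⟩⟩))
  · by_contra h
    exact hY (Finset.mem_union_right _ (Finset.mem_filter.2
      ⟨Finset.mem_range.2 hun, hu, .inr ⟨⟨x, hx, hux⟩, h⟩⟩))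
  · obtain ⟨-, huT, ⟨o, ho, hoA, huo⟩ | ⟨⟨x, hx, hux⟩, hno⟩⟩ := Finset.mem_filter.1 hu
    · exact (hX.cover u o huo).resolve_right fun h => hoA ((hA o ho).1 h)
    · by_contra huX
      have hxX := (hX.cover u x hux).resolve_left huX
      -- without `u`, the clique is a component of its own
      refine ((hX.joined x hxX r (hAX hr)).closed (fun z => z ∉ T ∧ E.Adj u z) ⟨hx, hux⟩
        fun p q hp hpq _ hq => ?_).1 (hAT hr)
      have hqT : q ∉ T := fun hqT => hno ⟨p, hp.1, hp.2, q, (hA q hqT).1 hq, hpq⟩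
      exact ⟨hqT, hT u p q huT hp.1 hqT hp.2 hpq fun e => huX (e ▸ hq)⟩

/-- At the end of the search, all components meet `A`. -/
theorem joined_of_no_pair (hT : Cluster E T) (hE : ∀ x y, E.Adj x y → x < n) (hAT : A ⊆ T) {r : ℕ}
    (hr : r ∈ A) (hP : Partial E n T A Y) (hX : Extends E n ℓ T A Y X)
    (hno : ∀ u < n, ∀ w < n, ¬ Pair E T Y u w) {y : ℕ} (hy : y ∈ Y) :
    ∃ a ∈ A, Joined E Y a y := by
  by_cases hyT : y ∈ T
  · exact ⟨y, (hX.inter y hyT).1 (hX.sub hy), .refl y⟩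
  -- a vertex of `Y` in the clique of `y` with a neighbour in `A`
  suffices h : ∃ x ∈ Y, (x = y ∨ E.Adj x y) ∧ ∃ a ∈ A, E.Adj x a by
    obtain ⟨x, hx, hxy, a, ha, hxa⟩ := h
    refine ⟨a, ha, (Joined.single hxa.symm (hP.sub ha) hx).trans ?_⟩
    rcases hxy with rfl | hxy
    exacts [.refl x, .single hxy hx hy]
  by_cases hu : ∃ u, u ∉ T ∧ u ∉ Y ∧ E.Adj u y
  · obtain ⟨u, huT, huY, huy⟩ := hu
    obtain ⟨x, hxT, hux, a, ha, hxa⟩ := hP.touch u y (hE u y huy) huT huY hyT huy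
    refine ⟨x, ?_, ?_, a, ha, hxa⟩
    · by_contra hxY
      exact hno u (hE u x hux) x (hE x u hux.symm) ⟨⟨huT, hxT⟩, ⟨huY, hxY⟩, hux⟩
    · by_cases hxy : x = y
      exacts [.inl hxy, .inr (hT x u y hxT huT hyT hux.symm huy hxy)]
  · push Not at hu
    by_contra! h
    refine ((hX.cvc.joined y (hX.sub hy) r (hX.sub (hP.sub hr))).closed
      (fun z => z ∉ T ∧ (z = y ∨ E.Adj z y)) ⟨hyT, .inl rfl⟩ fun p q hp hpq _ hq => ?_).1 (hAT hr)
    have hpY : p ∈ Y := by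
      by_contra hpY
      rcases hp.2 with rfl | hpy
      exacts [hpY hy, hu p hp.1 hpY hpy]
    have hqT : q ∉ T := fun hqT => h p hpY hp.2 q ((hX.inter q hqT).1 hq) hpq
    refine ⟨hqT, ?_⟩
    by_cases hqy : q = y
    · exact .inl hqy
    · rcases hp.2 with rfl | hpy
      · exact .inr hpq.symm
      · exact .inr (hT q p y hqT hp.1 hyT hpq.symm hpy hqy)

/-- For every connected vertex cover that meets `T` in `A` there are digits which lead the search to
a vertex cover that is contained in a connected vertex cover that is no larger. Each digit lowers
the number of components. -/
theorem exists_search (hT : Cluster E T) (hE : ∀ x y, E.Adj x y → x < n) (hX : IsCVC E n X)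
    (hl : X.card ≤ ℓ) (hA : ∀ x ∈ T, x ∈ X ↔ x ∈ A) (hAX : A ⊆ X) (hAT : A ⊆ T) {r : ℕ}
    (hr : r ∈ A) : ∃ (Y : Finset ℕ) (δ : List ℕ), (∀ g ∈ δ, g < 3) ∧
      comps E Y Y + δ.length ≤ A.card ∧ (∀ x y, E.Adj x y → x ∈ Y ∨ y ∈ Y) ∧
      (∃ X, Y ⊆ X ∧ IsCVC E n X ∧ X.card ≤ ℓ) ∧
      ∀ dig : ℕ → ℕ, (∀ i < δ.length, dig i = δ.getD i 0) →
        (search E n T A dig).1 = Y := by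
  have start := good_start hT hE hX hl hA hAX hAT hr
  obtain ⟨Y₁, δ₁, hg₁, -, hq₁, hd₁, hc₁, hf₁⟩ := advances_triplePass hT _ start
  obtain ⟨Y₂, δ₂, ⟨⟨hP, X₂, hX₂⟩, -⟩, hs₂, hq₂, hd₂, hc₂, hf₂⟩ :=
    advances_pairPass hT hAT hE _ (⟨hg₁, hq₁⟩ : Good₂ E n ℓ T A Y₁)
  refine ⟨Y₂, δ₁ ++ δ₂, ?_, ?_, fun x y hxy => ?_, ⟨X₂, hX₂.sub, hX₂.cvc, hX₂.card⟩,
    fun dig h => ?_⟩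
  · intro g hg
    rcases List.mem_append.1 hg with hg | hg
    exacts [hd₁ g hg, hd₂ g hg]
  · have h1 := comps_self_le fun y hy => joined_of_no_pair hT hE hAT hr hP hX₂ hq₂ hy
    have h2 := comps_le_card (E := E) (A := A) (Y := A ∪ forced E n T A)
    rw [List.length_append]
    omega
  · by_contra! hno
    have hYT : ∀ z ∈ T, z ∉ Y₂ → z ∉ X₂ := fun z hz hzY h => hzY (hP.sub ((hX₂.inter z hz).1 h))
    have one : ∀ {x y}, E.Adj x y → x ∉ Y₂ → y ∉ Y₂ → x ∈ T → False := fun {x y} hxy hx hy hxT => by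
      have hyX := (hX₂.cvc.cover x y hxy).resolve_left (hYT x hxT hx)
      by_cases hyT : y ∈ T
      · exact hYT y hyT hy hyX
      · exact hx (hP.sub (hP.out y hyT hy x hxT hxy.symm))
    by_cases hxT : x ∈ T
    · exact one hxy hno.1 hno.2 hxT
    by_cases hyT : y ∈ T
    · exact one hxy.symm hno.2 hno.1 hyT
    exact hq₂ x (hE x y hxy) y (hE y x hxy.symm) ⟨⟨hxT, hyT⟩, ⟨hno.1, hno.2⟩, hxy⟩
  · rw [List.length_append] at h
    rw [search, hf₁ dig 0 fun i hi => by
        rw [zero_add, h i (by omega), List.getD_append _ _ _ _ hi],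
      hf₂ dig (0 + δ₁.length) fun i hi => by
        rw [zero_add, h _ (by omega), List.getD_append_right _ _ _ _ (by omega)]
        congr 1
        omega]

end ConnVC

/-! ### The program -/

namespace ConnVC

open LoopLang LoopLang.Ex LoopLang.Cmd

-- The variables of the program. Variable `1` is missing: it holds the length of the input.
notation "vAns" => (0 : ℕ)
notation "vLim" => (2 : ℕ)
notation "vN" => (3 : ℕ)
notation "vEll" => (4 : ℕ)
notation "vCodes" => (5 : ℕ)
notation "vRoot" => (6 : ℕ)
notation "vCode" => (7 : ℕ)
notation "vRest" => (8 : ℕ)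
notation "vDigit" => (9 : ℕ)
notation "vCnt" => (10 : ℕ)
notation "vZeros" => (11 : ℕ)
notation "vI" => (12 : ℕ)
notation "vU" => (13 : ℕ)
notation "vV" => (14 : ℕ)
notation "vW" => (15 : ℕ)
notation "vP" => (16 : ℕ)
notation "vQ" => (17 : ℕ)
notation "vY" => (18 : ℕ)
notation "vX" => (19 : ℕ)
notation "vComps" => (20 : ℕ)
notation "vC₀" => (21 : ℕ)
notation "vC₁" => (22 : ℕ)
notation "vC₂" => (23 : ℕ)
notation "vC₃" => (24 : ℕ)
notation "vPtr" => (25 : ℕ)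
notation "vRead" => (26 : ℕ)
notation "vF₁" => (27 : ℕ)
notation "vF₂" => (28 : ℕ)
notation "vF₃" => (29 : ℕ)
notation "vPow" => (30 : ℕ)
notation "vMask" => (31 : ℕ)
notation "vBits" => (32 : ℕ)
notation "vMeet" => (33 : ℕ)
notation "vNext" => (34 : ℕ)
notation "vPlace" => (35 : ℕ)
notation "vJ" => (36 : ℕ)
notation "vBit" => (37 : ℕ)
notation "vHit" => (38 : ℕ)
notation "vSize" => (39 : ℕ)
notation "vCover" => (40 : ℕ)
notation "vTmp" => (41 : ℕ)
notation "vK" => (42 : ℕ)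

-- The arrays of the program. They share the memory behind the input, hence the bound `8`.
notation "aIn" => (0 : ℕ)
notation "aY" => (1 : ℕ)
notation "aA" => (2 : ℕ)
notation "aDig" => (3 : ℕ)
notation "aLab" => (4 : ℕ)
notation "aRank" => (5 : ℕ)
notation "aDp" => (6 : ℕ)
notation "aT" => (7 : ℕ)

/-- Adjacency of the vertices held by two variables. -/
def adjE (x y : ℕ) : Ex := arr aIn (add (const 2) (add (mul (var x) (var vN)) (var y)))

/-- Membership in the cluster deletion set of the vertex held by a variable. -/
def setE (x : ℕ) : Ex := arr aIn (add (const 2) (add (mul (var vN) (var vN)) (var x)))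

/-- Negation. -/
def notE (a : Ex) : Ex := sub (const 1) a

/-- Equality. -/
def eqE (a b : Ex) : Ex := lt (add (sub a b) (sub b a)) (const 1)

/-- The vertex held by a variable is marked in an array. -/
def inE (k x : ℕ) : Ex := arr k (var x)

/-- Case distinction without alternative. -/
def whenC (b : Ex) (p : Cmd) : Cmd := ite b p skip

/-- Component labels: every vertex of `Y` receives the least vertex of the base set in its
component, found by `n * n` passes over all edges. Then the least vertices are numbered. -/
def labelC (k : ℕ) : Cmd :=
  seq (loop vX vN (ite (inE k vX) (aset aLab (var vX) (var vX)) (aset aLab (var vX) (var vN))))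
  (seq (loop vP vN (loop vQ vN (loop vY vN (loop vX vN
    (whenC (mul (inE aY vY) (mul (inE aY vX) (mul (adjE vY vX)
        (lt (arr aLab (var vY)) (arr aLab (var vX))))))
      (aset aLab (var vX) (arr aLab (var vY))))))))
  (seq (set vComps (const 0))
  (loop vX vN (whenC (mul (inE k vX) (eqE (arr aLab (var vX)) (var vX)))
    (seq (aset aRank (var vX) (var vComps)) (set vComps (add (var vComps) (const 1))))))))

/-- The next digit of the current code is read if the vertex `vI` belongs to `S`. A digit below `3`
is stored for the search, and the trailing zeros among the stored digits are counted. -/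
def digitC : Cmd :=
  seq (set vDigit (sub (var vRest) (mul (const 4) (half (half (var vRest))))))
    (whenC (setE vI)
      (seq (set vRest (half (half (var vRest))))
        (whenC (lt (var vDigit) (const 3))
          (seq (aset aDig (var vCnt) (var vDigit))
          (seq (set vCnt (add (var vCnt) (const 1)))
            (ite (var vDigit) (set vZeros (const 0))
              (set vZeros (add (var vZeros) (const 1)))))))))

/-- Membership of the vertex `vI` in `T` and in `A`. -/
def markC : Cmd :=
  seq (aset aT (var vI) (lt (const 0) (add (setE vI) (eqE (var vI) (var vRoot)))))
    (aset aA (var vI) (lt (const 0) (add (mul (setE vI) (lt (var vDigit) (const 3)))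
      (eqE (var vI) (var vRoot)))))

/-- Decoding of the current code: the digits of the vertices of `S` determine the sets `T` and `A`
and the digits for the search. -/
def decodeC : Cmd :=
  seq (set vRest (var vCode)) (seq (set vCnt (const 0)) (seq (set vZeros (const 0))
  (loop vI vN (seq digitC markC))))

/-- The initial set `Y`. -/
def startC : Cmd :=
  loop vU vN (seq (set vF₁ (const 0)) (seq (set vF₂ (const 0)) (seq (set vF₃ (const 0))
    (seq (loop vV vN (whenC (adjE vU vV)
      (ite (inE aT vV) (whenC (notE (inE aA vV)) (set vF₁ (const 1)))
        (seq (set vF₂ (const 1))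
          (loop vW vN (whenC (mul (inE aA vW) (adjE vV vW)) (set vF₃ (const 1))))))))
      (aset aY (var vU) (lt (const 0) (add (inE aA vU) (mul (notE (inE aT vU))
        (add (var vF₁) (mul (var vF₂) (notE (var vF₃))))))))))))

/-- Mark two vertices in `Y`. -/
def add₂C (a b : ℕ) : Cmd := seq (aset aY (var b) (const 1)) (aset aY (var a) (const 1))

/-- The number of components that remain if two undecided vertices are added to `Y`. -/
def testC (a b out : ℕ) : Cmd :=
  seq (add₂C a b) (seq (labelC aA) (seq (set out (var vComps))
    (seq (aset aY (var b) (const 0)) (aset aY (var a) (const 0)))))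

/-- One step of the search. -/
def branchC (a a' s b b' s' c c' s'' : ℕ) : Cmd :=
  seq (labelC aA) (seq (set vC₀ (var vComps))
  (seq (testC a a' vC₁) (seq (testC b b' vC₂) (seq (testC c c' vC₃)
  (ite (notE (lt (var vC₁) (var vC₀))) (aset aY (var s) (const 1))
  (ite (notE (lt (var vC₂) (var vC₀))) (aset aY (var s') (const 1))
  (ite (notE (lt (var vC₃) (var vC₀))) (aset aY (var s'') (const 1))
  (seq (set vRead (arr aDig (var vPtr))) (seq (set vPtr (add (var vPtr) (const 1)))
    (ite (eqE (var vRead) (const 0)) (add₂C a a')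
      (ite (eqE (var vRead) (const 1)) (add₂C b b') (add₂C c c'))))))))))))

/-- The vertex held by a variable is undecided. -/
def openE (x : ℕ) : Ex := mul (notE (inE aT x)) (notE (inE aY x))

/-- The steps for triples. -/
def triplesC : Cmd :=
  loop vU vN (loop vV vN (loop vW vN
    (whenC (mul (mul (openE vU) (mul (openE vV) (openE vW)))
        (mul (adjE vU vV) (mul (adjE vU vW) (adjE vV vW))))
      (branchC vU vV vW vU vW vV vV vW vU))))

/-- The steps for pairs. -/
def pairsC : Cmd :=
  loop vU vN (loop vW vN
    (whenC (mul (mul (openE vU) (openE vW)) (adjE vU vW))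
      (branchC vU vU vW vW vW vU vW vW vU)))

/-- The size of `Y`, the test whether `Y` is a vertex cover, and the components of `Y`. -/
def measureC : Cmd :=
  seq (set vSize (const 0)) (seq (set vCover (const 1))
  (seq (loop vY vN (seq (whenC (inE aY vY) (set vSize (add (var vSize) (const 1))))
    (loop vX vN (whenC (mul (adjE vY vX) (mul (notE (inE aY vY)) (notE (inE aY vX))))
      (set vCover (const 0))))))
  (labelC aY)))

/-- The test whether the vertex `vU` has a neighbour in the component number `vJ`. -/
def hitC : Cmd :=
  seq (set vHit (const 0))
    (loop vX vN (whenC (mul (inE aY vX) (mul (adjE vU vX)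
      (eqE (arr aRank (arr aLab (var vX))) (var vJ)))) (set vHit (const 1))))

/-- The treatment of the component number `vJ`. Sums are clamped to remain below `vPow`. -/
def bitC : Cmd :=
  seq (set vBit (sub (var vBits) (mul (const 2) (half (var vBits)))))
  (seq (set vBits (half (var vBits)))
  (seq hitC
  (seq (whenC (mul (var vBit) (var vHit)) (set vMeet (const 1)))
  (seq (whenC (add (var vBit) (var vHit)) (setC vNext (add (var vNext) (var vPlace)) vPow))
    (setC vPlace (add (var vPlace) (var vPlace)) vPow)))))

/-- The components met by the vertex `vU` are added to the set of components coded by `vMask`. -/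
def unionC : Cmd :=
  seq (set vBits (var vMask)) (seq (set vMeet (const 0)) (seq (set vNext (const 0))
  (seq (set vPlace (const 1)) (loop vJ vN (whenC (lt (var vJ) (var vComps)) bitC)))))

/-- One step of the dynamic program: the vertex `vU` links the set of components coded by `vMask`
with all components that it meets. -/
def relaxC : Cmd :=
  seq unionC
    (whenC (mul (var vMeet) (lt (add (arr aDp (var vMask)) (const 1)) (arr aDp (var vNext))))
      (aset aDp (var vNext) (add (arr aDp (var vMask)) (const 1))))

/-- The number of sets of components. -/
def powC : Cmd :=
  seq (set vPow (const 1))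
    (loop vJ vN (whenC (lt (var vJ) (var vComps)) (setC vPow (add (var vPow) (var vPow)) vLim)))

/-- The table of the dynamic program before the first step. -/
def tableC : Cmd :=
  seq (loop vMask vPow (aset aDp (var vMask) (add (var vN) (const 1))))
    (aset aDp (const 1) (const 0))

/-- The body of the main loop of the dynamic program. -/
def roundC : Cmd :=
  whenC (lt (arr aDp (var vMask)) (add (var vN) (const 1)))
    (loop vU vN (whenC (notE (inE aY vU)) relaxC))

/-- The acceptance test at the end of the dynamic program. -/
def acceptC : Cmd :=
  whenC (mul (lt (arr aDp (sub (var vPow) (const 1))) (add (var vN) (const 1)))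
      (lt (add (var vSize) (arr aDp (sub (var vPow) (const 1)))) (add (var vEll) (const 1))))
    (set vAns (const 1))

/-- The dynamic program that finds the least number of vertices linking all components of `Y`. -/
def steinerC : Cmd :=
  seq powC (seq tableC (seq (loop vMask vPow roundC) acceptC))

/-- The search for one code. -/
def searchC : Cmd :=
  seq decodeC (seq startC (seq (set vPtr (const 0)) (seq triplesC (seq pairsC measureC))))

/-- The treatment of one code. -/
def codeC : Cmd :=
  seq searchC
    (whenC (mul (var vCover) (lt (var vComps) (add (var vZeros) (const 2)))) steinerC)

/-- The number of codes is multiplied by four if the vertex `vI` belongs to `S`. -/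
def growC : Cmd :=
  whenC (setE vI) (seq (set vTmp (const 0))
    (seq (loop vK vCodes (set vTmp (add (var vTmp) (const 4)))) (set vCodes (var vTmp))))

/-- The number of codes, and a bound for clamped sums. -/
def codesC : Cmd :=
  seq (set vCodes (const 1)) (seq (loop vI vN growC)
  (seq (set vLim (const 1)) (loop vK vCodes (set vLim (add (var vLim) (const 4))))))

/-- The two nested loops over roots and codes. -/
def loopsC : Cmd := loop vRoot vN (loop vCode vCodes codeC)

/-- The whole program. -/
def mainC : Cmd :=
  seq (set vN (arr aIn (const 0))) (seq (set vEll (arr aIn (const 1)))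
  (seq codesC loopsC))

theorem mainC_wf : mainC.wf = true := by decide +kernel

/-! ### Reasoning about the program -/

@[simp] theorem val_notE (s : Store) (a : Ex) : (notE a).val s ≠ 0 ↔ a.val s = 0 := by
  simp only [notE, val]
  omega

theorem val_eqE (s : Store) (a b : Ex) : (eqE a b).val s = if a.val s = b.val s then 1 else 0 := by
  simp only [eqE, val]
  congr 1
  apply propext
  omega

@[simp] theorem run_whenC (b : Ex) (p : Cmd) (s : Store) :
    (whenC b p).run s = if b.val s ≠ 0 then p.run s else s := rfl

/-- The invariant rule for loops with a given number of rounds. -/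
theorem loop_inv {p : Cmd} {i b m : ℕ} {s : Store} (hm : s.v b = m) (I : ℕ → Store → Prop)
    (h0 : I 0 (s.setV i 0))
    (hs : ∀ j t, j < m → (loop i b p).Agree s t → t.v i = j → I j t →
      I (j + 1) ((p.run t).setV i (j + 1))) :
    I m ((loop i b p).run s) := by
  subst hm
  exact loop_rule I h0 hs

/-- A loop whose body acts on some aspect `g` of the state like the function `f`. -/
theorem loop_rounds {α : Type*} {p : Cmd} {i b m : ℕ} {s : Store} (hm : s.v b = m) (g : Store → α)
    (f : ℕ → α → α) (hg : ∀ t m, g (t.setV i m) = g t)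
    (hs : ∀ j t, j < m → (loop i b p).Agree s t → t.v i = j → g (p.run t) = f j (g t)) :
    g ((loop i b p).run s) = rounds m f (g s) :=
  loop_inv hm (fun j t => g t = rounds j f (g s)) (by rw [hg]; rfl) fun j t hj ha hi h => by
    rw [hg, hs j t hj ha hi, h, rounds]

/-- The set of vertices marked in an array. -/
def marked (n : ℕ) (f : ℕ → ℕ) : Finset ℕ := (Finset.range n).filter fun x => f x ≠ 0

theorem mem_marked {n : ℕ} {f : ℕ → ℕ} {x : ℕ} : x ∈ marked n f ↔ x < n ∧ f x ≠ 0 := by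
  simp [marked]

theorem marked_insert {n : ℕ} {f : ℕ → ℕ} {x : ℕ} (hx : x < n) :
    marked n (Function.update f x 1) = insert x (marked n f) := by
  ext y
  by_cases h : y = x
  · subst h
    simp [mem_marked, hx]
  · simp [mem_marked, h]

/-- The state holds the graph `E`, the set `S` and the number `ℓ`. -/
structure Input (E : SimpleGraph ℕ) (n ℓ : ℕ) (S : Finset ℕ) (s : Store) : Prop where
  hn : s.v vN = n
  hl : s.v vEll = ℓ
  adj : ∀ x y, x < n → y < n → (s.a aIn (2 + (x * n + y)) ≠ 0 ↔ E.Adj x y)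
  set : ∀ x, x < n → (s.a aIn (2 + (n * n + x)) ≠ 0 ↔ x ∈ S)

theorem Input.of_eq {E : SimpleGraph ℕ} {n ℓ : ℕ} {S : Finset ℕ} {s t : Store}
    (h : Input E n ℓ S s) (h1 : t.v vN = s.v vN) (h2 : t.v vEll = s.v vEll)
    (h3 : t.a aIn = s.a aIn) : Input E n ℓ S t where
  hn := h1.trans h.hn
  hl := h2.trans h.hl
  adj := by rw [h3]; exact h.adj
  set := by rw [h3]; exact h.set

theorem Input.agree {E : SimpleGraph ℕ} {n ℓ : ℕ} {S : Finset ℕ} {s t : Store} {p : Cmd}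
    (h : Input E n ℓ S s) (ha : p.Agree s t)
    (hp : (p.wv vN || p.wv vEll || p.wa aIn) = false) : Input E n ℓ S t := by
  simp only [Bool.or_eq_false_iff] at hp
  exact h.of_eq (ha.1 _ hp.1.1) (ha.1 _ hp.1.2) (ha.2 _ hp.2)

theorem Input.adjE {E : SimpleGraph ℕ} {n ℓ : ℕ} {S : Finset ℕ} {s : Store}
    (h : Input E n ℓ S s) {x y : ℕ} (hx : s.v x < n) (hy : s.v y < n) :
    (adjE x y).val s ≠ 0 ↔ E.Adj (s.v x) (s.v y) := by
  simp only [ConnVC.adjE, val, h.hn]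
  exact h.adj _ _ hx hy

theorem Input.setE {E : SimpleGraph ℕ} {n ℓ : ℕ} {S : Finset ℕ} {s : Store}
    (h : Input E n ℓ S s) {x : ℕ} (hx : s.v x < n) : (setE x).val s ≠ 0 ↔ s.v x ∈ S := by
  simp only [ConnVC.setE, val, h.hn]
  exact h.set _ hx

/-! ### Component labels -/

/-- If each step lowers a potential or does nothing, so does a pass over all steps; in the latter
case the state is a fixed point of every step. -/
theorem rounds_decreasing {α : Type*} (Φ : α → ℕ) {f : ℕ → α → α} {m : ℕ}
    (hf : ∀ j < m, ∀ x, f j x = x ∨ Φ (f j x) < Φ x) (x : α) :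
    (rounds m f x = x ∧ ∀ j < m, f j x = x) ∨ Φ (rounds m f x) < Φ x := by
  induction m with
  | zero => exact .inl ⟨rfl, by simp⟩
  | succ m ih =>
    rcases ih (fun j hj => hf j (by omega)) with ⟨h1, h2⟩ | h
    · rw [rounds, h1]
      rcases hf m (by omega) x with h | h
      · refine .inl ⟨h, fun j hj => ?_⟩
        rcases Nat.lt_succ_iff_lt_or_eq.1 hj with hj | rfl
        exacts [h2 j hj, h]
      · exact .inr h
    · refine .inr ?_
      rw [rounds]
      rcases hf m (by omega) (rounds m f x) with h' | h'
      · rwa [h']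
      · exact h'.trans h

/-- A function that lowers a potential unless it does nothing reaches a fixed point. -/
theorem iterate_fixed {α : Type*} (Φ : α → ℕ) {f : α → α} (hf : ∀ x, f x = x ∨ Φ (f x) < Φ x)
    (m : ℕ) (x : α) (hx : Φ x ≤ m) : f (f^[m] x) = f^[m] x := by
  induction m generalizing x with
  | zero => exact (hf x).resolve_right (by omega)
  | succ m ih =>
    rcases hf x with h | h
    · rw [Function.iterate_fixed h, h]
    · exact ih (f x) (by omega)

theorem rounds_const {α : Type*} (f : α → α) (m : ℕ) (x : α) :
    rounds m (fun _ => f) x = f^[m] x := by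
  induction m with
  | zero => rfl
  | succ m ih => rw [rounds, ih, Function.iterate_succ_apply']

theorem rounds_inv {α : Type*} (P : α → Prop) {f : ℕ → α → α} {m : ℕ}
    (hf : ∀ j < m, ∀ x, P x → P (f j x)) {x : α} (hx : P x) : P (rounds m f x) := by
  induction m with
  | zero => exact hx
  | succ m ih => exact hf m (by omega) _ (ih fun j hj => hf j (by omega))

open Classical in
/-- Lower the label of `z` to that of its neighbour `y`. -/
noncomputable def lower (E : SimpleGraph ℕ) (Y : Finset ℕ) (y z : ℕ) (L : ℕ → ℕ) : ℕ → ℕ :=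
  if y ∈ Y ∧ z ∈ Y ∧ E.Adj y z ∧ L y < L z then Function.update L z (L y) else L

theorem lower_decreasing {E : SimpleGraph ℕ} {Y : Finset ℕ} {n y z : ℕ} (hz : z < n)
    (L : ℕ → ℕ) : lower E Y y z L = L ∨
      ∑ x ∈ Finset.range n, lower E Y y z L x < ∑ x ∈ Finset.range n, L x := by
  unfold lower
  split_ifs with h
  · refine .inr (Finset.sum_lt_sum (fun x _ => ?_) ⟨z, Finset.mem_range.2 hz, by simp [h.2.2.2]⟩)
    by_cases hx : x = z
    · subst hx
      simpa using h.2.2.2.le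
    · simp [hx]
  · exact .inl rfl

/-- The invariant of the labels: a vertex of the base set has a label at most itself, and every
label is either the default value `n` or a vertex of the base set in the component of its owner. -/
def Labels (E : SimpleGraph ℕ) (n : ℕ) (B Y : Finset ℕ) (L : ℕ → ℕ) : Prop :=
  (∀ a ∈ B, L a ≤ a) ∧ ∀ x < n, L x = n ∨ L x ∈ B ∧ Joined E Y (L x) x

theorem Labels.lower {E : SimpleGraph ℕ} {n : ℕ} {B Y : Finset ℕ} {L : ℕ → ℕ}
    (h : Labels E n B Y L) {y z : ℕ} (hy : y < n) :
    Labels E n B Y (lower E Y y z L) := by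
  unfold ConnVC.lower
  split_ifs with hc
  · refine ⟨fun a ha => ?_, fun x hx => ?_⟩
    · by_cases hxz : a = z
      · subst hxz
        simpa using hc.2.2.2.le.trans (h.1 a ha)
      · simpa [hxz] using h.1 a ha
    · by_cases hxz : x = z
      · subst hxz
        simp only [Function.update_self]
        exact (h.2 y hy).imp_right fun h => ⟨h.1, h.2.trans (.single hc.2.2.1 hc.1 hc.2.1)⟩
      · simpa [hxz] using h.2 x hx
  · exact h

/-- After `n * n` passes over all edges the labels are the least vertices of the base set in the
components. -/
theorem labels_final {E : SimpleGraph ℕ} {n : ℕ} {B Y : Finset ℕ} (hY : Y ⊆ Finset.range n)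
    (hB : B ⊆ Y) {L L' : ℕ → ℕ} (hL : Labels E n B Y L)
    (h' : L' = rounds n (fun _ => rounds n fun _ => rounds n fun y => rounds n fun z =>
      lower E Y y z) L) :
    Labels E n B Y L' ∧ ∀ a ∈ B, ∀ x, Joined E Y a x → L' x ≤ a := by
  set Φ : (ℕ → ℕ) → ℕ := fun L => ∑ x ∈ Finset.range n, L x with hΦ
  set pass : (ℕ → ℕ) → ℕ → ℕ := rounds n fun y => rounds n fun z => lower E Y y z with hpass
  have hinv : ∀ L, Labels E n B Y L → Labels E n B Y (pass L) := fun L hL =>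
    rounds_inv (Labels E n B Y) (fun y hy L hL => rounds_inv (Labels E n B Y)
      (fun z _ L hL => hL.lower hy) hL) hL
  have hin : ∀ y < n, ∀ L, _ := fun y _ =>
    rounds_decreasing (m := n) Φ (f := fun z => lower E Y y z) fun z hz L => lower_decreasing hz L
  have hout := rounds_decreasing (m := n) Φ (f := fun y => rounds n fun z => lower E Y y z)
    fun y hy L => (hin y hy L).imp_left And.left
  have hit : L' = pass^[n * n] L := by
    rw [h', rounds_const]
    have : (rounds n fun _ => pass) = pass^[n] := funext fun x => rounds_const pass n x
    rw [this, ← Function.iterate_mul]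
  have hL' : Labels E n B Y L' := by
    rw [hit, ← rounds_const]
    exact rounds_inv (Labels E n B Y) (fun _ _ => hinv) hL
  have hfix : pass L' = L' := by
    rw [hit]
    refine iterate_fixed Φ (fun L => (hout L).imp_left And.left) _ _ ?_
    calc Φ L ≤ ∑ _x ∈ Finset.range n, n := Finset.sum_le_sum fun x hx => by
          rcases hL.2 x (Finset.mem_range.1 hx) with h | h
          · exact h.le
          · exact (Finset.mem_range.1 (hY (hB h.1))).le
      _ = n * n := by simp
  have hedge : ∀ y z, E.Adj y z → y ∈ Y → z ∈ Y → L' z ≤ L' y := fun y z hyz hy hz => by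
    by_contra! hlt
    have hyn := Finset.mem_range.1 (hY hy)
    have hzn := Finset.mem_range.1 (hY hz)
    have h1 : ∀ j < n, (rounds n fun z => lower E Y j z) L' = L' := by
      rcases hout L' with h | h
      · exact h.2
      · exact absurd h (by rw [← hpass, hfix]; exact lt_irrefl _)
    have h2 : ∀ j < n, lower E Y y j L' = L' := by
      rcases hin y hyn L' with h | h
      · exact h.2
      · exact absurd h (by rw [h1 y hyn]; exact lt_irrefl _)
    have h3 := congrFun (h2 z hzn) z
    rw [lower, if_pos ⟨hy, hz, hyz, hlt⟩, Function.update_self] at h3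
    omega
  exact ⟨hL', fun a ha x hj => hj.closed (fun x => L' x ≤ a) (hL'.1 a ha)
    fun p q hp hpq hpY hqY => (hedge p q hpq hpY hqY).trans hp⟩

/-- The label of a vertex that is joined to the base set is the least such vertex. -/
theorem label_mem_reps {E : SimpleGraph ℕ} {n : ℕ} {B Y : Finset ℕ} {L : ℕ → ℕ}
    (hL : Labels E n B Y L) (hB : B ⊆ Finset.range n)
    (hm : ∀ a ∈ B, ∀ x, Joined E Y a x → L x ≤ a) {a x : ℕ} (ha : a ∈ B) (hx : x < n)
    (hj : Joined E Y a x) : L x ∈ reps E B Y ∧ Joined E Y (L x) x := by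
  have hlt : L x < n := (hm a ha x hj).trans_lt (Finset.mem_range.1 (hB ha))
  obtain ⟨h1, h2⟩ := (hL.2 x hx).resolve_left hlt.ne
  exact ⟨mem_reps.2 ⟨h1, fun b hb hbl hbj => absurd (hm b hb x (hbj.trans h2)) (not_le.2 hbl)⟩, h2⟩

/-- The result of the labelling. -/
theorem run_labelC {E : SimpleGraph ℕ} {n ℓ : ℕ} {S : Finset ℕ} {s : Store} (h : Input E n ℓ S s)
    {k : ℕ} (hk : k ≠ aLab) (hk' : k ≠ aRank) (hB : marked n (s.a k) ⊆ marked n (s.a aY)) :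
    ((labelC k).run s).v vComps = comps E (marked n (s.a k)) (marked n (s.a aY)) ∧
    Labels E n (marked n (s.a k)) (marked n (s.a aY)) (((labelC k).run s).a aLab) ∧
    (∀ a ∈ marked n (s.a k), ∀ x, Joined E (marked n (s.a aY)) a x →
      ((labelC k).run s).a aLab x ≤ a) ∧
    ∀ x ∈ reps E (marked n (s.a k)) (marked n (s.a aY)),
      ((labelC k).run s).a aRank x
        = ((reps E (marked n (s.a k)) (marked n (s.a aY))).filter (· < x)).card := by
  classical
  set B := marked n (s.a k) with hBdef
  set Y := marked n (s.a aY) with hYdef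
  have hYn : Y ⊆ Finset.range n := Finset.filter_subset _ _
  set s₁ := (loop vX vN (ite (inE k vX) (aset aLab (var vX) (var vX))
    (aset aLab (var vX) (var vN)))).run s with hs₁
  have ag₁ := run_agree (loop vX vN (ite (inE k vX) (aset aLab (var vX) (var vX))
    (aset aLab (var vX) (var vN)))) s
  rw [← hs₁] at ag₁
  have in₁ : Input E n ℓ S s₁ := h.agree ag₁ rfl
  have hk₁ : s₁.a k = s.a k := ag₁.2 k (by simp [wa, hk])
  have lab₁ : ∀ x < n, s₁.a aLab x = if x ∈ B then x else n := by
    exact loop_inv (p := ite (inE k vX) (aset aLab (var vX) (var vX))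
      (aset aLab (var vX) (var vN))) (i := vX) (b := vN) (s := s) h.hn
      (fun j t => ∀ x < j, t.a aLab x = if x ∈ B then x else n) (by simp)
      (fun j t hj ha hi ih x hx => by
        have hv : t.v vN = n := (ha.1 vN rfl).trans h.hn
        have hka : t.a k = s.a k := ha.2 k (by simp [wa, hk])
        by_cases hxj : x = j
        · subst hxj
          by_cases hx0 : s.a k x = 0 <;>
            simp [run, inE, hi, hka, hx0, hBdef, mem_marked, hj, hv]
        · have := ih x (by omega)
          by_cases hx0 : s.a k j = 0 <;> simp [run, inE, hi, hka, hx0, hxj, this])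
  have L₁ : Labels E n B Y (s₁.a aLab) := by
    refine ⟨fun a ha => ?_, fun x hx => ?_⟩
    · rw [lab₁ a (Finset.mem_range.1 (hYn (hB ha))), if_pos ha]
    · rw [lab₁ x hx]
      split_ifs with hxB
      · exact .inr ⟨hxB, .refl x⟩
      · exact .inl rfl
  set pass := loop vY vN (loop vX vN (whenC (mul (inE aY vY) (mul (inE aY vX) (mul (adjE vY vX)
    (lt (arr aLab (var vY)) (arr aLab (var vX)))))) (aset aLab (var vX) (arr aLab (var vY)))))
    with hpass
  set s₂ := (loop vP vN (loop vQ vN pass)).run s₁ with hs₂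
  have ag₂ := run_agree (loop vP vN (loop vQ vN pass)) s₁
  rw [← hs₂] at ag₂
  have in₂ : Input E n ℓ S s₂ := in₁.agree ag₂ rfl
  have hk₂ : s₂.a k = s.a k := (ag₂.2 k (by simp [hpass, whenC, wa, hk])).trans hk₁
  have lab₂ : s₂.a aLab = rounds n (fun _ => rounds n fun _ => rounds n fun y => rounds n fun z =>
      lower E Y y z) (s₁.a aLab) := by
    have hY₁ : s₁.a aY = s.a aY := ag₁.2 _ rfl
    refine loop_rounds in₁.hn (fun t => t.a aLab) _ (fun _ _ => rfl) fun _ t _ ha _ => ?_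
    have hY := (ha.2 aY rfl).trans hY₁
    have hi := in₁.agree ha rfl
    clear ha
    refine loop_rounds hi.hn (fun t => t.a aLab) _ (fun _ _ => rfl) fun _ t _ ha _ => ?_
    replace hY := (ha.2 aY rfl).trans hY
    replace hi := hi.agree ha rfl
    clear ha
    refine loop_rounds hi.hn (fun t => t.a aLab) _ (fun _ _ => rfl) fun y t hy ha hvy => ?_
    replace hY := (ha.2 aY rfl).trans hY
    replace hi := hi.agree ha rfl
    clear ha
    refine loop_rounds hi.hn (fun t => t.a aLab) _ (fun _ _ => rfl) fun z t hz ha hvz => ?_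
    replace hY := (ha.2 aY rfl).trans hY
    replace hi := hi.agree ha rfl
    replace hvy := (ha.1 vY rfl).trans hvy
    clear ha
    have hadj := hi.adjE (x := vY) (y := vX) (hvy ▸ hy) (hvz ▸ hz)
    rw [hvy, hvz] at hadj
    have hcond : (y ∈ Y ∧ z ∈ Y ∧ E.Adj y z ∧ t.a aLab y < t.a aLab z) ↔
        (mul (inE aY vY) (mul (inE aY vX) (mul (adjE vY vX)
        (lt (arr aLab (var vY)) (arr aLab (var vX)))))).val t ≠ 0 := by
      simp [hYdef, mem_marked, hy, hz, val, inE, hvy, hvz, hY, ← hadj]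
      tauto
    rw [lower, run_whenC]
    simp only [hcond]
    split_ifs <;> simp [run, hvy, hvz]
  obtain ⟨L₂, hmin⟩ := labels_final hYn hB L₁ lab₂
  set s₃ := (set vComps (const 0)).run s₂ with hs₃
  have hrep : ∀ x < n, (x ∈ reps E B Y ↔ s₂.a k x ≠ 0 ∧ s₂.a aLab x = x) := fun x hx => by
    rw [hk₂]
    constructor
    · intro hxr
      have hxB := (mem_reps.1 hxr).1
      obtain ⟨h1, h2⟩ := label_mem_reps L₂ (hB.trans hYn) hmin hxB hx (.refl x)
      exact ⟨(mem_marked.1 hxB).2, reps_injective h1 hxr h2⟩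
    · rintro ⟨hx0, hxl⟩
      have hxB : x ∈ B := mem_marked.2 ⟨hx, hx0⟩
      have := label_mem_reps L₂ (hB.trans hYn) hmin hxB hx (.refl x)
      rw [hxl] at this
      exact this.1
  have hcard : ∀ j, ((reps E B Y).filter (· < j + 1)).card
      = ((reps E B Y).filter (· < j)).card + if j ∈ reps E B Y then 1 else 0 := fun j => by
    have : (reps E B Y).filter (· < j + 1)
        = (reps E B Y).filter (· < j) ∪ (if j ∈ reps E B Y then {j} else ∅) := by
      ext x
      split_ifs with hj <;> simp only [Finset.mem_union, Finset.mem_filter, Finset.mem_singleton,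
        Finset.notMem_empty, Nat.lt_succ_iff_lt_or_eq] <;> grind
    rw [this, Finset.card_union_of_disjoint]
    · split_ifs <;> simp
    · split_ifs <;> simp
  have fin := loop_inv (i := vX) (b := vN) (s := s₃)
    (p := whenC (mul (inE k vX) (eqE (arr aLab (var vX)) (var vX)))
      (seq (aset aRank (var vX) (var vComps)) (set vComps (add (var vComps) (const 1)))))
    (m := n) in₂.hn
    (fun j t => t.v vComps = ((reps E B Y).filter (· < j)).card ∧
      ∀ x ∈ reps E B Y, x < j → t.a aRank x = ((reps E B Y).filter (· < x)).card)
    (by simp [hs₃, run]) (fun j t hj ha hi ih => by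
      have hka : t.a k = s₂.a k := ha.2 k (by simp [whenC, wa, hk'])
      have hla : t.a aLab = s₂.a aLab := ha.2 aLab rfl
      have hcond : j ∈ reps E B Y ↔
          (mul (inE k vX) (eqE (arr aLab (var vX)) (var vX))).val t ≠ 0 := by
        rw [hrep j hj]
        simp [val, val_eqE, inE, hi, hka, hla]
        tauto
      rw [run_whenC]
      by_cases hjr : j ∈ reps E B Y
      · rw [if_pos (hcond.1 hjr), hcard, if_pos hjr]
        refine ⟨by simp [run, ih.1], fun x hx hxj => ?_⟩
        rcases Nat.lt_succ_iff_lt_or_eq.1 hxj with hxj | rfl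
        · simp [run, hi, hxj.ne, ih.2 x hx hxj]
        · simp [run, hi, ih.1]
      · rw [if_neg (fun h => hjr (hcond.2 h)), hcard, if_neg hjr]
        refine ⟨by simp [ih.1], fun x hx hxj => ?_⟩
        rcases Nat.lt_succ_iff_lt_or_eq.1 hxj with hxj | rfl
        · simp [ih.2 x hx hxj]
        · exact absurd hx hjr)
  have hlt : ∀ x ∈ reps E B Y, x < n := fun x hx =>
    Finset.mem_range.1 (hYn (hB (mem_reps.1 hx).1))
  have ag₃ := run_agree (loop vX vN (whenC (mul (inE k vX) (eqE (arr aLab (var vX)) (var vX)))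
      (seq (aset aRank (var vX) (var vComps)) (set vComps (add (var vComps) (const 1)))))) s₃
  have hrun : (labelC k).run s = (loop vX vN (whenC (mul (inE k vX)
      (eqE (arr aLab (var vX)) (var vX))) (seq (aset aRank (var vX) (var vComps))
        (set vComps (add (var vComps) (const 1)))))).run s₃ := rfl
  rw [hrun]
  refine ⟨?_, ?_, ?_, fun x hx => fin.2 x hx (hlt x hx)⟩
  · refine fin.1.trans ?_
    rw [comps, Finset.filter_true_of_mem hlt]
  · rw [ag₃.2 aLab rfl]
    exact L₂
  · rw [ag₃.2 aLab rfl]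
    exact hmin

end ConnVC

/-! ### The search as a program -/

namespace ConnVC

open LoopLang LoopLang.Ex LoopLang.Cmd

variable {E : SimpleGraph ℕ} {n ℓ : ℕ} {S : Finset ℕ}

/-- One of the three variables that hold the vertices treated by a step of the search. -/
def Idx (x : ℕ) : Prop := x = vU ∨ x = vV ∨ x = vW

theorem labelC_wv {k x : ℕ} (h : Idx x) : (labelC k).wv x = false := by
  rcases h with rfl | rfl | rfl <;> rfl

theorem marked_insert₂ {f : ℕ → ℕ} {x y : ℕ} (hx : x < n) (hy : y < n) :
    marked n (Function.update (Function.update f y 1) x 1) = insert x (insert y (marked n f)) := by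
  rw [marked_insert hx, marked_insert hy]

/-- The test counts the components that meet `A` and leaves the marks of `Y` as they were. -/
theorem run_testC {s : Store} (h : Input E n ℓ S s) {a b out : ℕ} (ha : Idx a) (hb : Idx b)
    (ho : out = vC₁ ∨ out = vC₂ ∨ out = vC₃) (han : s.v a < n) (hbn : s.v b < n)
    (haY : s.a aY (s.v a) = 0) (hbY : s.a aY (s.v b) = 0)
    (hA : marked n (s.a aA) ⊆ marked n (s.a aY)) :
    ((testC a b out).run s).v out
      = comps E (marked n (s.a aA)) (insert (s.v a) (insert (s.v b) (marked n (s.a aY)))) ∧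
    ((testC a b out).run s).a aY = s.a aY ∧
    (∀ x, (labelC aA).wv x = false → x ≠ out → ((testC a b out).run s).v x = s.v x) ∧
    ∀ k, (labelC aA).wa k = false → k ≠ aY → ((testC a b out).run s).a k = s.a k := by
  set s₁ := (add₂C a b).run s with hs₁
  have hY₁ : s₁.a aY = Function.update (Function.update (s.a aY) (s.v b) 1) (s.v a) 1 := by
    simp [hs₁, add₂C, run]
  have hv₁ : s₁.v = s.v := rfl
  have ha₁ : ∀ k ≠ aY, s₁.a k = s.a k := fun k hk => by simp [hs₁, add₂C, run, hk]
  have in₁ : Input E n ℓ S s₁ := h.of_eq rfl rfl (ha₁ _ (by decide))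
  have hm₁ : marked n (s₁.a aY) = insert (s.v a) (insert (s.v b) (marked n (s.a aY))) := by
    rw [hY₁, marked_insert₂ han hbn]
  set s₂ := (labelC aA).run s₁ with hs₂
  have ag := run_agree (labelC aA) s₁
  rw [← hs₂] at ag
  have lab := (run_labelC in₁ (k := aA) (by decide) (by decide) (by
    rw [hm₁, ha₁ aA (by decide)]
    exact hA.trans ((Finset.subset_insert _ _).trans (Finset.subset_insert _ _)))).1
  rw [hm₁, ha₁ aA (by decide)] at lab
  have ho' : a ≠ out ∧ b ≠ out := by
    rcases ha with rfl | rfl | rfl <;> rcases hb with rfl | rfl | rfl <;>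
      rcases ho with rfl | rfl | rfl <;> decide
  have hfin : (testC a b out).run s
      = ((s₂.setV out (s₂.v vComps)).setA aY (s.v b) 0).setA aY (s.v a) 0 := by
    have h1 : s₂.v a = s.v a := ag.1 a (labelC_wv ha)
    have h2 : s₂.v b = s.v b := ag.1 b (labelC_wv hb)
    change ((s₂.setV out (s₂.v vComps)).setA aY ((s₂.setV out (s₂.v vComps)).v b) 0).setA aY
      ((s₂.setV out (s₂.v vComps)).v a) 0 = _
    simp only [Store.setV_v, ho'.1, ho'.2, if_false, h1, h2]
  rw [hfin]
  refine ⟨by simpa using lab, ?_, fun x hx hxo => ?_, fun k hk hkY => ?_⟩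
  · have : s₂.a aY = s₁.a aY := ag.2 _ rfl
    funext x
    by_cases hxa : x = s.v a
    · simp [hxa, haY]
    · by_cases hxb : x = s.v b
      · simp [hxb, hbY, Function.update_apply]
      · simp [hxa, hxb, this, hY₁]
  · simpa [hxo] using (ag.1 x hx).trans (congrFun hv₁ x)
  · simpa [hkY] using (ag.2 k hk).trans (ha₁ k hkY)

/-- The aspect of the state on which the search acts. -/
def view (n : ℕ) (s : Store) : Finset ℕ × ℕ := (marked n (s.a aY), s.v vPtr)

/-- The final part of a step of the search, after the three tests. -/
def chooseC (a a' s b b' s' c c' s'' : ℕ) : Cmd :=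
  ite (notE (lt (var vC₁) (var vC₀))) (aset aY (var s) (const 1))
  (ite (notE (lt (var vC₂) (var vC₀))) (aset aY (var s') (const 1))
  (ite (notE (lt (var vC₃) (var vC₀))) (aset aY (var s'') (const 1))
  (seq (set vRead (arr aDig (var vPtr))) (seq (set vPtr (add (var vPtr) (const 1)))
    (ite (eqE (var vRead) (const 0)) (add₂C a a')
      (ite (eqE (var vRead) (const 1)) (add₂C b b') (add₂C c c')))))))

/-- Provided the four counts are the right ones, the final part acts like `branch`. -/
theorem run_chooseC {s s₀ : Store} {Y A : Finset ℕ} {a a' c b b' d e e' f : ℕ}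
    (ha : Idx a) (ha' : Idx a') (hb : Idx b) (hb' : Idx b')
    (he : Idx e) (he' : Idx e') (hc : Idx c) (hd : Idx d) (hf : Idx f)
    (hv : ∀ x, Idx x → s.v x = s₀.v x)
    (hn : s₀.v a < n ∧ s₀.v a' < n ∧ s₀.v b < n ∧ s₀.v b' < n ∧ s₀.v e < n ∧ s₀.v e' < n ∧
      s₀.v c < n ∧ s₀.v d < n ∧ s₀.v f < n)
    (hY : marked n (s.a aY) = Y) (hD : s.a aDig = s₀.a aDig) (hP : s.v vPtr = s₀.v vPtr)
    (h₀ : s.v vC₀ = comps E A Y)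
    (h₁ : s.v vC₁ = comps E A (insert (s₀.v a) (insert (s₀.v a') Y)))
    (h₂ : s.v vC₂ = comps E A (insert (s₀.v b) (insert (s₀.v b') Y)))
    (h₃ : s.v vC₃ = comps E A (insert (s₀.v e) (insert (s₀.v e') Y))) :
    view n ((chooseC a a' c b b' d e e' f).run s)
      = branch E A (s₀.a aDig) (s₀.v a) (s₀.v a') (s₀.v c) (s₀.v b) (s₀.v b')
        (s₀.v d) (s₀.v e) (s₀.v e') (s₀.v f) (Y, s₀.v vPtr) := by
  obtain ⟨na, na', nb, nb', ne, ne', nc, nd, nf⟩ := hn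
  have hi : ∀ x, Idx x → s₀.v x < n → view n ((aset aY (var x) (const 1)).run s)
      = (insert (s₀.v x) Y, s₀.v vPtr) := fun x hx hxn => by
    simp only [view, run, val, hv x hx, Store.setA_v, hP, Store.setA_a, if_true,
      marked_insert hxn, hY]
  have hi₂ : ∀ x y, Idx x → Idx y → s₀.v x < n → s₀.v y < n → view n ((add₂C x y).run
      ((s.setV vRead (s₀.a aDig (s₀.v vPtr))).setV vPtr (s₀.v vPtr + 1)))
      = (insert (s₀.v x) (insert (s₀.v y) Y), s₀.v vPtr + 1) := fun x y hx hy hxn hyn => by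
    have hne : ∀ x, Idx x → x ≠ vRead ∧ x ≠ vPtr := fun x hx => by
      rcases hx with rfl | rfl | rfl <;> decide
    simp [view, add₂C, run, hne x hx, hne y hy, hv x hx, hv y hy, marked_insert hxn,
      marked_insert hyn, hY]
  have e₀ : (seq (set vRead (arr aDig (var vPtr))) (seq (set vPtr (add (var vPtr) (const 1)))
      (ite (eqE (var vRead) (const 0)) (add₂C a a')
      (ite (eqE (var vRead) (const 1)) (add₂C b b') (add₂C e e'))))).run s
      = if s₀.a aDig (s₀.v vPtr) = 0 then (add₂C a a').run
          ((s.setV vRead (s₀.a aDig (s₀.v vPtr))).setV vPtr (s₀.v vPtr + 1))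
        else if s₀.a aDig (s₀.v vPtr) = 1 then (add₂C b b').run
          ((s.setV vRead (s₀.a aDig (s₀.v vPtr))).setV vPtr (s₀.v vPtr + 1))
        else (add₂C e e').run
          ((s.setV vRead (s₀.a aDig (s₀.v vPtr))).setV vPtr (s₀.v vPtr + 1)) := by
    simp [run, val_eqE, hD, hP]
  have e₁ : ∀ (x : ℕ) (p q : Cmd), (ite (notE (lt (var x) (var vC₀))) p q).run s
      = if ¬ s.v x < s.v vC₀ then p.run s else q.run s := fun x p q => by
    by_cases h : s.v x < s.v vC₀ <;> simp [run, notE, h]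
  rw [chooseC, branch, e₁, e₁, e₁, e₀, h₀, h₁, h₂, h₃]
  dsimp only
  split_ifs
  · exact hi₂ a a' ha ha' na na'
  · exact hi₂ b b' hb hb' nb nb'
  · exact hi₂ e e' he he' ne ne'
  · exact hi f hf nf
  · exact hi d hd nd
  · exact hi c hc nc

/-- A step of the program acts like `branch` on the marked set and the number of digits read. -/
theorem run_branchC {s₀ : Store} (h₀ : Input E n ℓ S s₀) {a a' c b b' d e e' f : ℕ}
    (ha : Idx a) (ha' : Idx a') (hc : Idx c) (hb : Idx b) (hb' : Idx b') (hd : Idx d)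
    (he : Idx e) (he' : Idx e') (hf : Idx f)
    (hn : ∀ x, Idx x → (x = a ∨ x = a' ∨ x = b ∨ x = b' ∨ x = e ∨ x = e' ∨ x = c ∨ x = d ∨ x = f) →
      s₀.v x < n ∧ s₀.a aY (s₀.v x) = 0)
    (hA : marked n (s₀.a aA) ⊆ marked n (s₀.a aY)) :
    view n ((branchC a a' c b b' d e e' f).run s₀)
      = branch E (marked n (s₀.a aA)) (s₀.a aDig) (s₀.v a) (s₀.v a') (s₀.v c) (s₀.v b) (s₀.v b')
        (s₀.v d) (s₀.v e) (s₀.v e') (s₀.v f) (view n s₀) := by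
  obtain ⟨hna, hYa⟩ := hn a ha (by simp)
  obtain ⟨hna', hYa'⟩ := hn a' ha' (by simp)
  obtain ⟨hnb, hYb⟩ := hn b hb (by simp)
  obtain ⟨hnb', hYb'⟩ := hn b' hb' (by simp)
  obtain ⟨hne, hYe⟩ := hn e he (by simp)
  obtain ⟨hne', hYe'⟩ := hn e' he' (by simp)
  obtain ⟨hnc, -⟩ := hn c hc (by simp)
  obtain ⟨hnd, -⟩ := hn d hd (by simp)
  obtain ⟨hnf, -⟩ := hn f hf (by simp)
  set s := (set vC₀ (var vComps)).run ((labelC aA).run s₀) with hs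
  have lab := (run_labelC h₀ (k := aA) (by decide) (by decide) hA).1
  have ag := run_agree (seq (labelC aA) (set vC₀ (var vComps))) s₀
  have h : Input E n ℓ S s := h₀.agree ag rfl
  have hv : ∀ x, Idx x → s.v x = s₀.v x := fun x hx =>
    ag.1 x (by rcases hx with rfl | rfl | rfl <;> rfl)
  have hp : s.v vPtr = s₀.v vPtr := ag.1 _ rfl
  have hsY : s.a aY = s₀.a aY := ag.2 _ rfl
  have hsA : s.a aA = s₀.a aA := ag.2 _ rfl
  have hsD : s.a aDig = s₀.a aDig := ag.2 _ rfl
  have hc₀ : s.v vC₀ = comps E (marked n (s₀.a aA)) (marked n (s₀.a aY)) := by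
    simpa [hs, run] using lab
  have hrun : (branchC a a' c b b' d e e' f).run s₀ = (chooseC a a' c b b' d e e' f).run
      ((testC e e' vC₃).run ((testC b b' vC₂).run ((testC a a' vC₁).run s))) := rfl
  clear_value s
  clear lab ag hs
  obtain ⟨s₁, hs₁⟩ : ∃ t, t = (testC a a' vC₁).run s := ⟨_, rfl⟩
  rw [← hs₁] at hrun
  obtain ⟨c₁, y₁, v₁, r₁⟩ := run_testC h ha ha' (.inl rfl) (by rw [hv a ha]; exact hna)
    (by rw [hv a' ha']; exact hna') (by rw [hv a ha, hsY]; exact hYa)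
    (by rw [hv a' ha', hsY]; exact hYa') (by rw [hsA, hsY]; exact hA)
  rw [← hs₁] at c₁ y₁ v₁ r₁
  clear hs₁
  have i₁ : Input E n ℓ S s₁ := h.of_eq (v₁ vN rfl (by decide)) (v₁ vEll rfl (by decide))
    (r₁ aIn rfl (by decide))
  have w₁ : ∀ x, Idx x → s₁.v x = s₀.v x := fun x hx => (v₁ x (labelC_wv hx)
    (by rcases hx with rfl | rfl | rfl <;> decide)).trans (hv x hx)
  have A₁ : s₁.a aA = s₀.a aA := (r₁ aA rfl (by decide)).trans hsA
  have Y₁ : s₁.a aY = s₀.a aY := y₁.trans hsY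
  obtain ⟨s₂, hs₂⟩ : ∃ t, t = (testC b b' vC₂).run s₁ := ⟨_, rfl⟩
  rw [← hs₂] at hrun
  obtain ⟨c₂, y₂, v₂, r₂⟩ := run_testC i₁ hb hb' (.inr (.inl rfl)) (by rw [w₁ b hb]; exact hnb)
    (by rw [w₁ b' hb']; exact hnb') (by rw [w₁ b hb, Y₁]; exact hYb)
    (by rw [w₁ b' hb', Y₁]; exact hYb') (by rw [A₁, Y₁]; exact hA)
  rw [← hs₂] at c₂ y₂ v₂ r₂
  clear hs₂
  have i₂ : Input E n ℓ S s₂ := i₁.of_eq (v₂ vN rfl (by decide)) (v₂ vEll rfl (by decide))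
    (r₂ aIn rfl (by decide))
  have w₂ : ∀ x, Idx x → s₂.v x = s₀.v x := fun x hx => (v₂ x (labelC_wv hx)
    (by rcases hx with rfl | rfl | rfl <;> decide)).trans (w₁ x hx)
  have A₂ : s₂.a aA = s₀.a aA := (r₂ aA rfl (by decide)).trans A₁
  have Y₂ : s₂.a aY = s₀.a aY := y₂.trans Y₁
  obtain ⟨s₃, hs₃⟩ : ∃ t, t = (testC e e' vC₃).run s₂ := ⟨_, rfl⟩
  rw [← hs₃] at hrun
  obtain ⟨c₃, y₃, v₃, r₃⟩ := run_testC i₂ he he' (.inr (.inr rfl)) (by rw [w₂ e he]; exact hne)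
    (by rw [w₂ e' he']; exact hne') (by rw [w₂ e he, Y₂]; exact hYe)
    (by rw [w₂ e' he', Y₂]; exact hYe') (by rw [A₂, Y₂]; exact hA)
  rw [← hs₃] at c₃ y₃ v₃ r₃
  clear hs₃
  have w₃ : ∀ x, Idx x → s₃.v x = s₀.v x := fun x hx => (v₃ x (labelC_wv hx)
    (by rcases hx with rfl | rfl | rfl <;> decide)).trans (w₂ x hx)
  have Y₃ : s₃.a aY = s₀.a aY := y₃.trans Y₂
  have D₃ : s₃.a aDig = s₀.a aDig :=
    (r₃ aDig rfl (by decide)).trans ((r₂ aDig rfl (by decide)).trans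
      ((r₁ aDig rfl (by decide)).trans hsD))
  have P₃ : s₃.v vPtr = s₀.v vPtr :=
    (v₃ vPtr rfl (by decide)).trans ((v₂ vPtr rfl (by decide)).trans
      ((v₁ vPtr rfl (by decide)).trans hp))
  have C₀ : s₃.v vC₀ = comps E (marked n (s₀.a aA)) (marked n (s₀.a aY)) :=
    (v₃ vC₀ rfl (by decide)).trans ((v₂ vC₀ rfl (by decide)).trans
      ((v₁ vC₀ rfl (by decide)).trans hc₀))
  have C₁ : s₃.v vC₁ = comps E (marked n (s₀.a aA))
      (insert (s₀.v a) (insert (s₀.v a') (marked n (s₀.a aY)))) := by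
    rw [v₃ vC₁ rfl (by decide), v₂ vC₁ rfl (by decide), c₁, hsA, hsY, hv a ha, hv a' ha']
  have C₂ : s₃.v vC₂ = comps E (marked n (s₀.a aA))
      (insert (s₀.v b) (insert (s₀.v b') (marked n (s₀.a aY)))) := by
    rw [v₃ vC₂ rfl (by decide), c₂, A₁, Y₁, w₁ b hb, w₁ b' hb']
  have C₃ : s₃.v vC₃ = comps E (marked n (s₀.a aA))
      (insert (s₀.v e) (insert (s₀.v e') (marked n (s₀.a aY)))) := by
    rw [c₃, A₂, Y₂, w₂ e he, w₂ e' he']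
  clear c₁ y₁ v₁ r₁ c₂ y₂ v₂ r₂ c₃ y₃ v₃ r₃ i₁ i₂ w₁ w₂ A₁ Y₁ A₂ Y₂ h hv hp hsY hsA hsD hc₀
  rw [hrun]
  exact run_chooseC (s := s₃) (Y := marked n (s₀.a aY)) ha ha' hb hb' he he' hc hd hf w₃
    ⟨hna, hna', hnb, hnb', hne, hne', hnc, hnd, hnf⟩ (by rw [Y₃]) D₃ P₃ C₀ C₁ C₂ C₃

theorem val_pos (s : Store) (a : Ex) : (lt (const 0) a).val s ≠ 0 ↔ a.val s ≠ 0 := by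
  simp [val, pos_iff_ne_zero]

theorem val_add_ne (s : Store) (a b : Ex) :
    (add a b).val s ≠ 0 ↔ a.val s ≠ 0 ∨ b.val s ≠ 0 := by
  simp only [val]
  omega

theorem val_mul_ne (s : Store) (a b : Ex) :
    (mul a b).val s ≠ 0 ↔ a.val s ≠ 0 ∧ b.val s ≠ 0 := by
  simp [val]

/-- Loops whose body acts on some aspect `g` of the state like the function `f`, as long as that
aspect has the property `P`. -/
theorem loop_rounds_inv {α : Type*} {p : Cmd} {i b m : ℕ} {s : Store} (hm : s.v b = m)
    (g : Store → α) (f : ℕ → α → α) (P : α → Prop) (hP : P (g s)) (hf : ∀ j x, P x → P (f j x))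
    (hg : ∀ t m, g (t.setV i m) = g t)
    (hs : ∀ j t, j < m → (loop i b p).Agree s t → t.v i = j → P (g t) →
      g (p.run t) = f j (g t)) :
    g ((loop i b p).run s) = rounds m f (g s) :=
  (loop_inv hm (fun j t => g t = rounds j f (g s) ∧ P (g t)) (by rw [hg]; exact ⟨rfl, hP⟩)
    fun j t hj ha hi h => by
      have := hs j t hj ha hi h.2
      rw [hg, this]
      exact ⟨by rw [h.1, rounds], hf _ _ h.2⟩).1

theorem subset_branch {A Y : Finset ℕ} {dig : ℕ → ℕ} {a a' c b b' d e e' f : ℕ} {p : Finset ℕ × ℕ}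
    (h : Y ⊆ p.1) : Y ⊆ (branch E A dig a a' c b b' d e e' f p).1 := by
  unfold branch
  split_ifs <;> intro x hx <;> simp [h hx]

theorem subset_tripleStep {T A Y : Finset ℕ} {dig : ℕ → ℕ} {u v w : ℕ} {p : Finset ℕ × ℕ}
    (h : Y ⊆ p.1) : Y ⊆ (tripleStep E T A dig u v w p).1 := by
  unfold tripleStep
  split_ifs
  exacts [subset_branch h, h]

theorem subset_pairStep {T A Y : Finset ℕ} {dig : ℕ → ℕ} {u w : ℕ} {p : Finset ℕ × ℕ}
    (h : Y ⊆ p.1) : Y ⊆ (pairStep E T A dig u w p).1 := by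
  unfold pairStep
  split_ifs
  exacts [subset_branch h, h]

theorem subset_triplePass {T A Y : Finset ℕ} {dig : ℕ → ℕ} {p : Finset ℕ × ℕ}
    (h : Y ⊆ p.1) : Y ⊆ (triplePass E n T A dig p).1 :=
  rounds_inv (fun p : Finset ℕ × ℕ => Y ⊆ p.1) (fun _ _ _ h =>
    rounds_inv (fun p : Finset ℕ × ℕ => Y ⊆ p.1) (fun _ _ _ h =>
      rounds_inv (fun p : Finset ℕ × ℕ => Y ⊆ p.1) (fun _ _ _ h => subset_tripleStep h) h) h) h

theorem subset_pairPass {T A Y : Finset ℕ} {dig : ℕ → ℕ} {p : Finset ℕ × ℕ}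
    (h : Y ⊆ p.1) : Y ⊆ (pairPass E n T A dig p).1 :=
  rounds_inv (fun p : Finset ℕ × ℕ => Y ⊆ p.1) (fun _ _ _ h =>
    rounds_inv (fun p : Finset ℕ × ℕ => Y ⊆ p.1) (fun _ _ _ h => subset_pairStep h) h) h

theorem openE_iff {s : Store} {x : ℕ} (hx : s.v x < n) : (openE x).val s ≠ 0 ↔
    s.v x ∉ marked n (s.a aT) ∧ s.v x ∉ marked n (s.a aY) := by
  simp only [openE, val, mul_ne_zero_iff, val_notE, inE, mem_marked, hx, true_and, not_not]

theorem run_triplesC {s : Store} (h : Input E n ℓ S s)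
    (hA : marked n (s.a aA) ⊆ marked n (s.a aY)) :
    view n (triplesC.run s)
      = triplePass E n (marked n (s.a aT)) (marked n (s.a aA)) (s.a aDig) (view n s) := by
  classical
  have P : ∀ {i : ℕ}, i ≠ vPtr → ∀ (t : Store) (m : ℕ), view n (t.setV i m) = view n t :=
    fun hi t m => by simp [view, hi.symm]
  refine loop_rounds_inv h.hn (view n) _ (fun p => marked n (s.a aA) ⊆ p.1) hA
    (fun _ _ hp => rounds_inv (fun p : Finset ℕ × ℕ => marked n (s.a aA) ⊆ p.1) (fun _ _ _ hp =>
      rounds_inv (fun p : Finset ℕ × ℕ => marked n (s.a aA) ⊆ p.1)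
        (fun _ _ _ hp => subset_tripleStep hp) hp) hp) (P (by decide)) fun u t hu ha hvu hp => ?_
  have hT : t.a aT = s.a aT := ha.2 aT rfl
  have hAA : t.a aA = s.a aA := ha.2 aA rfl
  have hD : t.a aDig = s.a aDig := ha.2 aDig rfl
  have hi := h.agree ha rfl
  clear ha
  refine loop_rounds_inv hi.hn (view n) _ (fun p => marked n (s.a aA) ⊆ p.1) hp
    (fun _ _ hp => rounds_inv (fun p : Finset ℕ × ℕ => marked n (s.a aA) ⊆ p.1)
        (fun _ _ _ hp => subset_tripleStep hp) hp) (P (by decide)) fun v t' hv ha hvv hp => ?_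
  replace hT : t'.a aT = s.a aT := (ha.2 aT rfl).trans hT
  replace hAA : t'.a aA = s.a aA := (ha.2 aA rfl).trans hAA
  replace hD : t'.a aDig = s.a aDig := (ha.2 aDig rfl).trans hD
  replace hvu : t'.v vU = u := (ha.1 vU rfl).trans hvu
  replace hi := hi.agree ha rfl
  clear ha
  refine loop_rounds_inv hi.hn (view n) _ (fun p => marked n (s.a aA) ⊆ p.1) hp
    (fun _ _ hp => subset_tripleStep hp) (P (by decide)) fun w t'' hw ha hvw hp => ?_
  replace hT : t''.a aT = s.a aT := (ha.2 aT rfl).trans hT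
  replace hAA : t''.a aA = s.a aA := (ha.2 aA rfl).trans hAA
  replace hD : t''.a aDig = s.a aDig := (ha.2 aDig rfl).trans hD
  replace hvu : t''.v vU = u := (ha.1 vU rfl).trans hvu
  replace hvv : t''.v vV = v := (ha.1 vV rfl).trans hvv
  replace hi := hi.agree ha rfl
  clear ha
  have hcond : Triple E (marked n (s.a aT)) (view n t'').1 u v w ↔
      (mul (mul (openE vU) (mul (openE vV) (openE vW)))
        (mul (adjE vU vV) (mul (adjE vU vW) (adjE vV vW)))).val t'' ≠ 0 := by
    simp only [val, mul_ne_zero_iff]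
    rw [openE_iff (hvu ▸ hu), openE_iff (hvv ▸ hv), openE_iff (hvw ▸ hw),
      hi.adjE (hvu ▸ hu) (hvv ▸ hv), hi.adjE (hvu ▸ hu) (hvw ▸ hw), hi.adjE (hvv ▸ hv) (hvw ▸ hw),
      hvu, hvv, hvw, hT, Triple]
    simp only [view]
    tauto
  have hcase : ∀ x, Idx x → t''.v x < n := by
    rintro x (rfl | rfl | rfl)
    exacts [hvu ▸ hu, hvv ▸ hv, hvw ▸ hw]
  rw [run_whenC, tripleStep]
  by_cases hc : Triple E (marked n (s.a aT)) (view n t'').1 u v w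
  · rw [if_pos hc, if_pos (hcond.1 hc)]
    have hz : ∀ x, Idx x → t''.a aY (t''.v x) = 0 := by
      rintro x (rfl | rfl | rfl) <;> by_contra hne
      · exact hc.2.1.1 (mem_marked.2 ⟨hu, hvu ▸ hne⟩)
      · exact hc.2.1.2.1 (mem_marked.2 ⟨hv, hvv ▸ hne⟩)
      · exact hc.2.1.2.2 (mem_marked.2 ⟨hw, hvw ▸ hne⟩)
    have := run_branchC hi (a := vU) (a' := vV) (c := vW) (b := vU) (b' := vW) (d := vV) (e := vV)
      (e' := vW) (f := vU) (.inl rfl) (.inr (.inl rfl)) (.inr (.inr rfl)) (.inl rfl)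
      (.inr (.inr rfl)) (.inr (.inl rfl)) (.inr (.inl rfl)) (.inr (.inr rfl)) (.inl rfl)
      (fun x hx _ => ⟨hcase x hx, hz x hx⟩) (by rw [hAA]; exact hp)
    rw [this, hvu, hvv, hvw, hAA, hD]
  · rw [if_neg hc, if_neg (fun h' => hc (hcond.2 h'))]

theorem run_pairsC {s : Store} (h : Input E n ℓ S s)
    (hA : marked n (s.a aA) ⊆ marked n (s.a aY)) :
    view n (pairsC.run s)
      = pairPass E n (marked n (s.a aT)) (marked n (s.a aA)) (s.a aDig) (view n s) := by
  classical
  have P : ∀ {i : ℕ}, i ≠ vPtr → ∀ (t : Store) (m : ℕ), view n (t.setV i m) = view n t :=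
    fun hi t m => by simp [view, hi.symm]
  refine loop_rounds_inv h.hn (view n) _ (fun p => marked n (s.a aA) ⊆ p.1) hA
    (fun _ _ hp => rounds_inv (fun p : Finset ℕ × ℕ => marked n (s.a aA) ⊆ p.1)
        (fun _ _ _ hp => subset_pairStep hp) hp) (P (by decide)) fun u t' hu ha hvu hp => ?_
  have hT : t'.a aT = s.a aT := ha.2 aT rfl
  have hAA : t'.a aA = s.a aA := ha.2 aA rfl
  have hD : t'.a aDig = s.a aDig := ha.2 aDig rfl
  have hi := h.agree ha rfl
  clear ha
  refine loop_rounds_inv hi.hn (view n) _ (fun p => marked n (s.a aA) ⊆ p.1) hp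
    (fun _ _ hp => subset_pairStep hp) (P (by decide)) fun w t'' hw ha hvw hp => ?_
  replace hT : t''.a aT = s.a aT := (ha.2 aT rfl).trans hT
  replace hAA : t''.a aA = s.a aA := (ha.2 aA rfl).trans hAA
  replace hD : t''.a aDig = s.a aDig := (ha.2 aDig rfl).trans hD
  replace hvu : t''.v vU = u := (ha.1 vU rfl).trans hvu
  replace hi := hi.agree ha rfl
  clear ha
  have hcond : Pair E (marked n (s.a aT)) (view n t'').1 u w ↔
      (mul (mul (openE vU) (openE vW)) (adjE vU vW)).val t'' ≠ 0 := by
    simp only [val, mul_ne_zero_iff]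
    rw [openE_iff (hvu ▸ hu), openE_iff (hvw ▸ hw), hi.adjE (hvu ▸ hu) (hvw ▸ hw),
      hvu, hvw, hT, Pair]
    simp only [view]
    tauto
  rw [run_whenC, pairStep]
  by_cases hc : Pair E (marked n (s.a aT)) (view n t'').1 u w
  · rw [if_pos hc, if_pos (hcond.1 hc)]
    have hz : ∀ x, (x = vU ∨ x = vW) → t''.v x < n ∧ t''.a aY (t''.v x) = 0 := by
      rintro x (rfl | rfl)
      · refine ⟨hvu ▸ hu, ?_⟩
        by_contra hne
        exact hc.2.1.1 (mem_marked.2 ⟨hu, hvu ▸ hne⟩)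
      · refine ⟨hvw ▸ hw, ?_⟩
        by_contra hne
        exact hc.2.1.2 (mem_marked.2 ⟨hw, hvw ▸ hne⟩)
    have := run_branchC hi (a := vU) (a' := vU) (c := vW) (b := vW) (b' := vW) (d := vU) (e := vW)
      (e' := vW) (f := vU) (.inl rfl) (.inl rfl) (.inr (.inr rfl)) (.inr (.inr rfl))
      (.inr (.inr rfl)) (.inl rfl) (.inr (.inr rfl)) (.inr (.inr rfl)) (.inl rfl)
      (fun x _ hx' => hz x (by tauto)) (by rw [hAA]; exact hp)
    rw [this, hvu, hvw, hAA, hD]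
  · rw [if_neg hc, if_neg (fun h' => hc (hcond.2 h'))]

/-! ### The initial set of the search -/

theorem run_startC {s : Store} (h : Input E n ℓ S s) (hE : ∀ x y, E.Adj x y → x < n) :
    marked n ((startC.run s).a aY) = marked n (s.a aA) ∪
      forced E n (marked n (s.a aT)) (marked n (s.a aA)) := by
  classical
  set T := marked n (s.a aT) with hTdef
  set A := marked n (s.a aA) with hAdef
  set q := whenC (adjE vU vV) (ite (inE aT vV) (whenC (notE (inE aA vV)) (set vF₁ (const 1)))
        (seq (set vF₂ (const 1))
          (loop vW vN (whenC (mul (inE aA vW) (adjE vV vW)) (set vF₃ (const 1)))))) with hq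
  have key : ∀ x < n, ((startC.run s).a aY x ≠ 0 ↔ x ∈ A ∪ forced E n T A) := by
    refine loop_inv (i := vU) (b := vN) (s := s) h.hn
      (fun j t => ∀ x < j, (t.a aY x ≠ 0 ↔ x ∈ A ∪ forced E n T A)) (by simp)
      fun u t hu ha hvu ih => ?_
    have hi := h.agree ha rfl
    have hT : t.a aT = s.a aT := ha.2 aT rfl
    have hA : t.a aA = s.a aA := ha.2 aA rfl
    clear ha
    set t₁ := ((t.setV vF₁ 0).setV vF₂ 0).setV vF₃ 0 with ht₁
    have hi₁ : Input E n ℓ S t₁ := hi.of_eq rfl rfl rfl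
    have agq := run_agree (loop vV vN q) t₁
    -- the flags stand for neighbours in `T` outside `A`, neighbours outside `T`, and neighbours
    -- outside `T` that have a neighbour in `A`
    have hflags := loop_inv (p := q) (i := vV) (b := vN) (s := t₁) hi₁.hn
      (fun j t' => (t'.v vF₁ ≠ 0 ↔ ∃ o < j, E.Adj u o ∧ o ∈ T ∧ o ∉ A) ∧
        (t'.v vF₂ ≠ 0 ↔ ∃ x < j, E.Adj u x ∧ x ∉ T) ∧
        (t'.v vF₃ ≠ 0 ↔ ∃ x < j, E.Adj u x ∧ x ∉ T ∧ ∃ a < n, a ∈ A ∧ E.Adj x a))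
      (by simp [ht₁]) fun v t' hv ha hvv ih' => by
        have hi' := hi₁.agree ha rfl
        have hT' : t'.a aT = s.a aT := (ha.2 aT rfl).trans hT
        have hA' : t'.a aA = s.a aA := (ha.2 aA rfl).trans hA
        have hvu' : t'.v vU = u := (ha.1 vU rfl).trans hvu
        clear ha
        have hadj := hi'.adjE (x := vU) (y := vV) (hvu' ▸ hu) (hvv ▸ hv)
        rw [hvu', hvv] at hadj
        have hinT : v ∈ T ↔ (inE aT vV).val t' ≠ 0 := by
          simp [hTdef, mem_marked, hv, inE, hvv, hT']
        have hinA : v ∈ A ↔ (inE aA vV).val t' ≠ 0 := by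
          simp [hAdef, mem_marked, hv, inE, hvv, hA']
        simp only [Nat.exists_lt_succ_right, Store.setV_v]
        simp only [show (vF₁ = vV) = False by simp, show (vF₂ = vV) = False by simp,
          show (vF₃ = vV) = False by simp, if_false]
        rw [hq, run_whenC]
        by_cases huv : E.Adj u v
        · rw [if_pos (hadj.2 huv)]
          simp only [huv, true_and]
          by_cases hvT : v ∈ T
          · simp only [hvT, true_and, not_true_eq_false, false_and, or_false]
            rw [run, if_pos (hinT.1 hvT), run_whenC]
            by_cases hvA : v ∈ A
            · rw [if_neg (by rw [val_notE]; exact hinA.1 hvA)]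
              simpa [hvA] using ih'
            · rw [if_pos (by rw [val_notE]; by_contra h'; exact hvA (hinA.2 h'))]
              simpa [run, hvA] using ih'.2
          · rw [run, if_neg (fun h' => hvT (hinT.2 h'))]
            simp only [hvT, false_and, or_false, not_false_eq_true, true_and, or_true, iff_true]
            have ag := run_agree (loop vW vN (whenC (mul (inE aA vW) (adjE vV vW))
              (set vF₃ (const 1)))) (t'.setV vF₂ 1)
            have hw := loop_inv (p := whenC (mul (inE aA vW) (adjE vV vW)) (set vF₃ (const 1)))
              (i := vW) (b := vN) (s := t'.setV vF₂ 1) (m := n) hi'.hn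
              (fun j t'' => (t''.v vF₃ ≠ 0 ↔ t'.v vF₃ ≠ 0 ∨ ∃ a < j, a ∈ A ∧ E.Adj v a))
              (by simp) fun w t'' hw ha hvw ih'' => by
                have hi'' : Input E n ℓ S t'' :=
                  (hi'.of_eq (t := t'.setV vF₂ 1) rfl rfl rfl).agree ha rfl
                have hA'' : t''.a aA = s.a aA := (ha.2 aA rfl).trans hA'
                have hvv' : t''.v vV = v := (ha.1 vV rfl).trans hvv
                have hadj := hi''.adjE (x := vV) (y := vW) (hvv' ▸ hv) (hvw ▸ hw)
                rw [hvv', hvw] at hadj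
                have hc : (mul (inE aA vW) (adjE vV vW)).val t'' ≠ 0 ↔ w ∈ A ∧ E.Adj v w := by
                  rw [← hadj]
                  simp [hAdef, mem_marked, hw, inE, hvw, hA'']
                rw [run_whenC, Nat.exists_lt_succ_right]
                by_cases hwA : w ∈ A ∧ E.Adj v w
                · rw [if_pos (hc.2 hwA)]
                  simp [run, hwA]
                · rw [if_neg (fun h' => hwA (hc.1 h'))]
                  simpa [hwA] using ih''
            change (((loop vW vN (whenC (mul (inE aA vW) (adjE vV vW))
              (set vF₃ (const 1)))).run (t'.setV vF₂ 1)).v vF₁ ≠ 0 ↔ _) ∧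
              ((loop vW vN (whenC (mul (inE aA vW) (adjE vV vW))
              (set vF₃ (const 1)))).run (t'.setV vF₂ 1)).v vF₂ ≠ 0 ∧
              (((loop vW vN (whenC (mul (inE aA vW) (adjE vV vW))
              (set vF₃ (const 1)))).run (t'.setV vF₂ 1)).v vF₃ ≠ 0 ↔ _)
            refine ⟨?_, ?_, hw.trans (or_congr_left ih'.2.2)⟩
            · rw [ag.1 vF₁ rfl]
              exact ih'.1
            · rw [ag.1 vF₂ rfl]
              simp
        · rw [if_neg (fun h' => huv (hadj.1 h'))]
          simpa [huv] using ih'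
    obtain ⟨f₁, f₂, f₃⟩ := hflags
    set t₂ := (loop vV vN q).run t₁ with ht₂
    have hvu₂ : t₂.v vU = u := (agq.1 vU rfl).trans hvu
    have hT₂ : t₂.a aT = s.a aT := (agq.2 aT rfl).trans hT
    have hA₂ : t₂.a aA = s.a aA := (agq.2 aA rfl).trans hA
    have hY₂ : t₂.a aY = t.a aY := agq.2 aY rfl
    change ∀ x < u + 1, (((aset aY (var vU) (lt (const 0) (add (inE aA vU) (mul (notE (inE aT vU))
        (add (var vF₁) (mul (var vF₂) (notE (var vF₃)))))))).run t₂).setV vU (u + 1)).a aY x ≠ 0 ↔ _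
    clear_value t₂
    intro x hx
    rcases Nat.lt_succ_iff_lt_or_eq.1 hx with hx | rfl
    · rw [← ih x hx]
      simp [run, hvu₂, hx.ne, hY₂]
    · have e₁ : (x ∈ A ↔ t₂.a aA x ≠ 0) := by rw [hA₂, hAdef, mem_marked]; simp [hu]
      have e₂ : (x ∈ T ↔ t₂.a aT x ≠ 0) := by rw [hT₂, hTdef, mem_marked]; simp [hu]
      have e₃ : x ∈ forced E n T A ↔ x ∉ T ∧ (t₂.v vF₁ ≠ 0 ∨ t₂.v vF₂ ≠ 0 ∧ t₂.v vF₃ = 0) := by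
        have g : ∀ a b, E.Adj a b → b < n := fun a b hab => hE b a hab.symm
        have f₃' : t₂.v vF₃ = 0 ↔ ¬ ∃ y, y ∉ T ∧ E.Adj x y ∧ ∃ a ∈ A, E.Adj y a := by
          rw [← not_iff_not, ← ne_eq, f₃, not_not]
          exact ⟨fun ⟨y, _, h1, h2, a, _, h3, h4⟩ => ⟨y, h2, h1, a, h3, h4⟩,
            fun ⟨y, h2, h1, a, h3, h4⟩ => ⟨y, g _ _ h1, h1, h2, a, g _ _ h4, h3, h4⟩⟩
        have f₁' : t₂.v vF₁ ≠ 0 ↔ ∃ o ∈ T, o ∉ A ∧ E.Adj x o :=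
          f₁.trans ⟨fun ⟨y, _, h1, h2, h3⟩ => ⟨y, h2, h3, h1⟩,
            fun ⟨y, h2, h3, h1⟩ => ⟨y, g _ _ h1, h1, h2, h3⟩⟩
        have f₂' : t₂.v vF₂ ≠ 0 ↔ ∃ y, y ∉ T ∧ E.Adj x y :=
          f₂.trans ⟨fun ⟨y, _, h1, h2⟩ => ⟨y, h2, h1⟩, fun ⟨y, h2, h1⟩ => ⟨y, g _ _ h1, h1, h2⟩⟩
        rw [f₁', f₂', f₃', forced, Finset.mem_filter, Finset.mem_range]
        exact ⟨fun h' => h'.2, fun h' => ⟨hu, h'⟩⟩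
      rw [Finset.mem_union, e₃, e₁, e₂]
      have hval : ((lt (const 0) (add (inE aA vU) (mul (notE (inE aT vU))
          (add (var vF₁) (mul (var vF₂) (notE (var vF₃))))))).val t₂ ≠ 0) ↔
          (t₂.a aA x ≠ 0 ∨ ¬ t₂.a aT x ≠ 0 ∧ (t₂.v vF₁ ≠ 0 ∨ t₂.v vF₂ ≠ 0 ∧ t₂.v vF₃ = 0)) := by
        rw [val_pos, val_add_ne, val_mul_ne, val_add_ne, val_mul_ne, val_notE, val_notE]
        simp only [inE, val, hvu₂, not_not]
      rw [← hval]
      simp only [run, Store.setV_a, Store.setA_a, if_true]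
      rw [show (var vU).val t₂ = x from hvu₂, Function.update_self]
  ext x
  constructor
  · intro hx
    exact (key x (mem_marked.1 hx).1).1 (mem_marked.1 hx).2
  · intro hx
    have hxn : x < n := by
      rcases Finset.mem_union.1 hx with h' | h'
      · exact (mem_marked.1 h').1
      · exact Finset.mem_range.1 (Finset.mem_filter.1 h').1
    exact mem_marked.2 ⟨hxn, (key x hxn).2 hx⟩

end ConnVC

/-! ### Codes -/

namespace ConnVC

open LoopLang LoopLang.Ex LoopLang.Cmd

variable {E : SimpleGraph ℕ} {n ℓ : ℕ} {S : Finset ℕ}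

/-- The digit of the vertex `v` in the code `c`: the elements of `S` are numbered in increasing
order, and the code is read in base `4`, lowest digit first. -/
def digit (S : Finset ℕ) (c v : ℕ) : ℕ := c / 4 ^ Nat.count (· ∈ S) v % 4

/-- The vertices of `S` that belong to the cover according to the code `c`. The digit `3` excludes a
vertex; the other digits include it and serve, in this order, as digits for the search. -/
abbrev Chosen (S : Finset ℕ) (c v : ℕ) : Prop := v ∈ S ∧ digit S c v < 3

/-- The number of trailing zeros among the digits below `3` of the vertices below a bound. -/
def zeros (S : Finset ℕ) (c : ℕ) : ℕ → ℕ
  | 0 => 0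
  | v + 1 => if Chosen S c v then if digit S c v = 0 then zeros S c v + 1 else 0 else zeros S c v

theorem zeros_succ_of_mem {S : Finset ℕ} {c v : ℕ} (h : v ∈ S) : zeros S c (v + 1) =
    if digit S c v < 3 then if digit S c v = 0 then zeros S c v + 1 else 0 else zeros S c v := by
  rw [zeros]
  exact if_congr (and_iff_right h) rfl rfl

theorem zeros_succ_of_notMem {S : Finset ℕ} {c v : ℕ} (h : v ∉ S) :
    zeros S c (v + 1) = zeros S c v :=
  if_neg fun h' => h h'.1

theorem zeros_le (S : Finset ℕ) (c v : ℕ) : zeros S c v ≤ Nat.count (· ∈ S) v := by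
  induction v with
  | zero => simp [zeros]
  | succ v ih =>
    rw [Nat.count_succ]
    by_cases h : v ∈ S
    · rw [zeros_succ_of_mem h, if_pos h]
      split_ifs <;> omega
    · rw [zeros_succ_of_notMem h, if_neg h]
      exact ih

/-- If the digits below `3` spell `δ` followed by zeros, all but `δ.length` of them are trailing
zeros. -/
theorem count_le_zeros {S : Finset ℕ} {c : ℕ} {δ : List ℕ} {v : ℕ}
    (h : ∀ w < v, Chosen S c w → digit S c w = δ.getD (Nat.count (Chosen S c) w) 0) :
    Nat.count (Chosen S c) v ≤ zeros S c v + δ.length := by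
  induction v with
  | zero => simp
  | succ v ih =>
    have ih := ih fun w hw => h w (by omega)
    rw [zeros, Nat.count_succ]
    by_cases hc : Chosen S c v
    · rw [if_pos hc, if_pos hc]
      split_ifs with h0
      · omega
      · have hlt : Nat.count (Chosen S c) v < δ.length := by
          by_contra hge
          rw [h v (by omega) hc, List.getD_eq_default _ _ (by omega)] at h0
          exact h0 rfl
        omega
    · rw [if_neg hc, if_neg hc]
      exact ih

theorem digit_add {S : Finset ℕ} {c q v k : ℕ} (h : Nat.count (· ∈ S) v < k) :
    digit S (c + 4 ^ k * q) v = digit S c v := by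
  obtain ⟨m, rfl⟩ := Nat.exists_eq_add_of_lt h
  rw [digit, digit, show c + 4 ^ (Nat.count (· ∈ S) v + m + 1) * q
    = c + 4 ^ Nat.count (· ∈ S) v * (4 * (4 ^ m * q)) by ring,
    Nat.add_mul_div_left _ _ (by positivity), Nat.add_mul_mod_self_left]

theorem count_lt_of_mem {p : ℕ → Prop} [DecidablePred p] {v n : ℕ} (hv : v < n) (h : p v) :
    Nat.count p v < Nat.count p n := Nat.count_strict_mono h hv

/-- Higher digits do not influence the number of zeros below them. -/
theorem zeros_add {S : Finset ℕ} {c q n : ℕ} {v : ℕ} (hv : v ≤ n) :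
    zeros S (c + 4 ^ Nat.count (· ∈ S) n * q) v = zeros S c v := by
  induction v with
  | zero => rfl
  | succ v ih =>
    by_cases h : v ∈ S
    · rw [zeros_succ_of_mem h, zeros_succ_of_mem h,
        digit_add (count_lt_of_mem (p := (· ∈ S)) hv h), ih (by omega)]
    · rw [zeros_succ_of_notMem h, zeros_succ_of_notMem h, ih (by omega)]

/-- Every assignment of digits to the elements of `S` comes from a code. -/
theorem exists_code (S : Finset ℕ) (g : ℕ → ℕ) (hg : ∀ v, g v < 4) (n : ℕ) :
    ∃ c < 4 ^ Nat.count (· ∈ S) n, ∀ v < n, v ∈ S → digit S c v = g v := by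
  induction n with
  | zero => exact ⟨0, by simp, by simp⟩
  | succ n ih =>
    obtain ⟨c, hc, h⟩ := ih
    by_cases hn : n ∈ S
    · refine ⟨c + 4 ^ Nat.count (· ∈ S) n * g n, ?_, fun v hv hvS => ?_⟩
      · rw [Nat.count_succ, if_pos hn, pow_succ]
        have := hg n
        nlinarith [Nat.mul_le_mul_left (4 ^ Nat.count (· ∈ S) n) (show g n ≤ 3 by omega)]
      · rcases Nat.lt_succ_iff_lt_or_eq.1 hv with hv | rfl
        · rw [digit_add (count_lt_of_mem (p := (· ∈ S)) hv hvS), h v hv hvS]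
        · rw [digit, Nat.add_mul_div_left _ _ (by positivity), Nat.div_eq_of_lt hc, zero_add,
            Nat.mod_eq_of_lt (hg v)]
    · refine ⟨c, by simpa [Nat.count_succ, hn] using hc, fun v hv hvS => ?_⟩
      rcases Nat.lt_succ_iff_lt_or_eq.1 hv with hv | rfl
      exacts [h v hv hvS, absurd hvS hn]

/-- The reason for the running time: a code with `z` trailing zeros may take time `2 ^ z`, but such
codes are rare. A further digit `0` doubles `2 ^ z`, the digits `1` and `2` reset it to one, and the
digit `3` keeps it, so each summand `x` gives rise to `3 * x + 2`. -/
theorem sum_two_pow_zeros (S : Finset ℕ) (n : ℕ) :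
    ∑ c ∈ Finset.range (4 ^ Nat.count (· ∈ S) n), 2 ^ zeros S c n + 3 ^ Nat.count (· ∈ S) n
      ≤ 2 * 4 ^ Nat.count (· ∈ S) n := by
  induction n with
  | zero => simp [zeros]
  | succ n ih =>
    by_cases hn : n ∈ S
    · set k := Nat.count (· ∈ S) n with hk
      have hd : ∀ c < 4 ^ k, ∀ q < 4, digit S (c + 4 ^ k * q) n = q := fun c hc q hq => by
        rw [digit, ← hk, Nat.add_mul_div_left _ _ (by positivity), Nat.div_eq_of_lt hc, zero_add,
          Nat.mod_eq_of_lt hq]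
      have hz : ∀ c < 4 ^ k, ∀ q < 4, zeros S (c + 4 ^ k * q) (n + 1)
          = if q < 3 then if q = 0 then zeros S c n + 1 else 0 else zeros S c n :=
        fun c hc q hq => by
          rw [zeros_succ_of_mem hn, hd c hc q hq, hk, zeros_add le_rfl]
      have hsum : ∑ c ∈ Finset.range (4 ^ (k + 1)), 2 ^ zeros S c (n + 1)
          = ∑ c ∈ Finset.range (4 ^ k), (3 * 2 ^ zeros S c n + 2) := by
        rw [show 4 ^ (k + 1) = 4 ^ k + 4 ^ k + 4 ^ k + 4 ^ k by ring, Finset.sum_range_add,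
          Finset.sum_range_add, Finset.sum_range_add, ← Finset.sum_add_distrib,
          ← Finset.sum_add_distrib, ← Finset.sum_add_distrib]
        refine Finset.sum_congr rfl fun c hc => ?_
        have hc := Finset.mem_range.1 hc
        have h0 := hz c hc 0 (by omega)
        have h1 := hz c hc 1 (by omega)
        have h2 := hz c hc 2 (by omega)
        have h3 := hz c hc 3 (by omega)
        rw [show c + 4 ^ k * 0 = c by ring] at h0
        rw [show c + 4 ^ k * 1 = 4 ^ k + c by ring] at h1
        rw [show c + 4 ^ k * 2 = 4 ^ k + 4 ^ k + c by ring] at h2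
        rw [show c + 4 ^ k * 3 = 4 ^ k + 4 ^ k + 4 ^ k + c by ring] at h3
        rw [h0, h1, h2, h3]
        norm_num [pow_succ]
        ring
      rw [Nat.count_succ, if_pos hn, ← hk, hsum, Finset.sum_add_distrib, ← Finset.mul_sum]
      simp only [Finset.sum_const, Finset.card_range, smul_eq_mul, pow_succ]
      omega
    · simpa only [Nat.count_succ, hn, if_false, add_zero, zeros_succ_of_notMem hn] using ih

/-! ### Decoding -/

/-- The set `T` for the root `r`: the cluster deletion set together with the root. -/
def rootSet (n : ℕ) (S : Finset ℕ) (r : ℕ) : Finset ℕ :=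
  (Finset.range n).filter fun v => v ∈ S ∨ v = r

/-- The set `A` for the root `r` and the code `c`: the vertices of `T` that are to belong to the
cover. -/
def baseSet (n : ℕ) (S : Finset ℕ) (r c : ℕ) : Finset ℕ :=
  (Finset.range n).filter fun v => Chosen S c v ∨ v = r

/-- Decoding marks `T` and `A`, counts the trailing zeros and lists the digits below `3`. -/
theorem run_decodeC {s : Store} (h : Input E n ℓ S s) :
    marked n ((decodeC.run s).a aT) = rootSet n S (s.v vRoot) ∧
    marked n ((decodeC.run s).a aA) = baseSet n S (s.v vRoot) (s.v vCode) ∧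
    (decodeC.run s).v vZeros = zeros S (s.v vCode) n ∧
    ∀ v < n, Chosen S (s.v vCode) v → (decodeC.run s).a aDig (Nat.count (Chosen S (s.v vCode)) v)
      = digit S (s.v vCode) v := by
  set c := s.v vCode with hc
  set r := s.v vRoot with hr
  have key := loop_inv (i := vI) (b := vN) (m := n)
    (p := seq digitC markC)
    (s := ((s.setV vRest c).setV vCnt 0).setV vZeros 0) h.hn
    (fun j t => (t.v vRest = c / 4 ^ Nat.count (· ∈ S) j ∧ t.v vCnt = Nat.count (Chosen S c) j ∧
      t.v vZeros = zeros S c j) ∧ (∀ v < j, (t.a aT v ≠ 0 ↔ v ∈ S ∨ v = r) ∧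
        (t.a aA v ≠ 0 ↔ Chosen S c v ∨ v = r)) ∧
      ∀ v < j, Chosen S c v → t.a aDig (Nat.count (Chosen S c) v) = digit S c v)
    (by simp [zeros]) fun j t hj ha hi ih => by
      have hin : Input E n ℓ S t := (h.of_eq (t := ((s.setV vRest c).setV vCnt 0).setV vZeros 0)
        rfl rfl rfl).agree ha rfl
      have hroot : t.v vRoot = r := ha.1 vRoot rfl
      clear ha
      obtain ⟨⟨i₁, i₂, i₃⟩, i₄, i₅⟩ := ih
      have hS : (setE vI).val t ≠ 0 ↔ j ∈ S := by
        have := hin.setE (x := vI) (hi ▸ hj)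
        rwa [hi] at this
      have hdig : t.v vRest - 4 * (t.v vRest / 2 / 2) = digit S c j := by
        rw [digit, i₁]
        omega
      have hrest : t.v vRest / 2 / 2 = c / 4 ^ (Nat.count (· ∈ S) j + 1) := by
        rw [i₁, pow_succ, ← Nat.div_div_eq_div_mul, Nat.div_div_eq_div_mul _ 2 2]
      obtain ⟨t₂, ht₂⟩ : ∃ t₂, t₂ = digitC.run t := ⟨_, rfl⟩
      have ag : digitC.Agree t t₂ := ht₂ ▸ run_agree _ t
      have g : (t₂.v vRest = c / 4 ^ Nat.count (· ∈ S) (j + 1) ∧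
          t₂.v vCnt = Nat.count (Chosen S c) (j + 1) ∧ t₂.v vZeros = zeros S c (j + 1)) ∧
          t₂.v vDigit = digit S c j ∧ ∀ v < j + 1, Chosen S c v →
          t₂.a aDig (Nat.count (Chosen S c) v) = digit S c v := by
        have hS' : (setE vI).val (t.setV vDigit (t.v vRest - 4 * (t.v vRest / 2 / 2))) ≠ 0 ↔
            j ∈ S := hS
        rw [hdig] at hS'
        rw [Nat.count_succ, Nat.count_succ, zeros]
        simp only [digitC, run_whenC, run, val, hdig] at ht₂
        by_cases hjS : j ∈ S
        · rw [if_pos (hS'.2 hjS)] at ht₂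
          by_cases h3 : digit S c j < 3
          · have hch : Chosen S c j := ⟨hjS, h3⟩
            have hlt : ∀ v < j, Chosen S c v →
                Nat.count (Chosen S c) v ≠ Nat.count (Chosen S c) j :=
              fun v hv hcv => (Nat.count_strict_mono hcv hv).ne
            rw [if_pos hjS, if_pos hch, if_pos hch]
            simp only [Store.setV_v, Store.setA_v] at ht₂
            by_cases h0 : digit S c j = 0
            all_goals
              simp [h0, h3, hrest] at ht₂
              subst ht₂
              refine ⟨by simp [i₂, i₃, h0], by simp [h0], fun v hv hcv => ?_⟩
              rcases Nat.lt_succ_iff_lt_or_eq.1 hv with hv | rfl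
              · simp [i₂, hlt v hv hcv, i₅ v hv hcv]
              · simp [i₂, h0]
          · have hch : ¬ Chosen S c j := fun h' => h3 h'.2
            rw [if_pos hjS, if_neg hch, if_neg hch]
            simp [h3, hrest] at ht₂
            subst ht₂
            refine ⟨by simp [i₂, i₃], by simp, fun v hv hcv => ?_⟩
            rcases Nat.lt_succ_iff_lt_or_eq.1 hv with hv | rfl
            · simp [i₅ v hv hcv]
            · exact absurd hcv hch
        · rw [if_neg (fun h' => hjS (hS'.1 h'))] at ht₂
          have hch : ¬ Chosen S c j := fun h' => hjS h'.1
          rw [if_neg hjS, if_neg hch, if_neg hch]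
          subst ht₂
          refine ⟨by simp [i₁, i₂, i₃], by simp, fun v hv hcv => ?_⟩
          rcases Nat.lt_succ_iff_lt_or_eq.1 hv with hv | rfl
          · simp [i₅ v hv hcv]
          · exact absurd hcv hch
      obtain ⟨g₁, g₂, g₃⟩ := g
      have hin₂ : Input E n ℓ S t₂ := hin.agree ag rfl
      have hi₂ : t₂.v vI = j := (ag.1 vI rfl).trans hi
      have hr₂ : t₂.v vRoot = r := (ag.1 vRoot rfl).trans hroot
      have hT₂ : t₂.a aT = t.a aT := ag.2 aT rfl
      have hA₂ : t₂.a aA = t.a aA := ag.2 aA rfl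
      clear ag
      have hS₂ : (setE vI).val t₂ ≠ 0 ↔ j ∈ S := by
        have := hin₂.setE (x := vI) (hi₂ ▸ hj)
        rwa [hi₂] at this
      have heq : ∀ t' : Store, t'.v = t₂.v →
          ((eqE (var vI) (var vRoot)).val t' ≠ 0 ↔ j = r) := fun t' ht' => by
        simp [val_eqE, ht', hi₂, hr₂]
      have e₁ : (lt (const 0) (add (setE vI) (eqE (var vI) (var vRoot)))).val t₂ ≠ 0 ↔
          j ∈ S ∨ j = r := by
        rw [val_pos, val_add_ne, hS₂, heq _ rfl]
      set m₁ := (lt (const 0) (add (setE vI) (eqE (var vI) (var vRoot)))).val t₂ with hm₁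
      have e₂ : (lt (const 0) (add (mul (setE vI) (lt (var vDigit) (const 3)))
          (eqE (var vI) (var vRoot)))).val (t₂.setA aT j m₁) ≠ 0 ↔ Chosen S c j ∨ j = r := by
        rw [val_pos, val_add_ne, val_mul_ne, heq (t₂.setA aT j m₁) rfl,
          show (setE vI).val (t₂.setA aT j m₁) = (setE vI).val t₂ from rfl, hS₂]
        simp [g₂, Chosen]
      set m₂ := (lt (const 0) (add (mul (setE vI) (lt (var vDigit) (const 3)))
          (eqE (var vI) (var vRoot)))).val (t₂.setA aT j m₁) with hm₂
      have hfin : (seq digitC markC).run t = (t₂.setA aT j m₁).setA aA j m₂ := by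
        have h1 : (aset aT (var vI) (lt (const 0) (add (setE vI)
            (eqE (var vI) (var vRoot))))).run t₂ = t₂.setA aT j m₁ := by
          rw [hm₁, ← hi₂]
          rfl
        have h2 : (var vI).val (t₂.setA aT j m₁) = j := hi₂
        rw [run, ← ht₂, markC, run, h1, run, h2]
      rw [hfin]
      clear_value m₁ m₂
      refine ⟨by simpa using g₁, fun v hv => ?_, fun v hv hcv => by simpa using g₃ v hv hcv⟩
      rcases Nat.lt_succ_iff_lt_or_eq.1 hv with hv | rfl
      · simpa [hv.ne, hT₂, hA₂] using i₄ v hv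
      · simpa using ⟨e₁, e₂⟩
  have hrun : decodeC.run s
    = (loop vI vN (seq digitC markC)).run (((s.setV vRest c).setV vCnt 0).setV vZeros 0) := rfl
  rw [hrun]
  obtain ⟨⟨-, -, k₁⟩, k₂, k₃⟩ := key
  refine ⟨?_, ?_, k₁, k₃⟩ <;> ext v <;>
    simp only [mem_marked, rootSet, baseSet, Finset.mem_filter, Finset.mem_range]
  · exact and_congr_right fun hv => (k₂ v hv).1
  · exact and_congr_right fun hv => (k₂ v hv).2

end ConnVC

/-! ### The result of the search for one code -/

namespace ConnVC

open LoopLang LoopLang.Ex LoopLang.Cmd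

variable {E : SimpleGraph ℕ} {n ℓ : ℕ} {S : Finset ℕ}

/-- What the program knows about the set `Y` marked in its array after the search. -/
structure Measured (E : SimpleGraph ℕ) (n : ℕ) (Y : Finset ℕ) (s : Store) : Prop where
  marked : marked n (s.a aY) = Y
  size : s.v vSize = Y.card
  cover : s.v vCover ≠ 0 ↔ ∀ x y, E.Adj x y → x ∈ Y ∨ y ∈ Y
  comps : s.v vComps = comps E Y Y
  labels : Labels E n Y Y (s.a aLab)
  labels_le : ∀ a ∈ Y, ∀ x, Joined E Y a x → s.a aLab x ≤ a
  rank : ∀ x ∈ reps E Y Y, s.a aRank x = ((reps E Y Y).filter (· < x)).card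

theorem run_measureC {s : Store} (h : Input E n ℓ S s) (hE : ∀ x y, E.Adj x y → x < n) :
    Measured E n (marked n (s.a aY)) (measureC.run s) := by
  classical
  set Y := ConnVC.marked n (s.a aY) with hY
  set p := (seq (whenC (inE aY vY) (set vSize (add (var vSize) (const 1))))
    (loop vX vN (whenC (mul (adjE vY vX) (mul (notE (inE aY vY)) (notE (inE aY vX))))
      (set vCover (const 0))))) with hp
  set s₀ := (s.setV vSize 0).setV vCover 1 with hs₀
  have hm : ∀ (t : Store) (x j : ℕ), t.a aY = s.a aY → t.v x = j → j < n →
      (j ∈ Y ↔ (inE aY x).val t ≠ 0) := fun t x j ht hx hj => by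
    rw [hY, mem_marked, inE, val, val, ht, hx]
    exact and_iff_right hj
  have key := loop_inv (p := p) (i := vY) (b := vN) (s := s₀) (m := n) h.hn
    (fun j t => t.v vSize = Nat.count (· ∈ Y) j ∧
      (t.v vCover ≠ 0 ↔ ∀ y < j, ∀ x < n, E.Adj y x → y ∈ Y ∨ x ∈ Y)) (by simp [hs₀])
    fun y t hy ha hvy ih => by
      have hi : Input E n ℓ S t := (h.of_eq (t := s₀) rfl rfl rfl).agree ha rfl
      have hYt : t.a aY = s.a aY := ha.2 aY rfl
      clear ha
      obtain ⟨t₁, ht₁⟩ : ∃ t₁, t₁ = (whenC (inE aY vY)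
        (set vSize (add (var vSize) (const 1)))).run t := ⟨_, rfl⟩
      have ag : (whenC (inE aY vY) (set vSize (add (var vSize) (const 1)))).Agree t t₁ :=
        ht₁ ▸ run_agree _ t
      have hi₁ : Input E n ℓ S t₁ := hi.agree ag rfl
      have hY₁ : t₁.a aY = s.a aY := (ag.2 aY rfl).trans hYt
      have hvy₁ : t₁.v vY = y := (ag.1 vY rfl).trans hvy
      have hcov : t₁.v vCover = t.v vCover := ag.1 vCover rfl
      have hsize : t₁.v vSize = Nat.count (· ∈ Y) (y + 1) := by
        rw [ht₁, run_whenC, Nat.count_succ]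
        by_cases hyY : y ∈ Y
        · rw [if_pos ((hm t vY y hYt hvy hy).1 hyY), if_pos hyY]
          simp [run, ih.1]
        · rw [if_neg fun h' => hyY ((hm t vY y hYt hvy hy).2 h'), if_neg hyY]
          exact ih.1
      clear ag
      have ag := run_agree (loop vX vN (whenC (mul (adjE vY vX) (mul (notE (inE aY vY))
        (notE (inE aY vX)))) (set vCover (const 0)))) t₁
      have inner := loop_inv (p := whenC (mul (adjE vY vX) (mul (notE (inE aY vY))
        (notE (inE aY vX)))) (set vCover (const 0))) (i := vX) (b := vN) (s := t₁) (m := n) hi₁.hn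
        (fun j t' => t'.v vCover ≠ 0 ↔ t.v vCover ≠ 0 ∧ ∀ x < j, E.Adj y x → y ∈ Y ∨ x ∈ Y)
        (by simp [hcov]) fun x t' hx ha hvx ih' => by
          have hi' := hi₁.agree ha rfl
          have hY' : t'.a aY = s.a aY := (ha.2 aY rfl).trans hY₁
          have hvy' : t'.v vY = y := (ha.1 vY rfl).trans hvy₁
          clear ha
          have hc : (mul (adjE vY vX) (mul (notE (inE aY vY)) (notE (inE aY vX)))).val t' ≠ 0 ↔
              ¬ (E.Adj y x → y ∈ Y ∨ x ∈ Y) := by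
            rw [val_mul_ne, val_mul_ne, hi'.adjE (hvy' ▸ hy) (hvx ▸ hx), hvy', hvx, val_notE,
              val_notE, hm t' vY y hY' hvy' hy, hm t' vX x hY' hvx hx]
            tauto
          rw [run_whenC, Nat.forall_lt_succ_right, ← and_assoc, ← ih']
          by_cases hg : E.Adj y x → y ∈ Y ∨ x ∈ Y
          · rw [if_neg fun h' => hc.1 h' hg]
            simp only [Store.setV_v, iff_true_intro hg, and_true]
            rfl
          · rw [if_pos (hc.2 hg)]
            simp [run, iff_false_intro hg]
      have e : p.run t = (loop vX vN (whenC (mul (adjE vY vX) (mul (notE (inE aY vY))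
        (notE (inE aY vX)))) (set vCover (const 0)))).run t₁ := by rw [ht₁]; rfl
      rw [e]
      refine ⟨?_, ?_⟩
      · exact (ag.1 vSize rfl).trans hsize
      · rw [Nat.forall_lt_succ_right, ← ih.2]
        exact inner
  obtain ⟨t, ht⟩ : ∃ t, t = (loop vY vN p).run s₀ := ⟨_, rfl⟩
  have ag : (loop vY vN p).Agree s₀ t := ht ▸ run_agree _ _
  rw [← ht] at key
  have hi : Input E n ℓ S t := (h.of_eq (t := s₀) rfl rfl rfl).agree ag rfl
  have hYt : t.a aY = s.a aY := ag.2 aY rfl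
  have hrun : measureC.run s = (labelC aY).run t := by rw [ht]; rfl
  obtain ⟨l₁, l₂, l₃, l₄⟩ := run_labelC hi (k := aY) (by decide) (by decide) subset_rfl
  have ag' := run_agree (labelC aY) t
  rw [hYt, ← hY] at l₁ l₂ l₃ l₄
  rw [hrun]
  refine ⟨by rw [ag'.2 aY rfl, hYt], ?_, ?_, l₁, l₂, l₃, l₄⟩
  · rw [ag'.1 vSize rfl, key.1, Nat.count_eq_card_filter_range]
    congr 1
    ext x
    simp only [Finset.mem_filter, Finset.mem_range, and_iff_right_iff_imp]
    exact fun hx => (mem_marked.1 hx).1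
  · rw [ag'.1 vCover rfl, key.2]
    exact ⟨fun h' x y hxy => h' x (hE x y hxy) y (hE y x hxy.symm) hxy,
      fun h' x _ y _ hxy => h' x y hxy⟩

/-- The search is run with the digits of the code. Entries of the digit array beyond those of the
chosen vertices are left over from earlier codes, and nothing is said about them. -/
theorem run_searchC {s : Store} (h : Input E n ℓ S s) (hE : ∀ x y, E.Adj x y → x < n) :
    ∃ dig : ℕ → ℕ, (∀ v < n, Chosen S (s.v vCode) v →
        dig (Nat.count (Chosen S (s.v vCode)) v) = digit S (s.v vCode) v) ∧
      Measured E n (search E n (rootSet n S (s.v vRoot)) (baseSet n S (s.v vRoot) (s.v vCode))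
        dig).1 (searchC.run s) ∧
      (searchC.run s).v vZeros = zeros S (s.v vCode) n := by
  obtain ⟨d₁, d₂, d₃, d₄⟩ := run_decodeC h
  set T := rootSet n S (s.v vRoot) with hT
  set A := baseSet n S (s.v vRoot) (s.v vCode) with hA
  obtain ⟨s₁, hs₁⟩ : ∃ t, t = decodeC.run s := ⟨_, rfl⟩
  have g₁ : decodeC.Agree s s₁ := hs₁ ▸ run_agree _ _
  have i₁ : Input E n ℓ S s₁ := h.agree g₁ rfl
  rw [← hs₁] at d₁ d₂ d₃ d₄
  obtain ⟨s₂, hs₂⟩ : ∃ t, t = startC.run s₁ := ⟨_, rfl⟩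
  have g₂ : startC.Agree s₁ s₂ := hs₂ ▸ run_agree _ _
  have i₂ : Input E n ℓ S s₂ := i₁.agree g₂ rfl
  have y₂ : marked n (s₂.a aY) = A ∪ forced E n T A := by
    rw [hs₂, run_startC i₁ hE, d₁, d₂]
  set s₃ := s₂.setV vPtr 0 with hs₃
  have i₃ : Input E n ℓ S s₃ := i₂.of_eq rfl rfl rfl
  have a₃ : marked n (s₃.a aA) = A := by
    rw [← d₂, ← g₂.2 aA rfl]
    rfl
  have t₃ : marked n (s₃.a aT) = T := by
    rw [← d₁, ← g₂.2 aT rfl]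
    rfl
  have y₃ : view n s₃ = (A ∪ forced E n T A, 0) := by
    simp [view, hs₃, y₂]
  have v₃ : s₃.v vZeros = zeros S (s.v vCode) n := (g₂.1 vZeros rfl).trans d₃
  have D₃ : s₃.a aDig = s₁.a aDig := g₂.2 aDig rfl
  have hsub₃ : marked n (s₃.a aA) ⊆ marked n (s₃.a aY) := by
    have : marked n (s₃.a aY) = A ∪ forced E n T A := congrArg Prod.fst y₃
    rw [a₃, this]
    exact Finset.subset_union_left
  have w₃ := run_triplesC i₃ hsub₃
  obtain ⟨s₄, hs₄⟩ : ∃ t, t = triplesC.run s₃ := ⟨_, rfl⟩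
  have g₄ : triplesC.Agree s₃ s₄ := hs₄ ▸ run_agree _ _
  have i₄ : Input E n ℓ S s₄ := i₃.agree g₄ rfl
  rw [← hs₄] at w₃
  have hsub₄ : marked n (s₄.a aA) ⊆ marked n (s₄.a aY) := by
    have e : marked n (s₄.a aY) = (view n s₄).1 := rfl
    rw [g₄.2 aA rfl, e, w₃]
    exact subset_triplePass hsub₃
  have w₄ := run_pairsC i₄ hsub₄
  obtain ⟨s₅, hs₅⟩ : ∃ t, t = pairsC.run s₄ := ⟨_, rfl⟩
  have g₅ : pairsC.Agree s₄ s₅ := hs₅ ▸ run_agree _ _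
  have i₅ : Input E n ℓ S s₅ := i₄.agree g₅ rfl
  rw [← hs₅, g₄.2 aT rfl, g₄.2 aA rfl, g₄.2 aDig rfl, w₃, t₃, a₃, y₃] at w₄
  have hrun : searchC.run s = measureC.run s₅ := by
    rw [hs₅, hs₄, hs₃, hs₂, hs₁]
    rfl
  have g₆ := run_agree measureC s₅
  have hm := run_measureC i₅ hE
  rw [show marked n (s₅.a aY) = (search E n T A (s₃.a aDig)).1 from congrArg Prod.fst w₄] at hm
  rw [hrun]
  refine ⟨s₃.a aDig, fun v hv hc => ?_, hm, ?_⟩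
  · rw [D₃]
    exact d₄ v hv hc
  · rw [g₆.1 vZeros rfl, g₅.1 vZeros rfl, g₄.1 vZeros rfl, v₃]

end ConnVC

/-! ### Linking the components of a vertex cover -/

namespace ConnVC

variable {E : SimpleGraph ℕ} {n ℓ : ℕ} {Y : Finset ℕ}

/-- The function `idx` numbers the `b` components of the graph induced on `Y`. -/
structure Index (E : SimpleGraph ℕ) (Y : Finset ℕ) (b : ℕ) (idx : ℕ → ℕ) : Prop where
  lt : ∀ x ∈ Y, idx x < b
  eq_iff : ∀ x ∈ Y, ∀ y ∈ Y, (idx x = idx y ↔ Joined E Y x y)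
  surj : ∀ i < b, ∃ x ∈ Y, idx x = i

/-- The ranks of the labels number the components. -/
theorem Measured.index {s : LoopLang.Store} (h : Measured E n Y s) :
    Index E Y (ConnVC.comps E Y Y) fun x => s.a aRank (s.a aLab x) := by
  have hYn : Y ⊆ Finset.range n := by
    rw [← h.marked]
    exact Finset.filter_subset _ _
  have hlab : ∀ x ∈ Y, s.a aLab x ∈ reps E Y Y ∧ Joined E Y (s.a aLab x) x := fun x hx =>
    label_mem_reps h.labels hYn h.labels_le hx (Finset.mem_range.1 (hYn hx)) (.refl x)
  have hlt : ∀ x ∈ reps E Y Y, s.a aRank x < ConnVC.comps E Y Y := fun x hx => by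
    rw [h.rank x hx]
    exact Finset.card_lt_card ⟨Finset.filter_subset _ _,
      fun h' => absurd (Finset.mem_filter.1 (h' hx)).2 (lt_irrefl x)⟩
  have hmono : ∀ x ∈ reps E Y Y, ∀ y ∈ reps E Y Y, x < y → s.a aRank x < s.a aRank y :=
    fun x hx y hy hxy => by
      rw [h.rank x hx, h.rank y hy]
      refine Finset.card_lt_card ⟨fun z hz => ?_, fun h' => ?_⟩
      · rw [Finset.mem_filter] at hz ⊢
        exact ⟨hz.1, hz.2.trans hxy⟩
      · exact absurd (Finset.mem_filter.1 (h' (Finset.mem_filter.2 ⟨hx, hxy⟩))).2 (lt_irrefl x)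
  have hinj : ∀ x ∈ reps E Y Y, ∀ y ∈ reps E Y Y, s.a aRank x = s.a aRank y → x = y :=
    fun x hx y hy hxy => by
      rcases lt_trichotomy x y with hl | hl | hl
      · exact absurd hxy (hmono x hx y hy hl).ne
      · exact hl
      · exact absurd hxy.symm (hmono y hy x hx hl).ne
  refine ⟨fun x hx => hlt _ (hlab x hx).1, fun x hx y hy => ⟨fun hxy => ?_, fun hxy => ?_⟩,
    fun i hi => ?_⟩
  · have := hinj _ (hlab x hx).1 _ (hlab y hy).1 hxy
    exact (hlab x hx).2.symm.trans (this ▸ (hlab y hy).2)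
  · have := reps_injective (hlab x hx).1 (hlab y hy).1
      ((hlab x hx).2.trans (hxy.trans (hlab y hy).2.symm))
    exact congrArg _ this
  · have himg : (reps E Y Y).image (s.a aRank) = Finset.range (ConnVC.comps E Y Y) := by
      refine Finset.eq_of_subset_of_card_le (fun j hj => ?_) ?_
      · obtain ⟨x, hx, rfl⟩ := Finset.mem_image.1 hj
        exact Finset.mem_range.2 (hlt x hx)
      · rw [Finset.card_image_of_injOn fun x hx y hy hxy => hinj x hx y hy hxy, Finset.card_range]
        rfl
    obtain ⟨x, hx, rfl⟩ := Finset.mem_image.1 (himg ▸ Finset.mem_range.2 hi)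
    refine ⟨x, (mem_reps.1 hx).1, ?_⟩
    have hx' := hlab x (mem_reps.1 hx).1
    exact congrArg _ (reps_injective hx'.1 hx hx'.2)

/-- The vertex `u` has a neighbour in the component number `i`. -/
def Touch (E : SimpleGraph ℕ) (Y : Finset ℕ) (idx : ℕ → ℕ) (u i : ℕ) : Prop :=
  ∃ x ∈ Y, E.Adj u x ∧ idx x = i

/-- The vertex `u` has a neighbour in a component whose number belongs to the set coded by `W`. -/
def Meets (E : SimpleGraph ℕ) (Y : Finset ℕ) (idx : ℕ → ℕ) (W u : ℕ) : Prop :=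
  ∃ x ∈ Y, E.Adj u x ∧ W.testBit (idx x)

/-- The number `N` codes the set coded by `W` together with the components that `u` meets. -/
def IsUnion (E : SimpleGraph ℕ) (Y : Finset ℕ) (idx : ℕ → ℕ) (W u N : ℕ) : Prop :=
  ∀ i, N.testBit i ↔ W.testBit i ∨ Touch E Y idx u i

/-- At most `k` vertices link the components in the set coded by `W`. -/
def Linked (E : SimpleGraph ℕ) (n : ℕ) (Y : Finset ℕ) (idx : ℕ → ℕ) (W k : ℕ) : Prop :=
  ∃ U : Finset ℕ, U ⊆ Finset.range n ∧ U.card ≤ k ∧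
    ∀ x y, (x ∈ U ∨ x ∈ Y ∧ W.testBit (idx x)) → (y ∈ U ∨ y ∈ Y ∧ W.testBit (idx y)) →
      Joined E (Y ∪ U) x y

variable {b : ℕ} {idx : ℕ → ℕ}

/-- A vertex that meets a linked set of components links it with all components that it meets. -/
theorem Linked.union (hI : Index E Y b idx) {W k u N : ℕ} (h : Linked E n Y idx W k) (hu : u < n)
    (hm : Meets E Y idx W u) (hN : IsUnion E Y idx W u N) : Linked E n Y idx N (k + 1) := by
  obtain ⟨U, hUn, hUk, hU⟩ := h
  obtain ⟨x₀, hx₀, hux₀, hW₀⟩ := hm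
  have hsub : Y ∪ U ⊆ Y ∪ insert u U := Finset.union_subset_union_right (Finset.subset_insert _ _)
  have huY : u ∈ Y ∪ insert u U := by simp
  have key : ∀ x, (x ∈ insert u U ∨ x ∈ Y ∧ N.testBit (idx x)) →
      Joined E (Y ∪ insert u U) x u := by
    have hold : ∀ x, (x ∈ U ∨ x ∈ Y ∧ W.testBit (idx x)) → Joined E (Y ∪ insert u U) x u :=
      fun x hx => ((hU x x₀ hx (.inr ⟨hx₀, hW₀⟩)).mono hsub).trans
        (.single hux₀.symm (Finset.mem_union_left _ hx₀) huY)
    rintro x (hx | ⟨hx, hxN⟩)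
    · rcases Finset.mem_insert.1 hx with rfl | hx
      · exact .refl _
      · exact hold x (.inl hx)
    · rcases (hN _).1 hxN with hxW | ⟨x', hx', hux', he⟩
      · exact hold x (.inr ⟨hx, hxW⟩)
      · exact ((((hI.eq_iff x' hx' x hx).1 he).symm.mono Finset.subset_union_left)).trans
          (.single hux'.symm (Finset.mem_union_left _ hx') huY)
  refine ⟨insert u U, ?_, (Finset.card_insert_le _ _).trans (by omega),
    fun x y hx hy => (key x hx).trans (key y hy).symm⟩
  intro z hz
  rcases Finset.mem_insert.1 hz with rfl | hz
  exacts [Finset.mem_range.2 hu, hUn hz]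

/-- The state of the dynamic program when all sets below `j` are settled and the set `j` has been
linked with the vertices below `u`. -/
structure Table (E : SimpleGraph ℕ) (n : ℕ) (Y : Finset ℕ) (b : ℕ) (idx : ℕ → ℕ) (j u : ℕ)
    (dp : ℕ → ℕ) : Prop where
  sound : ∀ W < 2 ^ b, dp W < n + 1 → Linked E n Y idx W (dp W)
  base : dp 1 = 0
  closed : ∀ W < 2 ^ b, dp W < n + 1 → ∀ v < n, v ∉ Y → (W < j ∨ W = j ∧ v < u) →
    Meets E Y idx W v → ∀ N, IsUnion E Y idx W v N → dp N ≤ dp W + 1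

theorem table_start (hI : Index E Y b idx) {dp : ℕ → ℕ} (h₁ : dp 1 = 0)
    (h : ∀ W < 2 ^ b, W ≠ 1 → dp W = n + 1) : Table E n Y b idx 0 0 dp where
  sound W hW hd := by
    by_cases hW1 : W = 1
    · subst hW1
      refine ⟨∅, by simp, by simp, fun x y hx hy => ?_⟩
      simp only [Finset.notMem_empty, false_or, Nat.testBit_one_eq_true_iff_self_eq_zero,
        Finset.union_empty] at hx hy ⊢
      exact (hI.eq_iff x hx.1 y hy.1).1 (hx.2.trans hy.2.symm)
    · rw [h W hW hW1] at hd
      omega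
  base := h₁
  closed W _ _ v _ _ h := by omega

theorem Table.next {j : ℕ} {dp : ℕ → ℕ} (h : Table E n Y b idx j n dp) :
    Table E n Y b idx (j + 1) 0 dp where
  sound := h.sound
  base := h.base
  closed W hW hd v hv hvY hj := h.closed W hW hd v hv hvY (by omega)

theorem Table.next_of_le {j : ℕ} {dp : ℕ → ℕ} (h : Table E n Y b idx j 0 dp)
    (hj : ¬ dp j < n + 1) : Table E n Y b idx (j + 1) 0 dp where
  sound := h.sound
  base := h.base
  closed W hW hd v hv hvY hWj := h.closed W hW hd v hv hvY <| by
    rcases hWj with hWj | hWj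
    · rcases Nat.lt_succ_iff_lt_or_eq.1 hWj with hWj | rfl
      exacts [.inl hWj, absurd hd hj]
    · omega

theorem Table.skip {j u : ℕ} {dp : ℕ → ℕ} (h : Table E n Y b idx j u dp)
    (hu : u ∈ Y ∨ ¬ Meets E Y idx j u ∨
      ∀ N, IsUnion E Y idx j u N → dp N ≤ dp j + 1) : Table E n Y b idx j (u + 1) dp where
  sound := h.sound
  base := h.base
  closed W hW hd v hv hvY hWj hm N hN := by
    by_cases hc : W = j ∧ v = u
    · obtain ⟨rfl, rfl⟩ := hc
      rcases hu with hu | hu | hu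
      exacts [absurd hu hvY, absurd hm hu, hu N hN]
    · exact h.closed W hW hd v hv hvY (by omega) hm N hN

theorem IsUnion.unique {W u N N' : ℕ} (h : IsUnion E Y idx W u N) (h' : IsUnion E Y idx W u N') :
    N = N' :=
  Nat.eq_of_testBit_eq fun i => Bool.eq_iff_iff.2 ((h i).trans (h' i).symm)

theorem IsUnion.le {W u N : ℕ} (h : IsUnion E Y idx W u N) : W ≤ N :=
  Nat.le_of_testBit fun i hi => (h i).2 (.inl hi)

/-- Improving the entry of the union of `j` and the components met by `u` settles the vertex `u`.
Entries up to `j` are unaffected, because the union is a larger number than `j`. -/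
theorem Table.update (hI : Index E Y b idx) {j u N : ℕ} {dp : ℕ → ℕ}
    (h : Table E n Y b idx j u dp) (hj : j < 2 ^ b) (hd : dp j < n + 1) (hu : u < n)
    (hm : Meets E Y idx j u) (hN : IsUnion E Y idx j u N) (hlt : dp j + 1 < dp N) :
    Table E n Y b idx j (u + 1) (Function.update dp N (dp j + 1)) := by
  have hjN : j < N := lt_of_le_of_ne hN.le fun he => by rw [← he] at hlt; omega
  have hle : ∀ W, Function.update dp N (dp j + 1) W ≤ dp W := fun W => by
    by_cases hW : W = N
    · rw [hW, Function.update_self]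
      exact hlt.le
    · rw [Function.update_of_ne hW]
  have hlow : ∀ W ≤ j, Function.update dp N (dp j + 1) W = dp W := fun W hW =>
    Function.update_of_ne (by omega) _ _
  refine ⟨fun W hW hd' => ?_, ?_, fun W hW hd' v hv hvY hWj hmW M hM => ?_⟩
  · by_cases hWN : W = N
    · subst hWN
      rw [Function.update_self]
      exact (h.sound j hj hd).union hI hu hm hN
    · rw [Function.update_of_ne hWN] at hd' ⊢
      exact h.sound W hW hd'
  · rw [Function.update_of_ne, h.base]
    rintro rfl
    rw [h.base] at hlt
    omega
  · have hWj' : W ≤ j := by omega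
    rw [hlow W hWj'] at hd' ⊢
    by_cases hc : W = j ∧ v = u
    · obtain ⟨rfl, rfl⟩ := hc
      rw [hM.unique hN, Function.update_self]
    · exact (hle M).trans (h.closed W hW hd' v hv hvY (by omega) hmW M hM)

theorem testBit_add_two_pow {N j : ℕ} (hN : N < 2 ^ j) (i : ℕ) :
    (N + 2 ^ j).testBit i ↔ N.testBit i ∨ i = j := by
  rw [add_comm]
  rcases lt_trichotomy i j with h | rfl | h
  · simp [Nat.testBit_two_pow_add_gt h, h.ne]
  · simp [Nat.testBit_two_pow_add_eq, Nat.testBit_lt_two_pow hN]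
  · have h1 : 2 ^ j + N < 2 ^ i :=
      (show 2 ^ j + N < 2 ^ (j + 1) by rw [pow_succ]; omega).trans_le
        (Nat.pow_le_pow_right (by omega) h)
    simp [Nat.testBit_lt_two_pow h1, Nat.testBit_lt_two_pow ((Nat.le_add_left N _).trans_lt h1),
      h.ne']

/-- Every property of the numbers below `b` is coded by the bits of a number below `2 ^ b`. -/
theorem exists_testBit_iff (P : ℕ → Prop) (b : ℕ) :
    ∃ N < 2 ^ b, ∀ i, N.testBit i ↔ i < b ∧ P i := by
  induction b with
  | zero => exact ⟨0, by simp, by simp⟩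
  | succ b ih =>
    obtain ⟨N, hN, h⟩ := ih
    by_cases hP : P b
    · refine ⟨N + 2 ^ b, by rw [pow_succ]; omega, fun i => ?_⟩
      rw [testBit_add_two_pow hN, h, Nat.lt_succ_iff_lt_or_eq]
      constructor
      · rintro (h' | rfl)
        exacts [⟨.inl h'.1, h'.2⟩, ⟨.inr rfl, hP⟩]
      · rintro ⟨h' | rfl, hi⟩
        exacts [.inl ⟨h', hi⟩, .inr rfl]
    · refine ⟨N, by rw [pow_succ]; omega, fun i => ?_⟩
      rw [h, Nat.lt_succ_iff_lt_or_eq]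
      constructor
      · exact fun h' => ⟨.inl h'.1, h'.2⟩
      · rintro ⟨h' | rfl, hi⟩
        exacts [⟨h', hi⟩, absurd hi hP]

theorem exists_union (hI : Index E Y b idx) {W : ℕ} (hW : W < 2 ^ b) (u : ℕ) :
    ∃ N < 2 ^ b, IsUnion E Y idx W u N := by
  obtain ⟨N, hN, h⟩ := exists_testBit_iff (fun i => W.testBit i ∨ Touch E Y idx u i) b
  refine ⟨N, hN, fun i => (h i).trans (and_iff_right_of_imp ?_)⟩
  rintro (h' | ⟨x, hx, -, rfl⟩)
  · by_contra hi
    rw [Nat.testBit_lt_two_pow (hW.trans_le (Nat.pow_le_pow_right (by omega) (by omega)))] at h'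
    exact absurd h' (by simp)
  · exact hI.lt x hx

/-- Acceptance is correct: the entry of the full set is small enough if and only if the vertex cover
`Y` extends to a connected vertex cover of size at most `ℓ`. As `Y` is a vertex cover, the vertices
added to it are pairwise nonadjacent, so they can be linked one at a time. -/
theorem Table.final (hI : Index E Y b idx) {j u : ℕ} {dp : ℕ → ℕ} (h : Table E n Y b idx j u dp)
    (hj : 2 ^ b ≤ j) (hYn : Y ⊆ Finset.range n) (hne : Y.Nonempty)
    (hcov : ∀ x y, E.Adj x y → x ∈ Y ∨ y ∈ Y) :
    dp (2 ^ b - 1) < n + 1 ∧ Y.card + dp (2 ^ b - 1) ≤ ℓ ↔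
      ∃ X, Y ⊆ X ∧ IsCVC E n X ∧ X.card ≤ ℓ := by
  classical
  have hfull : ∀ x ∈ Y, (2 ^ b - 1).testBit (idx x) := fun x hx => by simpa using hI.lt x hx
  have hpos := Nat.two_pow_pos b
  constructor
  · rintro ⟨hd, hl⟩
    obtain ⟨U, hUn, hUc, hU⟩ := h.sound (2 ^ b - 1) (by omega) hd
    refine ⟨Y ∪ U, Finset.subset_union_left, ⟨Finset.union_subset hYn hUn,
      hne.mono Finset.subset_union_left, fun x y hxy => ?_, fun x hx y hy => ?_⟩,
      (Finset.card_union_le _ _).trans (by omega)⟩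
    · exact (hcov x y hxy).imp (Finset.mem_union_left _) (Finset.mem_union_left _)
    · have : ∀ x ∈ Y ∪ U, x ∈ U ∨ x ∈ Y ∧ (2 ^ b - 1).testBit (idx x) := fun x hx =>
        (Finset.mem_union.1 hx).elim (fun hx => .inr ⟨hx, hfull x hx⟩) .inl
      exact hU x y (this x hx) (this y hy)
  · rintro ⟨X, hYX, hX, hXl⟩
    have hUcard : (X \ Y).card + Y.card = X.card := Finset.card_sdiff_add_card_eq_card hYX
    have hUn : (X \ Y).card ≤ n := by
      have := Finset.card_le_card (Finset.sdiff_subset.trans hX.subset : X \ Y ⊆ Finset.range n)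
      simpa using this
    -- a largest set of vertices of `X` outside `Y` that the table has linked
    obtain ⟨U, hUmem, hUmax⟩ := Finset.exists_max_image
      ((X \ Y).powerset.filter fun U => ∃ W < 2 ^ b, dp W ≤ U.card ∧ W.testBit 0 ∧
        ∀ v ∈ U, ∀ i, Touch E Y idx v i → W.testBit i) Finset.card
      ⟨∅, Finset.mem_filter.2 ⟨by simp, 1, by
        obtain ⟨x, hx⟩ := hne
        have := hI.lt x hx
        exact Nat.one_lt_two_pow (by omega), by rw [h.base]; simp, rfl, by simp⟩⟩
    obtain ⟨hUX, W, hW, hdW, hW0, hWU⟩ := Finset.mem_filter.1 hUmem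
    rw [Finset.mem_powerset] at hUX
    have hUc := Finset.card_le_card hUX
    have hclosed : ∀ v ∈ X \ Y, Meets E Y idx W v → v ∈ U := fun v hv hm => by
      by_contra hvU
      obtain ⟨N, hN, hNu⟩ := exists_union hI hW v
      have hvX := Finset.mem_sdiff.1 hv
      have hle := h.closed W hW (by omega) v (Finset.mem_range.1 (hX.subset hvX.1)) hvX.2
        (.inl (by omega)) hm N hNu
      have := hUmax (insert v U) (Finset.mem_filter.2 ⟨Finset.mem_powerset.2
        (Finset.insert_subset hv hUX), N, hN, by
          rw [Finset.card_insert_of_notMem hvU]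
          omega, (hNu 0).2 (.inl hW0), fun w hw i hi => by
          rcases Finset.mem_insert.1 hw with rfl | hw
          · exact (hNu i).2 (.inr hi)
          · exact (hNu i).2 (.inl (hWU w hw i hi))⟩)
      rw [Finset.card_insert_of_notMem hvU] at this
      omega
    -- the part of `X` reached is closed under adjacency
    have hall : ∀ x ∈ Y, W.testBit (idx x) := fun x hx => by
      obtain ⟨x₀, hx₀, h0⟩ := hI.surj 0 (by have := hI.lt x hx; omega)
      have hr := (hX.joined x₀ (hYX hx₀) x (hYX hx)).closed
        (fun z => z ∈ U ∨ z ∈ Y ∧ W.testBit (idx z)) (.inr ⟨hx₀, h0 ▸ hW0⟩)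
        fun p q hp hpq hpX hqX => by
          by_cases hq : q ∈ Y
          · refine .inr ⟨hq, ?_⟩
            rcases hp with hp | ⟨hp, hpW⟩
            · exact hWU p hp _ ⟨q, hq, hpq, rfl⟩
            · rwa [← (hI.eq_iff p hp q hq).2 (.single hpq hp hq)]
          · rcases hp with hp | ⟨hp, hpW⟩
            · rcases hcov p q hpq with h' | h'
              exacts [absurd h' (Finset.mem_sdiff.1 (hUX hp)).2, absurd h' hq]
            · exact .inl (hclosed q (Finset.mem_sdiff.2 ⟨hqX, hq⟩) ⟨p, hp, hpq.symm, hpW⟩)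
      rcases hr with hr | hr
      · exact absurd hx (Finset.mem_sdiff.1 (hUX hr)).2
      · exact hr.2
    have hWfull : W = 2 ^ b - 1 := Nat.eq_of_testBit_eq fun i => by
      rw [Nat.testBit_two_pow_sub_one]
      by_cases hi : i < b
      · obtain ⟨x, hx, rfl⟩ := hI.surj i hi
        simp [hall x hx, hi]
      · simp only [hi, decide_false]
        exact Nat.testBit_lt_two_pow (hW.trans_le (Nat.pow_le_pow_right (by omega) (by omega)))
    rw [← hWfull]
    omega

end ConnVC

/-! ### The dynamic program -/

namespace ConnVC

open LoopLang LoopLang.Ex LoopLang.Cmd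

variable {E : SimpleGraph ℕ} {n ℓ : ℕ} {S Y : Finset ℕ} {b : ℕ} {idx : ℕ → ℕ}

/-- The part of the state that the dynamic program uses but does not change. -/
structure Ready (E : SimpleGraph ℕ) (n ℓ : ℕ) (S Y : Finset ℕ) (b : ℕ) (idx : ℕ → ℕ) (s : Store) :
    Prop where
  input : Input E n ℓ S s
  marked : marked n (s.a aY) = Y
  comps : s.v vComps = b
  pow : s.v vPow = 2 ^ b
  idx : ∀ x, s.a aRank (s.a aLab x) = idx x

theorem Ready.of_eq {s t : Store} (h : Ready E n ℓ S Y b idx s) (h1 : t.v vN = s.v vN)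
    (h2 : t.v vEll = s.v vEll) (h3 : t.a aIn = s.a aIn) (h4 : t.a aY = s.a aY)
    (h5 : t.v vComps = s.v vComps) (h6 : t.v vPow = s.v vPow) (h7 : t.a aRank = s.a aRank)
    (h8 : t.a aLab = s.a aLab) : Ready E n ℓ S Y b idx t where
  input := h.input.of_eq h1 h2 h3
  marked := by rw [h4, h.marked]
  comps := by rw [h5, h.comps]
  pow := by rw [h6, h.pow]
  idx := by rw [h7, h8]; exact h.idx

theorem Ready.agree {s t : Store} {p : Cmd} (h : Ready E n ℓ S Y b idx s) (ha : p.Agree s t)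
    (h1 : p.wv vN = false) (h2 : p.wv vEll = false) (h3 : p.wa aIn = false) (h4 : p.wa aY = false)
    (h5 : p.wv vComps = false) (h6 : p.wv vPow = false) (h7 : p.wa aRank = false)
    (h8 : p.wa aLab = false) : Ready E n ℓ S Y b idx t :=
  h.of_eq (ha.1 _ h1) (ha.1 _ h2) (ha.2 _ h3) (ha.2 _ h4) (ha.1 _ h5) (ha.1 _ h6) (ha.2 _ h7)
    (ha.2 _ h8)

theorem Ready.mem_iff {s : Store} (h : Ready E n ℓ S Y b idx s) {x : ℕ} (hx : s.v x < n) :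
    s.v x ∈ Y ↔ (inE aY x).val s ≠ 0 := by
  rw [← h.marked, mem_marked]
  exact and_iff_right hx

theorem run_hitC {s : Store} (h : Ready E n ℓ S Y b idx s) (hu : s.v vU < n) :
    (hitC.run s).v vHit ≠ 0 ↔ Touch E Y idx (s.v vU) (s.v vJ) := by
  have key := loop_inv (p := whenC (mul (inE aY vX) (mul (adjE vU vX)
      (eqE (arr aRank (arr aLab (var vX))) (var vJ)))) (set vHit (const 1))) (i := vX) (b := vN)
    (s := s.setV vHit 0) (m := n) h.input.hn
    (fun j t => t.v vHit ≠ 0 ↔ ∃ x < j, x ∈ Y ∧ E.Adj (s.v vU) x ∧ idx x = s.v vJ) (by simp)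
    fun x t hx ha hvx ih => by
      have ht : Ready E n ℓ S Y b idx t := (h.of_eq (t := s.setV vHit 0)
        rfl rfl rfl rfl rfl rfl rfl rfl).agree ha rfl rfl rfl rfl rfl rfl rfl rfl
      have hvu : t.v vU = s.v vU := ha.1 vU rfl
      have hvj : t.v vJ = s.v vJ := ha.1 vJ rfl
      clear ha
      have hc : (mul (inE aY vX) (mul (adjE vU vX)
          (eqE (arr aRank (arr aLab (var vX))) (var vJ)))).val t ≠ 0 ↔
          x ∈ Y ∧ E.Adj (s.v vU) x ∧ idx x = s.v vJ := by
        have h1 := ht.mem_iff (x := vX) (hvx ▸ hx)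
        have h2 := ht.input.adjE (x := vU) (y := vX) (hvu ▸ hu) (hvx ▸ hx)
        have h3 : (eqE (arr aRank (arr aLab (var vX))) (var vJ)).val t ≠ 0 ↔
            idx x = s.v vJ := by
          simp [val_eqE, ht.idx, hvx, hvj]
        rw [hvx] at h1 h2
        rw [hvu] at h2
        rw [val_mul_ne, val_mul_ne, ← h1, h2, h3]
      rw [run_whenC, Nat.exists_lt_succ_right]
      by_cases hg : x ∈ Y ∧ E.Adj (s.v vU) x ∧ idx x = s.v vJ
      · rw [if_pos (hc.2 hg)]
        simp [run, iff_true_intro hg]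
      · rw [if_neg fun h' => hg (hc.1 h'), iff_false_intro hg, or_false]
        exact ih
  refine Iff.trans key ⟨?_, ?_⟩
  · rintro ⟨x, _, h1, h2, h3⟩
    exact ⟨x, h1, h2, h3⟩
  · rintro ⟨x, h1, h2, h3⟩
    rw [← h.marked] at h1
    exact ⟨x, (mem_marked.1 h1).1, h.marked ▸ h1, h2, h3⟩

/-- The state of the computation of a union when the components below `m` have been treated. -/
structure Partway (E : SimpleGraph ℕ) (Y : Finset ℕ) (b : ℕ) (idx : ℕ → ℕ) (W u m : ℕ)
    (s : Store) : Prop where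
  bits : s.v vBits = W / 2 ^ m
  meet : s.v vMeet ≠ 0 ↔ ∃ i < m, W.testBit i ∧ Touch E Y idx u i
  lt : s.v vNext < 2 ^ m
  next : ∀ i, (s.v vNext).testBit i ↔ i < m ∧ (W.testBit i ∨ Touch E Y idx u i)
  place : m < b → s.v vPlace = 2 ^ m

/-- The components are treated in increasing order, by halving `vBits` and doubling `vPlace`. -/
theorem run_bitC {s : Store} (h : Ready E n ℓ S Y b idx s) (hu : s.v vU < n) {W j : ℕ}
    (hj : s.v vJ = j) (hjb : j < b) (hp : Partway E Y b idx W (s.v vU) j s) :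
    Partway E Y b idx W (s.v vU) (j + 1) (bitC.run s) := by
  set u := s.v vU with hu'
  set s₁ := (s.setV vBit (s.v vBits - 2 * (s.v vBits / 2))).setV vBits (s.v vBits / 2) with hs₁
  have h₁ : Ready E n ℓ S Y b idx s₁ := h.of_eq rfl rfl rfl rfl rfl rfl rfl rfl
  have hhit := run_hitC h₁ hu
  have ag := run_agree hitC s₁
  obtain ⟨s₂, hs₂⟩ : ∃ t, t = hitC.run s₁ := ⟨_, rfl⟩
  have hrun : bitC.run s = (seq (whenC (mul (var vBit) (var vHit)) (set vMeet (const 1)))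
      (seq (whenC (add (var vBit) (var vHit)) (setC vNext (add (var vNext) (var vPlace)) vPow))
        (setC vPlace (add (var vPlace) (var vPlace)) vPow))).run s₂ := by
    rw [hs₂]
    rfl
  rw [← hs₂] at hhit ag
  have e₁ : s₂.v vBits = W / 2 ^ (j + 1) := by
    rw [ag.1 vBits rfl, pow_succ, ← Nat.div_div_eq_div_mul, ← hp.bits]
    rfl
  have e₂ : s₂.v vBit = W / 2 ^ j % 2 := by
    rw [ag.1 vBit rfl, ← hp.bits]
    change s.v vBits - 2 * (s.v vBits / 2) = _
    omega
  have e₃ : s₂.v vMeet = s.v vMeet := ag.1 vMeet rfl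
  have e₄ : s₂.v vNext = s.v vNext := ag.1 vNext rfl
  have e₅ : s₂.v vPlace = 2 ^ j := (ag.1 vPlace rfl).trans (hp.place hjb)
  have e₆ : s₂.v vPow = 2 ^ b := (ag.1 vPow rfl).trans h.pow
  have e₇ : s₂.v vHit ≠ 0 ↔ Touch E Y idx u j := by
    rw [hhit]
    exact Iff.of_eq (congrArg _ hj)
  clear ag hhit hs₂
  have hW : s₂.v vBit ≠ 0 ↔ W.testBit j := by
    rw [e₂, Nat.testBit_eq_decide_div_mod_eq, decide_eq_true_eq]
    omega
  have hlt : s.v vNext + 2 ^ j < 2 ^ (j + 1) := by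
    have := hp.lt
    rw [pow_succ]
    omega
  have hle : 2 ^ (j + 1) ≤ 2 ^ b := Nat.pow_le_pow_right (by omega) hjb
  set t := (seq (whenC (mul (var vBit) (var vHit)) (set vMeet (const 1)))
      (seq (whenC (add (var vBit) (var vHit)) (setC vNext (add (var vNext) (var vPlace)) vPow))
        (setC vPlace (add (var vPlace) (var vPlace)) vPow))).run s₂ with ht
  have f₁ : t.v vBits = W / 2 ^ (j + 1) := by
    rw [← e₁]
    exact (run_agree (seq (whenC (mul (var vBit) (var vHit)) (set vMeet (const 1)))
      (seq (whenC (add (var vBit) (var vHit)) (setC vNext (add (var vNext) (var vPlace)) vPow))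
        (setC vPlace (add (var vPlace) (var vPlace)) vPow))) s₂).1 vBits rfl
  have f₂ : t.v vMeet = if s₂.v vBit ≠ 0 ∧ s₂.v vHit ≠ 0 then 1 else s.v vMeet := by
    by_cases hb : s₂.v vBit = 0 <;> by_cases hh : s₂.v vHit = 0 <;>
      simp [ht, run, hb, hh, e₃]
  have f₃ : t.v vNext = if s₂.v vBit ≠ 0 ∨ s₂.v vHit ≠ 0 then s.v vNext + 2 ^ j
      else s.v vNext := by
    have : s.v vNext + 2 ^ j < 2 ^ b := by omega
    by_cases hb : s₂.v vBit = 0 <;> by_cases hh : s₂.v vHit = 0 <;>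
      simp [ht, run, hb, hh, e₄, e₅, e₆, this]
  have f₄ : j + 1 < b → t.v vPlace = 2 ^ (j + 1) := fun hb => by
    have h1 : 2 ^ j + 2 ^ j < 2 ^ b := by
      rw [← two_mul, ← pow_succ']
      exact Nat.pow_lt_pow_right (by omega) hb
    have h2 : t.v vPlace = if s₂.v vPlace + s₂.v vPlace < s₂.v vPow then
        s₂.v vPlace + s₂.v vPlace else 0 := by
      by_cases hb : s₂.v vBit = 0 <;> by_cases hh : s₂.v vHit = 0 <;>
        simp [ht, run, hb, hh]
    rw [h2, e₅, e₆, if_pos h1, pow_succ]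
    ring
  rw [hrun]
  clear_value t
  replace f₂ : t.v vMeet ≠ 0 ↔ s.v vMeet ≠ 0 ∨ W.testBit j ∧ Touch E Y idx u j := by
    rw [f₂, ← hW, ← e₇]
    split_ifs with hc
    · simp [hc]
    · simp only [hc, or_false]
  refine ⟨f₁, ?_, ?_, fun i => ?_, f₄⟩
  · rw [f₂, Nat.exists_lt_succ_right, ← hp.meet]
  · rw [f₃]
    split_ifs
    · exact hlt
    · omega
  · rw [f₃, Nat.lt_succ_iff_lt_or_eq]
    split_ifs with hc <;> rw [hW, e₇] at hc
    · rw [testBit_add_two_pow hp.lt, hp.next]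
      constructor
      · rintro (h' | rfl)
        exacts [⟨.inl h'.1, h'.2⟩, ⟨.inr rfl, hc⟩]
      · rintro ⟨h' | rfl, hi⟩
        exacts [.inl ⟨h', hi⟩, .inr rfl]
    · rw [hp.next]
      constructor
      · exact fun h' => ⟨.inl h'.1, h'.2⟩
      · rintro ⟨h' | rfl, hi⟩
        exacts [⟨h', hi⟩, absurd hi hc]

theorem run_unionC {s : Store} (h : Ready E n ℓ S Y b idx s) (hI : Index E Y b idx) (hbn : b ≤ n)
    (hu : s.v vU < n) (hW : s.v vMask < 2 ^ b) :
    ((unionC.run s).v vMeet ≠ 0 ↔ Meets E Y idx (s.v vMask) (s.v vU)) ∧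
      IsUnion E Y idx (s.v vMask) (s.v vU) ((unionC.run s).v vNext) := by
  set s₀ := (((s.setV vBits (s.v vMask)).setV vMeet 0).setV vNext 0).setV vPlace 1 with hs₀
  have key := loop_inv (p := whenC (lt (var vJ) (var vComps)) bitC) (i := vJ) (b := vN) (s := s₀)
    (m := n) h.input.hn (fun j t => Partway E Y b idx (s.v vMask) (s.v vU) (min j b) t)
    (by
      rw [Nat.zero_min]
      exact ⟨by simp [hs₀], by simp [hs₀], by simp [hs₀], by simp [hs₀], by simp [hs₀]⟩)
    fun j t hj ha hvj ih => by
      have ht : Ready E n ℓ S Y b idx t := (h.of_eq (t := s₀)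
        rfl rfl rfl rfl rfl rfl rfl rfl).agree ha rfl rfl rfl rfl rfl rfl rfl rfl
      have hvu : t.v vU = s.v vU := ha.1 vU rfl
      clear ha
      have hc : (lt (var vJ) (var vComps)).val t ≠ 0 ↔ j < b := by
        simp [hvj, ht.comps]
      have hset : ∀ t' : Store, Partway E Y b idx (s.v vMask) (s.v vU) (min (j + 1) b) t' →
          Partway E Y b idx (s.v vMask) (s.v vU) (min (j + 1) b) (t'.setV vJ (j + 1)) :=
        fun t' h' => ⟨h'.bits, h'.meet, h'.lt, h'.next, h'.place⟩
      refine hset _ ?_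
      rw [run_whenC]
      by_cases hjb : j < b
      · rw [if_pos (hc.2 hjb), min_eq_left (by omega)]
        rw [min_eq_left hjb.le, ← hvu] at ih
        rw [← hvu]
        exact run_bitC ht (hvu ▸ hu) hvj hjb ih
      · rw [if_neg fun h' => hjb (hc.1 h'), min_eq_right (by omega)]
        rwa [min_eq_right (by omega)] at ih
  rw [min_eq_right hbn] at key
  have hrun : unionC.run s = (loop vJ vN (whenC (lt (var vJ) (var vComps)) bitC)).run s₀ := rfl
  rw [hrun]
  refine ⟨key.meet.trans ⟨?_, ?_⟩, fun i => (key.next i).trans (and_iff_right_of_imp ?_)⟩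
  · rintro ⟨i, hi, hWi, x, hx, hux, rfl⟩
    exact ⟨x, hx, hux, hWi⟩
  · rintro ⟨x, hx, hux, hWx⟩
    exact ⟨idx x, hI.lt x hx, hWx, x, hx, hux, rfl⟩
  · rintro (h' | ⟨x, hx, -, rfl⟩)
    · by_contra hi
      rw [Nat.testBit_lt_two_pow (hW.trans_le (Nat.pow_le_pow_right (by omega) (by omega)))] at h'
      exact absurd h' (by simp)
    · exact hI.lt x hx

/-- One step of the dynamic program settles one vertex and keeps the entry of the current set. -/
theorem run_relaxC {s : Store} (h : Ready E n ℓ S Y b idx s) (hI : Index E Y b idx) (hbn : b ≤ n)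
    (hu : s.v vU < n) (hW : s.v vMask < 2 ^ b) (hd : s.a aDp (s.v vMask) < n + 1)
    (ht : Table E n Y b idx (s.v vMask) (s.v vU) (s.a aDp)) :
    Table E n Y b idx (s.v vMask) (s.v vU + 1) ((relaxC.run s).a aDp) ∧
      (relaxC.run s).a aDp (s.v vMask) = s.a aDp (s.v vMask) := by
  obtain ⟨h₁, h₂⟩ := run_unionC h hI hbn hu hW
  have ag := run_agree unionC s
  obtain ⟨s₁, hs₁⟩ : ∃ t, t = unionC.run s := ⟨_, rfl⟩
  have hrun : relaxC.run s = (whenC (mul (var vMeet)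
      (lt (add (arr aDp (var vMask)) (const 1)) (arr aDp (var vNext))))
      (aset aDp (var vNext) (add (arr aDp (var vMask)) (const 1)))).run s₁ := by
    rw [hs₁]
    rfl
  rw [← hs₁] at h₁ h₂ ag
  have e₁ : s₁.a aDp = s.a aDp := ag.2 aDp rfl
  have e₂ : s₁.v vMask = s.v vMask := ag.1 vMask rfl
  clear ag hs₁
  have hc : (mul (var vMeet) (lt (add (arr aDp (var vMask)) (const 1)) (arr aDp (var vNext)))).val
      s₁ ≠ 0 ↔ Meets E Y idx (s.v vMask) (s.v vU) ∧
        s.a aDp (s.v vMask) + 1 < s.a aDp (s₁.v vNext) := by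
    rw [val_mul_ne, val, h₁]
    simp [e₁, e₂]
  rw [hrun, run_whenC]
  by_cases hg : Meets E Y idx (s.v vMask) (s.v vU) ∧
      s.a aDp (s.v vMask) + 1 < s.a aDp (s₁.v vNext)
  · rw [if_pos (hc.2 hg)]
    have e : ((aset aDp (var vNext) (add (arr aDp (var vMask)) (const 1))).run s₁).a aDp
        = Function.update (s.a aDp) (s₁.v vNext) (s.a aDp (s.v vMask) + 1) := by
      simp [run, e₁, e₂]
    rw [e]
    refine ⟨ht.update hI hW hd hu hg.1 h₂ hg.2, Function.update_of_ne (fun he => ?_) _ _⟩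
    have := hg.2
    rw [← he] at this
    omega
  · rw [if_neg fun h' => hg (hc.1 h'), e₁]
    refine ⟨ht.skip (.inr ?_), rfl⟩
    by_cases hm : Meets E Y idx (s.v vMask) (s.v vU)
    · refine .inr fun N hN => ?_
      rw [hN.unique h₂]
      by_contra hlt
      exact hg ⟨hm, by omega⟩
    · exact .inl hm

theorem run_roundC {s : Store} (h : Ready E n ℓ S Y b idx s) (hI : Index E Y b idx) (hbn : b ≤ n)
    (hW : s.v vMask < 2 ^ b) (ht : Table E n Y b idx (s.v vMask) 0 (s.a aDp)) :
    Table E n Y b idx (s.v vMask + 1) 0 ((roundC.run s).a aDp) := by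
  have hc : (lt (arr aDp (var vMask)) (add (var vN) (const 1))).val s ≠ 0 ↔
      s.a aDp (s.v vMask) < n + 1 := by
    simp [h.input.hn]
  rw [roundC, run_whenC]
  by_cases hd : s.a aDp (s.v vMask) < n + 1
  · rw [if_pos (hc.2 hd)]
    refine (loop_inv (i := vU) (b := vN) (s := s) h.input.hn (fun u t =>
      Table E n Y b idx (s.v vMask) u (t.a aDp) ∧ t.a aDp (s.v vMask) = s.a aDp (s.v vMask))
      ⟨ht, rfl⟩ fun u t hu ha hvu ih => ?_).1.next
    have hr : Ready E n ℓ S Y b idx t := h.agree ha rfl rfl rfl rfl rfl rfl rfl rfl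
    have hm : t.v vMask = s.v vMask := ha.1 vMask rfl
    clear ha
    have hmem := hr.mem_iff (x := vU) (hvu ▸ hu)
    rw [hvu] at hmem
    change Table E n Y b idx (s.v vMask) (u + 1) (((whenC (notE (inE aY vU)) relaxC).run t).a aDp) ∧
      ((whenC (notE (inE aY vU)) relaxC).run t).a aDp (s.v vMask) = _
    rw [run_whenC]
    by_cases huY : u ∈ Y
    · rw [if_neg (by rw [val_notE]; exact hmem.1 huY)]
      exact ⟨ih.1.skip (.inl huY), ih.2⟩
    · rw [if_pos (by rw [val_notE]; by_contra h'; exact huY (hmem.2 h'))]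
      rw [← hm, ← hvu] at ih
      have := run_relaxC hr hI hbn (hvu ▸ hu) (hm ▸ hW) (by rw [ih.2, hm]; exact hd) ih.1
      rw [hm, hvu] at this
      refine ⟨this.1, this.2.trans ?_⟩
      rw [← hm, ih.2, hm]
  · rw [if_neg fun h' => hd (hc.1 h')]
    exact ht.next_of_le hd

/-- The clamp at `vLim` has no effect on the powers of two that occur. -/
theorem run_powC {s : Store} (hn : s.v vN = n) (hb : s.v vComps = b) (hbn : b ≤ n)
    (hl : 2 ^ b < s.v vLim) : (powC.run s).v vPow = 2 ^ b := by
  have key := loop_inv (p := whenC (lt (var vJ) (var vComps)) (setC vPow (add (var vPow) (var vPow))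
    vLim)) (i := vJ) (b := vN) (s := s.setV vPow 1) (m := n) hn
    (fun j t => t.v vPow = 2 ^ min j b) (by simp) fun j t hj ha hvj ih => by
      have h1 : t.v vComps = b := (ha.1 vComps rfl).trans hb
      have h2 : t.v vLim = s.v vLim := ha.1 vLim rfl
      clear ha
      rw [run_whenC]
      by_cases hjb : j < b
      · have h3 : 2 ^ j + 2 ^ j = 2 ^ (j + 1) := by rw [pow_succ]; omega
        have h4 : 2 ^ (j + 1) ≤ 2 ^ b := Nat.pow_le_pow_right (by omega) hjb
        rw [min_eq_left hjb.le] at ih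
        rw [if_pos (by simp [hvj, h1, hjb]), min_eq_left (by omega)]
        simp [run, ih, h2, h3, h4.trans_lt hl]
      · rw [if_neg (by simp [hvj, h1, hjb]), min_eq_right (by omega)]
        rwa [min_eq_right (by omega)] at ih
  rw [min_eq_right hbn] at key
  exact key

/-- The dynamic program accepts exactly if `Y` extends to a solution. -/
theorem run_steinerC {s : Store} (h : Input E n ℓ S s) (hm : Measured E n Y s) (hne : Y.Nonempty)
    (hcov : ∀ x y, E.Adj x y → x ∈ Y ∨ y ∈ Y) (hl : 2 ^ comps E Y Y < s.v vLim)
    [Decidable (∃ X, Y ⊆ X ∧ IsCVC E n X ∧ X.card ≤ ℓ)] :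
    (steinerC.run s).v vAns
      = if ∃ X, Y ⊆ X ∧ IsCVC E n X ∧ X.card ≤ ℓ then 1 else s.v vAns := by
  have hYn : Y ⊆ Finset.range n := by
    rw [← hm.marked]
    exact Finset.filter_subset _ _
  have hI := hm.index
  set b := comps E Y Y with hb
  have hbn : b ≤ n := comps_le_card.trans (by simpa using Finset.card_le_card hYn)
  set idx := fun x => s.a aRank (s.a aLab x) with hidx
  have hpow := run_powC h.hn hm.comps hbn hl
  have g₁ := run_agree powC s
  obtain ⟨s₁, hs₁⟩ : ∃ t, t = powC.run s := ⟨_, rfl⟩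
  rw [← hs₁] at hpow g₁
  have r₁ : Ready E n ℓ S Y b idx s₁ := by
    refine ⟨h.agree g₁ rfl, ?_, ?_, hpow, fun x => ?_⟩
    · rw [g₁.2 aY rfl, hm.marked]
    · rw [g₁.1 vComps rfl, hm.comps]
    · rw [g₁.2 aRank rfl, g₁.2 aLab rfl]
  have hans₁ : s₁.v vAns = s.v vAns := g₁.1 vAns rfl
  have hsize₁ : s₁.v vSize = Y.card := (g₁.1 vSize rfl).trans hm.size
  clear g₁
  have tab := loop_inv (p := aset aDp (var vMask) (add (var vN) (const 1))) (i := vMask)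
    (b := vPow) (s := s₁) r₁.pow (fun j t => ∀ W < j, t.a aDp W = n + 1) (by simp)
    fun j t hj ha hv ih W hWj => by
      have hN : t.v vN = n := (ha.1 vN rfl).trans r₁.input.hn
      clear ha
      rcases Nat.lt_succ_iff_lt_or_eq.1 hWj with hWj | rfl
      · simp [run, hv, hWj.ne, ih W hWj]
      · simp [run, hv, hN]
  have g₂ := run_agree tableC s₁
  obtain ⟨s₂, hs₂⟩ : ∃ t, t = tableC.run s₁ := ⟨_, rfl⟩
  have dp₂ : s₂.a aDp = Function.update (((loop vMask vPow (aset aDp (var vMask)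
      (add (var vN) (const 1)))).run s₁).a aDp) 1 0 := by
    rw [hs₂]
    rfl
  rw [← hs₂] at g₂
  have r₂ : Ready E n ℓ S Y b idx s₂ := r₁.agree g₂ rfl rfl rfl rfl rfl rfl rfl rfl
  have hans₂ : s₂.v vAns = s.v vAns := (g₂.1 vAns rfl).trans hans₁
  have hsize₂ : s₂.v vSize = Y.card := (g₂.1 vSize rfl).trans hsize₁
  clear g₂
  have t₂ : Table E n Y b idx 0 0 (s₂.a aDp) := by
    rw [dp₂]
    refine table_start hI (by simp) fun W hW hW1 => ?_
    rw [Function.update_of_ne hW1]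
    exact tab W hW
  have fin := loop_inv (p := roundC) (i := vMask) (b := vPow) (s := s₂) r₂.pow
    (fun j t => Table E n Y b idx j 0 (t.a aDp)) t₂ fun j t hj ha hv ih => by
      have hr : Ready E n ℓ S Y b idx t := r₂.agree ha rfl rfl rfl rfl rfl rfl rfl rfl
      clear ha
      rw [← hv] at ih
      have := run_roundC hr hI hbn (hv ▸ hj) ih
      rw [hv] at this
      exact this
  have g₃ := run_agree (loop vMask vPow roundC) s₂
  obtain ⟨s₃, hs₃⟩ : ∃ t, t = (loop vMask vPow roundC).run s₂ := ⟨_, rfl⟩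
  rw [← hs₃] at fin g₃
  have r₃ : Ready E n ℓ S Y b idx s₃ := r₂.agree g₃ rfl rfl rfl rfl rfl rfl rfl rfl
  have hans₃ : s₃.v vAns = s.v vAns := (g₃.1 vAns rfl).trans hans₂
  have hsize₃ : s₃.v vSize = Y.card := (g₃.1 vSize rfl).trans hsize₂
  have hrun : steinerC.run s = acceptC.run s₃ := by
    rw [hs₃, hs₂, hs₁]
    rfl
  clear g₃
  have hacc := fin.final (ℓ := ℓ) hI le_rfl hYn hne hcov
  have hc : (mul (lt (arr aDp (sub (var vPow) (const 1))) (add (var vN) (const 1)))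
      (lt (add (var vSize) (arr aDp (sub (var vPow) (const 1)))) (add (var vEll) (const 1)))).val
      s₃ ≠ 0 ↔ ∃ X, Y ⊆ X ∧ IsCVC E n X ∧ X.card ≤ ℓ := by
    rw [← hacc]
    simp [r₃.input.hn, r₃.input.hl, r₃.pow, hsize₃]
    omega
  rw [hrun, acceptC, run_whenC]
  split_ifs with h1 h2 h2
  · rfl
  · exact absurd (hc.1 h1) h2
  · exact absurd (hc.2 h2) h1
  · exact hans₃

end ConnVC

/-! ### Correctness of the program -/

namespace ConnVC

open LoopLang LoopLang.Ex LoopLang.Cmd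

variable {E : SimpleGraph ℕ} {n ℓ : ℕ} {S : Finset ℕ}

/-- The treatment of the root `r` and the code `c` leads to acceptance. -/
def Succeeds (E : SimpleGraph ℕ) (n ℓ : ℕ) (S : Finset ℕ) (r c : ℕ) : Prop :=
  ∀ dig : ℕ → ℕ, (∀ v < n, Chosen S c v → dig (Nat.count (Chosen S c) v) = digit S c v) →
    ∀ Y, Y = (search E n (rootSet n S r) (baseSet n S r c) dig).1 →
      (∀ x y, E.Adj x y → x ∈ Y ∨ y ∈ Y) ∧ comps E Y Y ≤ zeros S c n + 1 ∧
      ∃ X, Y ⊆ X ∧ IsCVC E n X ∧ X.card ≤ ℓ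

theorem exists_count_eq (p : ℕ → Prop) [DecidablePred p] {i n : ℕ} (h : i < Nat.count p n) :
    ∃ v < n, p v ∧ Nat.count p v = i := by
  induction n with
  | zero => simp at h
  | succ n ih =>
    rw [Nat.count_succ] at h
    by_cases hi : i < Nat.count p n
    · obtain ⟨v, hv, hp⟩ := ih hi
      exact ⟨v, by omega, hp⟩
    · by_cases hp : p n
      · rw [if_pos hp] at h
        exact ⟨n, by omega, hp, by omega⟩
      · rw [if_neg hp] at h
        omega

theorem subset_search {T A : Finset ℕ} {dig : ℕ → ℕ} : A ⊆ (search E n T A dig).1 :=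
  subset_pairPass (subset_triplePass Finset.subset_union_left)

/-- If there is a solution, some root and some code lead to acceptance. The code describes the
intersection of the solution with `S` and the decisions of the search; unused digits are zero. -/
theorem exists_succeeds (hT : Cluster E S) (hE : ∀ x y, E.Adj x y → x < n)
    (hS : S ⊆ Finset.range n) {X : Finset ℕ} (hX : IsCVC E n X) (hl : X.card ≤ ℓ) :
    ∃ r < n, ∃ c < 4 ^ Nat.count (· ∈ S) n, Succeeds E n ℓ S r c := by
  classical
  obtain ⟨r, hr⟩ := hX.nonempty
  have hrn : r < n := Finset.mem_range.1 (hX.subset hr)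
  set p : ℕ → Prop := fun v => v ∈ S ∧ v ∈ X ∧ v ≠ r with hp
  set A := (Finset.range n).filter fun v => p v ∨ v = r with hA
  have hAT : A ⊆ rootSet n S r := fun x hx => by
    obtain ⟨h1, h2⟩ := Finset.mem_filter.1 hx
    exact Finset.mem_filter.2 ⟨h1, h2.imp_left And.left⟩
  have hAX : A ⊆ X := fun x hx => by
    rcases (Finset.mem_filter.1 hx).2 with h | rfl
    exacts [h.2.1, hr]
  have hrA : r ∈ A := Finset.mem_filter.2 ⟨Finset.mem_range.2 hrn, .inr rfl⟩
  have hTr : Cluster E (rootSet n S r) := fun x y z hx hy hz hxy => by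
    have hlt : ∀ w < n, w ∉ rootSet n S r → w ∉ S := fun w hw hwT hwS =>
      hwT (Finset.mem_filter.2 ⟨Finset.mem_range.2 hw, .inl hwS⟩)
    intro hyz
    exact hT x y z (hlt x (hE x y hxy) hx) (hlt y (hE y x hxy.symm) hy)
      (hlt z (hE z y hyz.symm) hz) hxy hyz
  obtain ⟨Y, δ, hδ, hc, hcov, hex, hsearch⟩ := exists_search hTr hE hX hl
    (fun x hx => ⟨fun hxX => by
      obtain ⟨h1, h2⟩ := Finset.mem_filter.1 hx
      refine Finset.mem_filter.2 ⟨h1, ?_⟩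
      by_cases hxr : x = r
      · exact .inr hxr
      · exact .inl ⟨h2.resolve_right hxr, hxX, hxr⟩, fun h => hAX h⟩) hAX hAT hrA
  obtain ⟨c, hcn, hdig⟩ := exists_code S
    (fun v => if p v then δ.getD (Nat.count p v) 0 else 3) (fun v => by
      split_ifs
      · by_cases hv : Nat.count p v < δ.length
        · rw [List.getD_eq_getElem _ _ hv]
          exact (hδ _ (List.getElem_mem hv)).trans (by omega)
        · rw [List.getD_eq_default _ _ (by omega)]
          omega
      · omega) n
  have hchosen : Chosen S c = p := by
    funext v
    refine propext ⟨fun h => ?_, fun h => ⟨h.1, ?_⟩⟩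
    · have := hdig v (Finset.mem_range.1 (hS h.1)) h.1
      by_contra hpv
      rw [if_neg hpv] at this
      have := h.2
      omega
    · rw [hdig v (Finset.mem_range.1 (hS h.1)) h.1, if_pos h]
      by_cases hv : Nat.count p v < δ.length
      · rw [List.getD_eq_getElem _ _ hv]
        exact hδ _ (List.getElem_mem hv)
      · rw [List.getD_eq_default _ _ (by omega)]
        omega
  have hcount : ∀ v, Nat.count (Chosen S c) v = Nat.count p v := fun v => by
    simp only [Nat.count_eq_card_filter_range, hchosen]
  have hbase : baseSet n S r c = A := by
    ext v
    simp only [baseSet, hA, Finset.mem_filter, ← hchosen]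
  have hcardA : A.card = Nat.count p n + 1 := by
    have : A = insert r ((Finset.range n).filter p) := by
      ext v
      simp only [hA, Finset.mem_filter, Finset.mem_insert, Finset.mem_range]
      constructor
      · rintro ⟨h1, h2 | h2⟩
        exacts [.inr ⟨h1, h2⟩, .inl h2]
      · rintro (rfl | ⟨h1, h2⟩)
        exacts [⟨hrn, .inr rfl⟩, ⟨h1, .inl h2⟩]
    rw [this, Finset.card_insert_of_notMem (by simp [hp]), Nat.count_eq_card_filter_range]
  have hY : ∀ dig : ℕ → ℕ, (∀ v < n, Chosen S c v →
      dig (Nat.count (Chosen S c) v) = digit S c v) →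
      (search E n (rootSet n S r) A dig).1 = Y := fun dig hd => by
    by_cases hlen : δ.length ≤ Nat.count p n
    · refine hsearch dig fun i hi => ?_
      obtain ⟨v, hv, hpv, rfl⟩ := exists_count_eq p (hi.trans_le hlen)
      have h1 := hd v hv (hchosen ▸ hpv)
      rw [hcount] at h1
      rw [h1, hdig v hv hpv.1, if_pos hpv]
    · -- a search that uses more digits than there are chosen vertices ends without components
      exfalso
      have hY0 : comps E Y Y = 0 := by omega
      have hrY : r ∈ Y := by
        rw [← hsearch (fun i => δ.getD i 0) fun _ _ => rfl]
        exact subset_search hrA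
      obtain ⟨x, hx, -⟩ := exists_rep (E := E) (Y := Y) hrY
      exact absurd hx (by rw [Finset.card_eq_zero.1 hY0]; simp)
  refine ⟨r, hrn, c, hcn, fun dig hd Y' hY' => ?_⟩
  rw [hbase, hY dig hd] at hY'
  subst hY'
  have hz := count_le_zeros (S := S) (c := c) (δ := δ) (v := n) fun w hw hcw => by
    rw [hdig w hw hcw.1, hcount, if_pos (hchosen ▸ hcw)]
  rw [hcount] at hz
  exact ⟨hcov, by omega, hex⟩

/-- The treatment of one code never accepts wrongly, and it accepts if it should. -/
theorem run_codeC {s : Store} (h : Input E n ℓ S s) (hE : ∀ x y, E.Adj x y → x < n)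
    (hr : s.v vRoot < n) (hlim : s.v vLim = 1 + 4 * 4 ^ Nat.count (· ∈ S) n) :
    ((codeC.run s).v vAns = s.v vAns ∨
      (codeC.run s).v vAns = 1 ∧ ∃ X, IsCVC E n X ∧ X.card ≤ ℓ) ∧
    (Succeeds E n ℓ S (s.v vRoot) (s.v vCode) → (codeC.run s).v vAns = 1) := by
  classical
  obtain ⟨dig, hdig, hm, hz⟩ := run_searchC h hE
  obtain ⟨Y, hY⟩ : ∃ Y, Y = (search E n (rootSet n S (s.v vRoot))
    (baseSet n S (s.v vRoot) (s.v vCode)) dig).1 := ⟨_, rfl⟩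
  rw [← hY] at hm
  have ag := run_agree searchC s
  have hrun : codeC.run s = (whenC (mul (var vCover) (lt (var vComps) (add (var vZeros) (const 2))))
      steinerC).run (searchC.run s) := rfl
  generalize searchC.run s = t at hm hz ag hrun
  have ht : Input E n ℓ S t := h.agree ag rfl
  have hans : t.v vAns = s.v vAns := ag.1 vAns rfl
  have hlim' : t.v vLim = 1 + 4 * 4 ^ Nat.count (· ∈ S) n := (ag.1 vLim rfl).trans hlim
  have hc : (mul (var vCover) (lt (var vComps) (add (var vZeros) (const 2)))).val t ≠ 0 ↔
      (∀ x y, E.Adj x y → x ∈ Y ∨ y ∈ Y) ∧ comps E Y Y ≤ zeros S (s.v vCode) n + 1 := by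
    rw [val_mul_ne, val, hm.cover]
    simp [hm.comps, hz]
    intro _
    omega
  rw [hrun, run_whenC]
  by_cases hg : (∀ x y, E.Adj x y → x ∈ Y ∨ y ∈ Y) ∧ comps E Y Y ≤ zeros S (s.v vCode) n + 1
  · rw [if_pos (hc.2 hg)]
    have hne : Y.Nonempty := by
      refine ⟨s.v vRoot, ?_⟩
      rw [hY]
      exact subset_search (Finset.mem_filter.2 ⟨Finset.mem_range.2 hr, .inr rfl⟩)
    have hpow : 2 ^ comps E Y Y < t.v vLim := by
      rw [hlim']
      have h1 := zeros_le S (s.v vCode) n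
      calc 2 ^ comps E Y Y ≤ 2 ^ (Nat.count (· ∈ S) n + 1) :=
            Nat.pow_le_pow_right (by omega) (by omega)
        _ = 2 * 2 ^ Nat.count (· ∈ S) n := by ring
        _ ≤ 2 * 4 ^ Nat.count (· ∈ S) n :=
            Nat.mul_le_mul_left _ (Nat.pow_le_pow_left (by omega) _)
        _ < _ := by omega
    rw [run_steinerC ht hm hne hg.1 hpow]
    refine ⟨?_, fun hs => if_pos (hs dig hdig Y hY).2.2⟩
    split_ifs with hX
    · obtain ⟨X, -, hX⟩ := hX
      exact .inr ⟨rfl, X, hX⟩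
    · exact .inl hans
  · rw [if_neg fun h' => hg (hc.1 h')]
    exact ⟨.inl hans, fun hs => absurd ⟨(hs dig hdig Y hY).1, (hs dig hdig Y hY).2.1⟩ hg⟩

theorem run_loop_add {x i b : ℕ} (hxi : x ≠ i) {s : Store} :
    ((loop i b (set x (add (var x) (const 4)))).run s).v x = s.v x + 4 * s.v b :=
  loop_inv (p := set x (add (var x) (const 4))) (s := s) rfl
    (fun j t => t.v x = s.v x + 4 * j) (by simp [hxi]) fun j t _ _ _ ih => by
      simp [run, hxi, ih]
      ring

theorem run_growC {s : Store} (h : Input E n ℓ S s) {j : ℕ} (hj : j < n) (hv : s.v vI = j)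
    (hc : s.v vCodes = 4 ^ Nat.count (· ∈ S) j) :
    (growC.run s).v vCodes = 4 ^ Nat.count (· ∈ S) (j + 1) := by
  have hS := h.setE (x := vI) (hv ▸ hj)
  rw [hv] at hS
  rw [growC, run_whenC, Nat.count_succ]
  by_cases hjS : j ∈ S
  · rw [if_pos (hS.2 hjS), if_pos hjS]
    have h2 := run_loop_add (x := vTmp) (i := vK) (b := vCodes) (by decide) (s := s.setV vTmp 0)
    change ((loop vK vCodes (set vTmp (add (var vTmp) (const 4)))).run (s.setV vTmp 0)).v vTmp = _
    rw [h2]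
    simp [hc, pow_succ]
    ring
  · rw [if_neg fun h' => hjS (hS.1 h'), if_neg hjS]
    exact hc

/-- The number of codes is a power of four, and `vLim` exceeds the number of sets of components. -/
theorem run_codesC {s : Store} (h : Input E n ℓ S s) :
    (codesC.run s).v vCodes = 4 ^ Nat.count (· ∈ S) n ∧
    (codesC.run s).v vLim = 1 + 4 * 4 ^ Nat.count (· ∈ S) n := by
  have key := loop_inv (p := growC) (i := vI) (b := vN) (s := s.setV vCodes 1) (m := n) h.hn
    (fun j t => t.v vCodes = 4 ^ Nat.count (· ∈ S) j) (by simp) fun j t hj ha hv ih =>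
      run_growC ((h.of_eq (t := s.setV vCodes 1) rfl rfl rfl).agree ha rfl) hj hv ih
  obtain ⟨t, ht⟩ : ∃ t, t = (loop vI vN growC).run (s.setV vCodes 1) := ⟨_, rfl⟩
  have hrun : codesC.run s
      = (loop vK vCodes (set vLim (add (var vLim) (const 4)))).run (t.setV vLim 1) := by
    rw [ht]
    rfl
  rw [← ht] at key
  rw [hrun, run_loop_add (by decide)]
  refine ⟨?_, ?_⟩
  · exact ((run_agree (loop vK vCodes (set vLim (add (var vLim) (const 4))))
      (t.setV vLim 1)).1 vCodes rfl).trans key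
  · simp [key]

/-- The nested loops decide whether there is a solution. -/
theorem run_loopsC {s : Store} (h : Input E n ℓ S s) (hE : ∀ x y, E.Adj x y → x < n)
    (hT : Cluster E S) (hS : S ⊆ Finset.range n) (h0 : s.v vAns = 0)
    (hcodes : s.v vCodes = 4 ^ Nat.count (· ∈ S) n)
    (hlim : s.v vLim = 1 + 4 * 4 ^ Nat.count (· ∈ S) n) :
    ((∃ X, IsCVC E n X ∧ X.card ≤ ℓ) → (loopsC.run s).v vAns = 1) ∧
    ((¬ ∃ X, IsCVC E n X ∧ X.card ≤ ℓ) → (loopsC.run s).v vAns = 0) := by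
  have key := loop_inv (p := loop vCode vCodes codeC) (i := vRoot) (b := vN) (s := s) h.hn
    (fun j t => (t.v vAns = 1 ∧ ∃ X, IsCVC E n X ∧ X.card ≤ ℓ) ∨
      t.v vAns = 0 ∧ ∀ r < j, ∀ c < 4 ^ Nat.count (· ∈ S) n, ¬ Succeeds E n ℓ S r c)
    (.inr (by simpa using h0)) fun r t hr ha hv ih => by
      have ht : Input E n ℓ S t := h.agree ha rfl
      have hcodes' : t.v vCodes = 4 ^ Nat.count (· ∈ S) n := (ha.1 vCodes rfl).trans hcodes
      have hlim' : t.v vLim = 1 + 4 * 4 ^ Nat.count (· ∈ S) n := (ha.1 vLim rfl).trans hlim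
      clear ha
      have inner := loop_inv (p := codeC) (i := vCode) (b := vCodes) (s := t) hcodes'
        (fun j t' => (t'.v vAns = 1 ∧ ∃ X, IsCVC E n X ∧ X.card ≤ ℓ) ∨
          t'.v vAns = 0 ∧ (∀ r' < r, ∀ c < 4 ^ Nat.count (· ∈ S) n, ¬ Succeeds E n ℓ S r' c) ∧
            ∀ c < j, ¬ Succeeds E n ℓ S r c)
        (ih.imp id fun h' => ⟨h'.1, h'.2, by simp⟩) fun c t' hc ha hvc ih' => by
          have ht' : Input E n ℓ S t' := ht.agree ha rfl
          have hr' : t'.v vRoot = r := (ha.1 vRoot rfl).trans hv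
          have hl' := (ha.1 vLim rfl).trans hlim'
          clear ha
          obtain ⟨k₁, k₂⟩ := run_codeC ht' hE (hr' ▸ hr) hl'
          rw [hr', hvc] at k₂
          generalize codeC.run t' = t'' at k₁ k₂ ⊢
          have e : (t''.setV vCode (c + 1)).v vAns = t''.v vAns := rfl
          rw [e]
          rcases k₁ with k₁ | k₁
          · rw [k₁]
            refine ih'.imp id fun h' => ⟨h'.1, h'.2.1, fun c' hc' hsc => ?_⟩
            rcases Nat.lt_succ_iff_lt_or_eq.1 hc' with hc' | rfl
            · exact h'.2.2 c' hc' hsc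
            · have := k₂ hsc
              rw [k₁, h'.1] at this
              omega
          · exact .inl k₁
      generalize (loop vCode vCodes codeC).run t = t' at inner ⊢
      refine inner.imp id fun h' => ⟨h'.1, fun r' hr' => ?_⟩
      rcases Nat.lt_succ_iff_lt_or_eq.1 hr' with hr' | rfl
      exacts [h'.2.1 r' hr', h'.2.2]
  constructor
  · rintro ⟨X, hX, hl⟩
    obtain ⟨r, hr, c, hc, hs⟩ := exists_succeeds hT hE hS hX hl
    rcases key with k | k
    exacts [k.1, absurd hs (k.2 r hr c hc)]
  · intro hno
    rcases key with k | k
    exacts [absurd k.2 hno, k.1]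

end ConnVC

/-! ### The number of steps -/

namespace ConnVC

open LoopLang LoopLang.Ex LoopLang.Cmd

variable {E : SimpleGraph ℕ} {n ℓ : ℕ} {S : Finset ℕ}

/-- All loops of the program have `vN` rounds. -/
def Flat : Cmd → Bool
  | .skip => true
  | .set _ _ => true
  | .setC _ _ _ => true
  | .aset _ _ _ => true
  | .seq p q => Flat p && Flat q
  | .ite _ p q => Flat p && Flat q
  | .loop _ b p => decide (b = vN) && Flat p

/-- A bound on the number of steps of a program all of whose loops have `m` rounds. -/
def cap (m : ℕ) : Cmd → ℕ
  | .skip => 1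
  | .set _ _ => 1
  | .setC _ _ _ => 1
  | .aset _ _ _ => 1
  | .seq p q => cap m p + cap m q
  | .ite _ p q => 1 + (cap m p + cap m q)
  | .loop _ _ p => 2 + m * (cap m p + 2)

/-- A bound for the steps of a loop whose body is bounded under an invariant. -/
theorem steps_loop_inv {p : Cmd} {i b m : ℕ} {s : Store} (hm : s.v b = m) (f : ℕ → ℕ)
    (I : ℕ → Store → Prop) (h0 : I 0 (s.setV i 0))
    (hs : ∀ j t, j < m → (loop i b p).Agree s t → t.v i = j → I j t →
      I (j + 1) ((p.run t).setV i (j + 1)))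
    (h : ∀ j t, j < m → (loop i b p).Agree s t → t.v i = j → I j t → p.steps t ≤ f j) :
    (loop i b p).steps s ≤ 2 + ∑ j ∈ Finset.range m, (f j + 2) := by
  subst hm
  have hI : ∀ j ≤ s.v b, I j (iter p.run i s j) := fun j hj => by
    induction j with
    | zero => exact h0
    | succ j ih => exact hs j _ hj (iter_agree p i b s j) (iter_counter _ _ _ _) (ih (by omega))
  rw [steps]
  gcongr with j hj
  have hj := Finset.mem_range.1 hj
  exact h j _ hj (iter_agree p i b s j) (iter_counter _ _ _ _) (hI j hj.le)

theorem steps_loop_le {p : Cmd} {i b m : ℕ} {s : Store} (hm : s.v b = m) (f : ℕ → ℕ)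
    (h : ∀ j t, j < m → (loop i b p).Agree s t → t.v i = j → p.steps t ≤ f j) :
    (loop i b p).steps s ≤ 2 + ∑ j ∈ Finset.range m, (f j + 2) :=
  steps_loop_inv hm f (fun _ _ => True) trivial (fun _ _ _ _ _ _ => trivial)
    fun j t hj ha hv _ => h j t hj ha hv

theorem steps_le_cap (p : Cmd) {s : Store} {m : ℕ} (hp : Flat p = true) (hN : p.wv vN = false)
    (hm : s.v vN = m) : p.steps s ≤ cap m p := by
  induction p generalizing s with
  | skip => exact le_rfl
  | set x e => exact le_rfl
  | setC x e y => exact le_rfl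
  | aset k i e => exact le_rfl
  | seq p q ihp ihq =>
    simp only [Flat, Bool.and_eq_true] at hp
    simp only [wv, Bool.or_eq_false_iff] at hN
    exact Nat.add_le_add (ihp hp.1 hN.1 hm) (ihq hp.2 hN.2 (((run_agree p s).1 _ hN.1).trans hm))
  | ite b p q ihp ihq =>
    simp only [Flat, Bool.and_eq_true] at hp
    simp only [wv, Bool.or_eq_false_iff] at hN
    have h1 := ihp hp.1 hN.1 hm
    have h2 := ihq hp.2 hN.2 hm
    simp only [steps, cap]
    split_ifs <;> omega
  | loop i b p ih =>
    simp only [Flat, Bool.and_eq_true, decide_eq_true_eq] at hp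
    obtain ⟨rfl, hp⟩ := hp
    have hN' := hN
    simp only [wv, Bool.or_eq_false_iff] at hN
    refine (steps_loop_le hm (fun _ => cap m p) fun j t _ ha _ =>
      ih hp hN.2 ((ha.1 _ (by simp only [wv, Bool.or_eq_false_iff]; exact hN)).trans hm)).trans ?_
    simp [cap]

/-- Functions bounded by a polynomial. -/
def Poly (f : ℕ → ℕ) : Prop := ∃ K d, ∀ m, f m ≤ K * (m + 1) ^ d

theorem Poly.const (c : ℕ) : Poly fun _ => c := ⟨c, 0, by simp⟩

theorem Poly.id : Poly fun m => m := ⟨1, 1, by simp⟩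

theorem Poly.add {f g : ℕ → ℕ} (hf : Poly f) (hg : Poly g) : Poly fun m => f m + g m := by
  obtain ⟨K, d, h⟩ := hf
  obtain ⟨L, e, k⟩ := hg
  refine ⟨K + L, d + e, fun m => ?_⟩
  rw [add_mul]
  refine Nat.add_le_add ((h m).trans ?_) ((k m).trans ?_) <;>
    exact Nat.mul_le_mul_left _ (Nat.pow_le_pow_right (by omega) (by omega))

theorem Poly.mul {f g : ℕ → ℕ} (hf : Poly f) (hg : Poly g) : Poly fun m => f m * g m := by
  obtain ⟨K, d, h⟩ := hf
  obtain ⟨L, e, k⟩ := hg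
  refine ⟨K * L, d + e, fun m => (Nat.mul_le_mul (h m) (k m)).trans (le_of_eq ?_)⟩
  rw [pow_add]
  ring

theorem poly_cap (p : Cmd) : Poly fun m => cap m p := by
  induction p with
  | skip => exact .const 1
  | set x e => exact .const 1
  | setC x e y => exact .const 1
  | aset k i e => exact .const 1
  | seq p q ihp ihq => exact ihp.add ihq
  | ite b p q ihp ihq => exact (Poly.const 1).add (ihp.add ihq)
  | loop i b p ih => exact (Poly.const 2).add (Poly.id.mul (ih.add (.const 2)))

/-- The dynamic program takes polynomial time for each set of components. -/
theorem steps_steinerC {s : Store} (hn : s.v vN = n) {b : ℕ} (hb : s.v vComps = b) (hbn : b ≤ n)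
    (hl : 2 ^ b < s.v vLim) :
    steinerC.steps s ≤ (cap n powC + cap n roundC + cap n acceptC + 10) * 2 ^ b := by
  have h1 : powC.steps s ≤ cap n powC := steps_le_cap powC rfl rfl hn
  have hpow := run_powC hn hb hbn hl
  have g₁ := run_agree powC s
  have hrun : steinerC.steps s = powC.steps s + (tableC.steps (powC.run s) +
      ((loop vMask vPow roundC).steps (tableC.run (powC.run s)) +
        acceptC.steps ((loop vMask vPow roundC).run (tableC.run (powC.run s))))) := rfl
  generalize powC.run s = s₁ at hpow g₁ hrun
  have n₁ : s₁.v vN = n := (g₁.1 vN rfl).trans hn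
  have h2 : tableC.steps s₁ ≤ 3 + 3 * 2 ^ b := by
    have : (loop vMask vPow (aset aDp (var vMask) (add (var vN) (const 1)))).steps s₁
        ≤ 2 + ∑ j ∈ Finset.range (2 ^ b), (1 + 2) :=
      steps_loop_le hpow (fun _ => 1) fun _ _ _ _ _ => le_rfl
    rw [tableC, steps, steps]
    simp only [Finset.sum_const, Finset.card_range, smul_eq_mul] at this
    omega
  have g₂ := run_agree tableC s₁
  generalize tableC.run s₁ = s₂ at g₂ hrun
  have n₂ : s₂.v vN = n := (g₂.1 vN rfl).trans n₁
  have p₂ : s₂.v vPow = 2 ^ b := (g₂.1 vPow rfl).trans hpow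
  have h3 : (loop vMask vPow roundC).steps s₂ ≤ 2 + 2 ^ b * (cap n roundC + 2) := by
    refine (steps_loop_le p₂ (fun _ => cap n roundC) fun j t _ ha _ => ?_).trans (by simp)
    exact steps_le_cap roundC rfl rfl ((ha.1 vN rfl).trans n₂)
  have g₃ := run_agree (loop vMask vPow roundC) s₂
  generalize (loop vMask vPow roundC).run s₂ = s₃ at g₃ hrun
  have h4 : acceptC.steps s₃ ≤ cap n acceptC :=
    steps_le_cap acceptC rfl rfl ((g₃.1 vN rfl).trans n₂)
  have hb1 : 1 ≤ 2 ^ b := Nat.one_le_two_pow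
  rw [hrun]
  nlinarith [Nat.mul_le_mul_left (cap n powC) hb1, Nat.mul_le_mul_left (cap n acceptC) hb1]

/-- The time for one code: polynomial, up to the number of sets of components. -/
theorem steps_codeC {s : Store} (h : Input E n ℓ S s) (hE : ∀ x y, E.Adj x y → x < n)
    (hlim : s.v vLim = 1 + 4 * 4 ^ Nat.count (· ∈ S) n) :
    codeC.steps s ≤ (cap n searchC + 2 +
      2 * (cap n powC + cap n roundC + cap n acceptC + 10)) * 2 ^ zeros S (s.v vCode) n := by
  obtain ⟨dig, -, hm, hz⟩ := run_searchC h hE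
  generalize (search E n (rootSet n S (s.v vRoot))
    (baseSet n S (s.v vRoot) (s.v vCode)) dig).1 = Y at hm
  have ag := run_agree searchC s
  have h1 : searchC.steps s ≤ cap n searchC := steps_le_cap searchC rfl rfl h.hn
  have hrun : codeC.steps s = searchC.steps s +
      (whenC (mul (var vCover) (lt (var vComps) (add (var vZeros) (const 2))))
      steinerC).steps (searchC.run s) := rfl
  generalize searchC.run s = t at hm hz ag hrun
  have hlim' : t.v vLim = 1 + 4 * 4 ^ Nat.count (· ∈ S) n := (ag.1 vLim rfl).trans hlim
  have hb1 : 1 ≤ 2 ^ zeros S (s.v vCode) n := Nat.one_le_two_pow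
  set Q := cap n powC + cap n roundC + cap n acceptC + 10
  have h2 : (whenC (mul (var vCover) (lt (var vComps) (add (var vZeros) (const 2))))
      steinerC).steps t ≤ 2 + Q * (2 * 2 ^ zeros S (s.v vCode) n) := by
    rw [whenC, steps]
    split_ifs with hc
    · rw [val_mul_ne] at hc
      have hc := hc.2
      simp only [val, hm.comps, hz, ne_eq, ite_eq_right_iff, one_ne_zero, imp_false,
        not_not] at hc
      have hle : 2 ^ comps E Y Y ≤ 2 * 2 ^ zeros S (s.v vCode) n := by
        rw [← pow_succ']
        exact Nat.pow_le_pow_right (by omega) (by omega)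
      have hYn : Y ⊆ Finset.range n := by
        rw [← hm.marked]
        exact Finset.filter_subset _ _
      have hpow : 2 ^ comps E Y Y < t.v vLim := by
        rw [hlim']
        have h1 := zeros_le S (s.v vCode) n
        calc 2 ^ comps E Y Y ≤ 2 * 2 ^ zeros S (s.v vCode) n := hle
          _ ≤ 2 * 2 ^ Nat.count (· ∈ S) n :=
              Nat.mul_le_mul_left _ (Nat.pow_le_pow_right (by omega) h1)
          _ ≤ 2 * 4 ^ Nat.count (· ∈ S) n :=
              Nat.mul_le_mul_left _ (Nat.pow_le_pow_left (by omega) _)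
          _ < _ := by omega
      have := steps_steinerC ((ag.1 vN rfl).trans h.hn) hm.comps
        (comps_le_card.trans (by simpa using Finset.card_le_card hYn)) hpow
      have := this.trans (Nat.mul_le_mul_left Q hle)
      omega
    · simp only [steps]
      omega
  rw [hrun]
  nlinarith [Nat.mul_le_mul_left (cap n searchC) hb1]

/-- Each of the loops that add up codes has at most `4 ^ |S|` rounds, and there are `n + 1` of
them. -/
theorem steps_codesC {s : Store} (h : Input E n ℓ S s) :
    codesC.steps s ≤ (12 * n + 20) * 4 ^ Nat.count (· ∈ S) n := by
  set K := 4 ^ Nat.count (· ∈ S) n with hK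
  have hK1 : 1 ≤ K := Nat.one_le_pow _ _ (by omega)
  have add_steps : ∀ (x i b : ℕ) (t : Store),
      (loop i b (set x (add (var x) (const 4)))).steps t = 2 + 3 * t.v b := fun x i b t => by
    simp only [steps, Finset.sum_const, Finset.card_range, smul_eq_mul]
    ring
  have h1 : (loop vI vN growC).steps (s.setV vCodes 1) ≤ 2 + n * (3 * K + 9) := by
    refine (steps_loop_inv (i := vI) (b := vN) (s := s.setV vCodes 1) (m := n) h.hn
      (fun _ => 3 * K + 7)
      (fun j t => t.v vCodes = 4 ^ Nat.count (· ∈ S) j) (by simp) (fun j t hj ha hv ih =>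
        run_growC ((h.of_eq (t := s.setV vCodes 1) rfl rfl rfl).agree ha rfl) hj hv ih)
      fun j t hj ha hv ih => ?_).trans (by simp)
    have hle : t.v vCodes ≤ K := by
      rw [ih]
      exact Nat.pow_le_pow_right (by omega) (Nat.count_monotone _ hj.le)
    have hin := add_steps vTmp vK vCodes (t.setV vTmp 0)
    rw [Store.setV_v, if_neg (by decide)] at hin
    rw [growC, whenC, steps]
    split_ifs
    · simp only [steps, run, val] at hin ⊢
      omega
    · simp only [steps]
      omega
  have hc := (run_codesC h).1
  have ag := run_agree (loop vK vCodes (set vLim (add (var vLim) (const 4))))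
    (((loop vI vN growC).run (s.setV vCodes 1)).setV vLim 1)
  have h2 : ((loop vI vN growC).run (s.setV vCodes 1)).v vCodes = K :=
    (ag.1 vCodes rfl).symm.trans hc
  have hrun : codesC.steps s = 1 + ((loop vI vN growC).steps (s.setV vCodes 1) +
      (1 + (loop vK vCodes (set vLim (add (var vLim) (const 4)))).steps
        (((loop vI vN growC).run (s.setV vCodes 1)).setV vLim 1))) := rfl
  rw [hrun, add_steps, Store.setV_v, if_neg (by decide), h2]
  nlinarith [Nat.mul_le_mul_left n hK1]

/-- The number of steps of the two nested loops. -/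
theorem steps_loopsC : ∃ K d, ∀ (E : SimpleGraph ℕ) (n ℓ : ℕ) (S : Finset ℕ) (s : Store),
    Input E n ℓ S s → (∀ x y, E.Adj x y → x < n) → s.v vCodes = 4 ^ Nat.count (· ∈ S) n →
    s.v vLim = 1 + 4 * 4 ^ Nat.count (· ∈ S) n →
    loopsC.steps s ≤ K * (n + 1) ^ d * 4 ^ Nat.count (· ∈ S) n := by
  obtain ⟨K, d, hK⟩ : Poly fun n => 2 + n * (2 * (cap n searchC + 2 +
      2 * (cap n powC + cap n roundC + cap n acceptC + 10)) + 6) :=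
    (Poly.const 2).add (Poly.id.mul (((Poly.const 2).mul (((poly_cap _).add (.const 2)).add
      ((Poly.const 2).mul ((((poly_cap _).add (poly_cap _)).add (poly_cap _)).add
        (.const 10))))).add (.const 6)))
  refine ⟨K, d, fun E n ℓ S s h hE hcodes hlim => ?_⟩
  set k := Nat.count (· ∈ S) n with hk
  set R := cap n searchC + 2 + 2 * (cap n powC + cap n roundC + cap n acceptC + 10) with hR
  have hpos : 1 ≤ 4 ^ k := Nat.one_le_pow _ _ (by omega)
  have inner : ∀ r t, r < n → loopsC.Agree s t → t.v vRoot = r →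
      (loop vCode vCodes codeC).steps t ≤ 2 + (2 * R + 2) * 4 ^ k := fun r t hr ha hv => by
    have ht : Input E n ℓ S t := h.agree ha rfl
    have hl : t.v vLim = 1 + 4 * 4 ^ k := (ha.1 vLim rfl).trans hlim
    have hc : t.v vCodes = 4 ^ k := (ha.1 vCodes rfl).trans hcodes
    clear ha
    refine (steps_loop_le hc (fun c => R * 2 ^ zeros S c n) fun c t' _ ha hvc => ?_).trans ?_
    · have := steps_codeC (ht.agree ha rfl) hE ((ha.1 vLim rfl).trans hl)
      rwa [hvc] at this
    · have := sum_two_pow_zeros S n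
      rw [← hk] at this
      rw [Finset.sum_add_distrib, ← Finset.mul_sum]
      simp only [Finset.sum_const, Finset.card_range, smul_eq_mul]
      have h3 : ∑ c ∈ Finset.range (4 ^ k), 2 ^ zeros S c n ≤ 2 * 4 ^ k :=
        (Nat.le_add_right _ _).trans this
      have := Nat.mul_le_mul_left R h3
      nlinarith
  have outer := steps_loop_le (p := loop vCode vCodes codeC) (i := vRoot) (b := vN) (s := s) h.hn
    (fun _ => 2 + (2 * R + 2) * 4 ^ k) inner
  refine outer.trans ?_
  simp only [Finset.sum_const, Finset.card_range, smul_eq_mul]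
  calc 2 + n * (2 + (2 * R + 2) * 4 ^ k + 2) ≤ (2 + n * (2 * R + 6)) * 4 ^ k := by
        nlinarith [Nat.mul_le_mul_left n hpos]
    _ ≤ _ := Nat.mul_le_mul_right _ (hK n)

end ConnVC

/-! ### Instances -/

namespace ConnVC

open LoopLang LoopLang.Ex LoopLang.Cmd

section Transfer

variable {n ℓ : ℕ} (G : SimpleGraph (Fin n)) (S : Finset (Fin n))

/-- A graph on `Fin n` as a graph on the natural numbers. -/
def lift : SimpleGraph ℕ := G.map Fin.valEmbedding

/-- A set of vertices as a set of natural numbers. -/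
def liftSet : Finset ℕ := S.map Fin.valEmbedding

variable {G S}

theorem lift_adj (x y : Fin n) : (lift G).Adj x y ↔ G.Adj x y :=
  SimpleGraph.map_adj_apply (f := Fin.valEmbedding) (G := G)

theorem exists_of_lift_adj {x y : ℕ} (h : (lift G).Adj x y) :
    ∃ u v : Fin n, G.Adj u v ∧ (u : ℕ) = x ∧ (v : ℕ) = y :=
  (SimpleGraph.map_adj _ _ _ _).1 h

theorem lift_adj_lt {x y : ℕ} (h : (lift G).Adj x y) : x < n := by
  obtain ⟨u, v, -, rfl, -⟩ := exists_of_lift_adj h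
  exact u.2

theorem mem_liftSet (x : Fin n) : (x : ℕ) ∈ liftSet S ↔ x ∈ S :=
  Finset.mem_map' Fin.valEmbedding

theorem liftSet_subset : liftSet S ⊆ Finset.range n := fun x hx => by
  obtain ⟨u, -, rfl⟩ := Finset.mem_map.1 hx
  exact Finset.mem_range.2 u.2

theorem card_liftSet : (liftSet S).card = S.card := Finset.card_map _

theorem count_liftSet : Nat.count (· ∈ liftSet S) n = S.card := by
  rw [Nat.count_eq_card_filter_range, ← card_liftSet (S := S)]
  congr 1
  ext x
  simp only [Finset.mem_filter, and_iff_right_iff_imp]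
  exact fun hx => liftSet_subset hx

theorem exists_eq_liftSet {X : Finset ℕ} (hX : X ⊆ Finset.range n) :
    ∃ X' : Finset (Fin n), X = liftSet X' := by
  refine ⟨Finset.univ.filter fun u => (u : ℕ) ∈ X, ?_⟩
  ext x
  simp only [liftSet, Finset.mem_map, Finset.mem_filter, Finset.mem_univ, true_and]
  constructor
  · exact fun hx => ⟨⟨x, Finset.mem_range.1 (hX hx)⟩, hx, rfl⟩
  · rintro ⟨u, hu, rfl⟩
    exact hu

theorem cluster_lift (h : IsClusterDeletionSet G S) : Cluster (lift G) (liftSet S) := by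
  intro x y z hx hy hz hxy hyz hxz
  obtain ⟨u, v, huv, rfl, rfl⟩ := exists_of_lift_adj hxy
  obtain ⟨v', w, hvw, hv', rfl⟩ := exists_of_lift_adj hyz
  obtain rfl := Fin.val_injective hv'
  rw [mem_liftSet] at hx hy hz
  set H := G.induce ((S : Set (Fin n))ᶜ)
  let u' : ((S : Set (Fin n))ᶜ : Set (Fin n)) := ⟨u, by simpa using hx⟩
  let v'' : ((S : Set (Fin n))ᶜ : Set (Fin n)) := ⟨v', by simpa using hy⟩
  let w' : ((S : Set (Fin n))ᶜ : Set (Fin n)) := ⟨w, by simpa using hz⟩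
  have h1 : H.Adj u' v'' := huv
  have h2 : H.Adj v'' w' := hvw
  have hc := h (H.connectedComponentMk u')
  have : H.Adj u' w' := hc rfl (SimpleGraph.ConnectedComponent.sound
    (h1.reachable.trans h2.reachable).symm) fun he =>
      hxz (congrArg Fin.val (congrArg Subtype.val he))
  exact (lift_adj u w).2 this

/-- Reachability in the induced subgraph is joinedness in the lifted graph. -/
theorem joined_liftSet_iff {X : Finset (Fin n)} {u v : Fin n} (hu : u ∈ X) (hv : v ∈ X) :
    Joined (lift G) (liftSet X) u v ↔
      (G.induce (X : Set (Fin n))).Reachable ⟨u, hu⟩ ⟨v, hv⟩ := by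
  constructor
  · intro h
    obtain ⟨v', hv', he, hr⟩ := h.closed (fun y => ∃ (v : Fin n) (hv : v ∈ X), (v : ℕ) = y ∧
      (G.induce (X : Set (Fin n))).Reachable ⟨u, hu⟩ ⟨v, hv⟩) ⟨u, hu, rfl, .refl _⟩ <| by
        rintro p q ⟨a, ha, rfl, hr⟩ hpq - hq
        obtain ⟨a', c, hac, ha', rfl⟩ := exists_of_lift_adj hpq
        obtain rfl := Fin.val_injective ha'
        have hc : c ∈ X := (mem_liftSet c).1 hq
        have hadj : (G.induce (X : Set (Fin n))).Adj ⟨a', ha⟩ ⟨c, hc⟩ := hac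
        exact ⟨c, hc, rfl, hr.trans hadj.reachable⟩
    obtain rfl := Fin.val_injective he
    exact hr
  · intro h
    rw [SimpleGraph.reachable_iff_reflTransGen] at h
    exact h.lift (fun a : (X : Set (Fin n)) => ((a : Fin n) : ℕ)) fun a c hac =>
      ⟨(lift_adj _ _).2 hac, (mem_liftSet _).2 a.2, (mem_liftSet _).2 c.2⟩

theorem isCVC_liftSet_iff {X : Finset (Fin n)} : IsCVC (lift G) n (liftSet X) ↔
    G.IsVertexCover (X : Set (Fin n)) ∧ (G.induce (X : Set (Fin n))).Connected := by
  constructor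
  · intro h
    refine ⟨fun u v huv => ?_, ?_⟩
    · have := h.cover u v ((lift_adj u v).2 huv)
      rwa [mem_liftSet, mem_liftSet] at this
    · obtain ⟨x, hx⟩ := h.nonempty
      obtain ⟨u, hu, rfl⟩ := Finset.mem_map.1 hx
      have : Nonempty (X : Set (Fin n)) := ⟨⟨u, hu⟩⟩
      refine ⟨fun a c => ?_⟩
      exact (joined_liftSet_iff a.2 c.2).1
        (h.joined _ ((mem_liftSet _).2 a.2) _ ((mem_liftSet _).2 c.2))
  · rintro ⟨h1, h2⟩
    refine ⟨liftSet_subset, ?_, fun x y hxy => ?_, fun x hx y hy => ?_⟩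
    · obtain ⟨u⟩ := h2.nonempty
      exact ⟨_, (mem_liftSet _).2 u.2⟩
    · obtain ⟨u, v, huv, rfl, rfl⟩ := exists_of_lift_adj hxy
      rw [mem_liftSet, mem_liftSet]
      exact h1 huv
    · obtain ⟨u, hu, rfl⟩ := Finset.mem_map.1 hx
      obtain ⟨v, hv, rfl⟩ := Finset.mem_map.1 hy
      exact (joined_liftSet_iff hu hv).2 (h2.preconnected _ _)

theorem hasConnectedVertexCover_iff : HasConnectedVertexCover G ℓ ↔
    ∃ X, IsCVC (lift G) n X ∧ X.card ≤ ℓ := by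
  constructor
  · rintro ⟨X, h1, h2, h3⟩
    exact ⟨liftSet X, isCVC_liftSet_iff.2 ⟨h1, h2⟩, card_liftSet.trans_le h3⟩
  · rintro ⟨X, h1, h2⟩
    obtain ⟨X, rfl⟩ := exists_eq_liftSet h1.subset
    exact ⟨X, (isCVC_liftSet_iff.1 h1).1, (isCVC_liftSet_iff.1 h1).2, card_liftSet ▸ h2⟩

/-! ### Input words -/

theorem getD_flatMap {α : Type*} {m : ℕ} (f : α → List ℕ) (hf : ∀ a, (f a).length = m)
    (L : List α) {x y : ℕ} (hx : x < L.length) (hy : y < m) :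
    (L.flatMap f).getD (x * m + y) 0 = (f L[x]).getD y 0 := by
  induction L generalizing x with
  | nil => simp at hx
  | cons a L ih =>
    rw [List.flatMap_cons]
    cases x with
    | zero => rw [zero_mul, zero_add, List.getD_append _ _ _ _ (by rw [hf]; exact hy)]; rfl
    | succ x =>
      rw [List.getD_append_right _ _ _ _ (by rw [hf, add_mul]; omega), hf,
        show (x + 1) * m + y - m = x * m + y by rw [add_mul]; omega]
      exact ih (by simpa using hx)

theorem getD_map_finRange (f : Fin n → ℕ) {x : ℕ} (hx : x < n) :
    ((List.finRange n).map f).getD x 0 = f ⟨x, hx⟩ := by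
  rw [List.getD_eq_getElem _ _ (by simpa using hx)]
  simp

open Classical in
theorem length_rows : ((List.finRange n).flatMap
    (fun u => (List.finRange n).map fun v => if G.Adj u v then 1 else 0)).length = n * n := by
  simp [List.length_flatMap]

theorem length_encodeInstance : (encodeInstance G S ℓ).length = n * n + n + 2 := by
  classical
  rw [encodeInstance, List.length_append, List.length_append, length_rows]
  simp
  ring

theorem encodeInstance_zero : (encodeInstance G S ℓ).getD 0 0 = n := rfl

theorem encodeInstance_one : (encodeInstance G S ℓ).getD 1 0 = ℓ := rfl

open Classical in
theorem encodeInstance_adj {x y : ℕ} (hx : x < n) (hy : y < n) :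
    (encodeInstance G S ℓ).getD (2 + (x * n + y)) 0 = if (lift G).Adj x y then 1 else 0 := by
  have hlt : x * n + y < n * n := by nlinarith
  rw [encodeInstance, List.append_assoc, List.getD_append_right _ _ _ _ (by simp),
    List.getD_append _ _ _ _ (by rw [length_rows]; simpa using hlt)]
  have e : 2 + (x * n + y) - [n, ℓ].length = x * n + y := by simp
  rw [e, getD_flatMap (m := n) _ (by simp) _ (by simpa using hx) hy, getD_map_finRange _ hy]
  have : (lift G).Adj x y ↔ G.Adj ⟨x, hx⟩ ⟨y, hy⟩ := lift_adj ⟨x, hx⟩ ⟨y, hy⟩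
  simp [this]

open Classical in
theorem encodeInstance_set {x : ℕ} (hx : x < n) :
    (encodeInstance G S ℓ).getD (2 + (n * n + x)) 0 = if x ∈ liftSet S then 1 else 0 := by
  rw [encodeInstance, List.getD_append_right _ _ _ _ (by
    rw [List.length_append, length_rows]
    simp)]
  have e : 2 + (n * n + x) - ([n, ℓ] ++ (List.finRange n).flatMap
      (fun u => (List.finRange n).map fun v => if G.Adj u v then 1 else 0)).length = x := by
    rw [List.length_append, length_rows]
    simp
    omega
  rw [e, getD_map_finRange _ hx]
  have : x ∈ liftSet S ↔ ⟨x, hx⟩ ∈ S := mem_liftSet ⟨x, hx⟩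
  simp [this]

theorem length_le_inputSize (w : List ℕ) : w.length ≤ RAM.inputSize w := by
  rw [RAM.inputSize, ← List.length_map (as := w) (f := fun a => a.size + 1)]
  exact List.length_le_sum_of_one_le _ (by simp)

theorem getD_lt_two_pow (w : List ℕ) (i : ℕ) : w.getD i 0 < 2 ^ RAM.inputSize w := by
  by_cases hi : i < w.length
  · rw [List.getD_eq_getElem _ _ hi]
    refine Nat.size_le.1 ((Nat.le_succ _).trans ?_)
    exact List.single_le_sum (by simp) _ (List.mem_map.2 ⟨w[i], List.getElem_mem hi, rfl⟩)
  · rw [List.getD_eq_default _ _ (by omega)]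
    positivity

end Transfer

end ConnVC

/-! ### The machine -/

namespace ConnVC

open LoopLang LoopLang.Ex LoopLang.Cmd

/-- The machine program: register `1` receives the length of the input word and register `0` is
cleared, as the translation of the loop program expects. -/
def machine : RAM.Program :=
  .seq (.assign 1 (.reg 0)) (.seq (.assign 0 (.const 0)) mainC.prog)

/-- The store that represents an input word. -/
def initStore (w : List ℕ) : Store where
  v x := if x = 1 then w.length else 0
  a k i := if k = 0 then w.getD i 0 else 0

/-- The state of the machine when the translated program starts. -/
def initState (w : List ℕ) : RAM.State where
  reg x := if x = 1 then w.length else 0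
  mem i := w.getD i 0

theorem sim_init (w : List ℕ) : Sim (initStore w) (initState w) where
  reg _ := rfl
  inp i := by
    by_cases hi : i < w.length
    · simp [initStore, initState, hi]
    · simp [initStore, hi]
  arr k i hk _ := by
    simp [initStore, initState, hk.ne']

theorem below_init (w : List ℕ) : Below (2 ^ RAM.inputSize w) (initState w) := by
  refine ⟨fun x => ?_, fun i => (getD_lt_two_pow w i).le⟩
  simp only [initState]
  split_ifs
  · exact (length_le_inputSize w).trans Nat.lt_two_pow_self.le
  · exact Nat.zero_le _

/-- The two assignments that precede the translated program produce the state `initState`. -/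
theorem exec_machine {w : List ℕ} {σ : RAM.State} {t : ℕ}
    (h : RAM.Exec mainC.prog (initState w) σ t) :
    RAM.Exec machine (RAM.init w) σ (w.length.size + t + 4) := by
  have h1 := RAM.Exec.assign 1 (.reg 0) (RAM.init w)
  have h2 := RAM.Exec.assign 0 (.const 0)
    ⟨Function.update (RAM.init w).reg 1 (RAM.Term.value (RAM.init w) (.reg 0)), (RAM.init w).mem⟩
  have e : (⟨Function.update (Function.update (RAM.init w).reg 1
      (RAM.Term.value (RAM.init w) (.reg 0))) 0 0, (RAM.init w).mem⟩ : RAM.State)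
      = initState w := by
    simp only [initState, RAM.init, RAM.Term.value, if_true]
    congr 1
    funext x
    by_cases h0 : x = 0
    · subst h0; rfl
    · by_cases h1 : x = 1
      · subst h1; rfl
      · simp [h0, h1]
  rw [← e] at h
  have e' : w.length.size + t + 4 = w.length.size + 1 + 1 + (Nat.size 0 + 1 + 1 + t) := by
    have : Nat.size 0 = 0 := Nat.size_zero
    omega
  rw [e']
  exact h1.seq (h2.seq h)

section Instance

variable {n ℓ : ℕ} {G : SimpleGraph (Fin n)} {S : Finset (Fin n)}

/-- The store after reading the two numbers at the beginning of the input word. -/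
def readStore (w : List ℕ) : Store :=
  (set vEll (arr aIn (const 1))).run ((set vN (arr aIn (const 0))).run (initStore w))

theorem input_readStore :
    Input (lift G) n ℓ (liftSet S) (readStore (encodeInstance G S ℓ)) where
  hn := encodeInstance_zero (G := G) (S := S) (ℓ := ℓ)
  hl := encodeInstance_one (G := G) (S := S) (ℓ := ℓ)
  adj x y hx hy := by
    classical
    change (encodeInstance G S ℓ).getD (2 + (x * n + y)) 0 ≠ 0 ↔ _
    rw [encodeInstance_adj hx hy]
    simp
  set x hx := by
    classical
    change (encodeInstance G S ℓ).getD (2 + (n * n + x)) 0 ≠ 0 ↔ _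
    rw [encodeInstance_set hx]
    simp

/-- The loop program decides the problem. -/
theorem run_mainC (hS : IsClusterDeletionSet G S) :
    (HasConnectedVertexCover G ℓ →
      (mainC.run (initStore (encodeInstance G S ℓ))).v vAns = 1) ∧
    (¬ HasConnectedVertexCover G ℓ →
      (mainC.run (initStore (encodeInstance G S ℓ))).v vAns = 0) := by
  have hin := input_readStore (G := G) (S := S) (ℓ := ℓ)
  have hc := run_codesC hin
  have ag := run_agree codesC (readStore (encodeInstance G S ℓ))
  rw [hasConnectedVertexCover_iff]
  exact run_loopsC (hin.agree ag rfl) (fun _ _ => lift_adj_lt) (cluster_lift hS) liftSet_subset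
    (ag.1 vAns rfl) hc.1 hc.2

/-- The number of steps is `4 ^ |S|` up to a polynomial in `n`. -/
theorem steps_mainC : ∃ K d, ∀ (n ℓ : ℕ) (G : SimpleGraph (Fin n)) (S : Finset (Fin n)),
    mainC.steps (initStore (encodeInstance G S ℓ)) ≤ K * (n + 1) ^ d * 4 ^ S.card := by
  obtain ⟨K, d, hK⟩ := steps_loopsC
  refine ⟨K + 22, d + 1, fun n ℓ G S => ?_⟩
  have hin := input_readStore (G := G) (S := S) (ℓ := ℓ)
  have hc := run_codesC hin
  have ag := run_agree codesC (readStore (encodeInstance G S ℓ))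
  have h1 := steps_codesC hin
  have h2 := hK _ _ _ _ _ (hin.agree ag rfl) (fun _ _ => lift_adj_lt) hc.1 hc.2
  rw [count_liftSet] at h1 h2
  have hrun : mainC.steps (initStore (encodeInstance G S ℓ)) =
      1 + (1 + (codesC.steps (readStore (encodeInstance G S ℓ)) +
        loopsC.steps (codesC.run (readStore (encodeInstance G S ℓ))))) := rfl
  have hp : 1 ≤ 4 ^ S.card := Nat.one_le_pow _ _ (by omega)
  have h3 : n + 1 ≤ (n + 1) ^ (d + 1) := Nat.le_self_pow (by omega) _
  have h4 : (n + 1) ^ d ≤ (n + 1) ^ (d + 1) := Nat.pow_le_pow_right (by omega) (by omega)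
  calc _ ≤ 2 * 4 ^ S.card + ((12 * n + 20) * 4 ^ S.card + K * (n + 1) ^ d * 4 ^ S.card) := by
        rw [hrun]; omega
    _ = (22 + 12 * n + K * (n + 1) ^ d) * 4 ^ S.card := by ring
    _ ≤ _ := Nat.mul_le_mul_right _ (by nlinarith [Nat.mul_le_mul_left K h4])

theorem succ_le_inputSize : n + 1 ≤ RAM.inputSize (encodeInstance G S ℓ) := by
  have := length_le_inputSize (encodeInstance G S ℓ)
  rw [length_encodeInstance] at this
  nlinarith

/-- The binary length of all numbers that occur is polynomial: their values are at most
exponential in the size of the instance. -/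
theorem size_bound {K d n k N T : ℕ} (hT : T ≤ K * (n + 1) ^ d * 4 ^ k) (hn : n + 1 ≤ N)
    (hk : k ≤ n) : (2 ^ N + 4 * T + 2).size ≤ (K + d + 6) * N := by
  have hN : 1 ≤ N := by omega
  have h1 : T ≤ 2 ^ (K + d * N + 2 * N) := by
    calc T ≤ K * (n + 1) ^ d * 4 ^ k := hT
      _ ≤ 2 ^ K * (2 ^ N) ^ d * 4 ^ N := by
          gcongr
          · exact Nat.lt_two_pow_self.le
          · exact hn.trans Nat.lt_two_pow_self.le
          · omega
          · omega
      _ = _ := by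
          rw [show (4 : ℕ) = 2 ^ 2 by rfl, ← pow_mul, ← pow_mul, ← pow_add, ← pow_add]
          congr 1
          ring
  have h2 : K ≤ K * N := Nat.le_mul_of_pos_right _ hN
  set M := K + d * N + 2 * N with hM
  have h3 : 2 ^ N ≤ 2 ^ M := Nat.pow_le_pow_right (by omega) (by omega)
  have h4 : 2 ≤ 2 ^ M := Nat.le_self_pow (n := M) (by omega) 2
  have h5 : 2 ^ N + 4 * T + 2 < 2 ^ (M + 3) := by
    rw [pow_add]
    omega
  refine (Nat.size_le.2 h5).trans ?_
  nlinarith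

end Instance

end ConnVC

open ConnVC LoopLang in
theorem mainTheorem5 :
    ∃ (p : RAM.Program) (C d : ℕ),
      ∀ (n : ℕ) (G : SimpleGraph (Fin n)) (S : Finset (Fin n)) (ℓ : ℕ),
        IsClusterDeletionSet G S → 0 < ℓ →
          RAM.DecidesWithin p (encodeInstance G S ℓ) (HasConnectedVertexCover G ℓ)
            (C * 4 ^ S.card * RAM.inputSize (encodeInstance G S ℓ) ^ d) := by
  obtain ⟨A, hA⟩ := simulation mainC mainC_wf
  obtain ⟨K, d, hK⟩ := steps_mainC
  -- the summand `5` pays for the two assignments that precede the translated program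
  refine ⟨machine, A * K * (K + d + 6) ^ 2 + 5, d + 2, fun n G S ℓ hS _ => ?_⟩
  set w := encodeInstance G S ℓ
  set N := RAM.inputSize w with hN
  have hnN : n + 1 ≤ N := succ_le_inputSize
  have hN1 : 1 ≤ N := by omega
  obtain ⟨σ, t, he, hs, -, ht⟩ := hA _ _ _ (sim_init w) (below_init w) Nat.one_le_two_pow
  have hT := hK n ℓ G S
  have hk : S.card ≤ n := by simpa using S.card_le_univ
  have hsize := size_bound hT hnN hk
  have hp : 1 ≤ 4 ^ S.card := Nat.one_le_pow _ _ (by omega)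
  refine ⟨σ, _, exec_machine he, ?_, ?_⟩
  · have h1 : w.length.size ≤ N := by
      refine Nat.size_le.2 ((length_le_inputSize w).trans_lt Nat.lt_two_pow_self)
    have h2 : t ≤ A * (K * N ^ d * 4 ^ S.card) * ((K + d + 6) * N) ^ 2 := by
      refine ht.trans ?_
      gcongr
      exact hT.trans (by gcongr)
    have h3 : N ≤ N ^ (d + 2) := Nat.le_self_pow (by omega) _
    have h4 : N ^ (d + 2) ≤ 4 ^ S.card * N ^ (d + 2) := Nat.le_mul_of_pos_left _ hp
    calc w.length.size + t + 4 ≤ A * (K * N ^ d * 4 ^ S.card) * ((K + d + 6) * N) ^ 2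
          + 5 * (4 ^ S.card * N ^ (d + 2)) := by omega
      _ = _ := by ring
  · rw [hs.reg]
    exact run_mainC hS
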